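/- Use coordinates $(z,w)$ on $\mathbb C^2$. Let $(S,U)$ be a smooth Levi flat germ at $0$: $S\ni 0$ is a $C^\infty$ embedded real hypersurface in a domain $\mathcal U\subset\mathbb C^2$, foliated by complex curves, which divides $\mathcal U$ into two connected components and every point of which is adherent to both; $U$ is one of these components. Suppose that the complex tangent space of $S$ at $0$ is $H_0(S)=\{w=0\}$. Near $0$ the leaves of $S$ are graphs $$w=g(t,z)=\sum_{k\ge 0} b_k(t)z^k,\qquad |t|<\delta,\ |z|<\varepsilon,$$ where $t\in\mathbb R$, $g$ is $C^\infty$, holomorphic in $z$, with $g(0,0)=0$ and $\partial g/\partial t\ne0$, and $(t,z)\mapsto(z,g(t,z))$ maps bijectively onto a neighborhood of $0$ in $S$. Then $b_0$ parametrizes the curve $\gamma=S\cap\{z=0\}\subset\mathbb C_w$ near $0$; put $a_k(p)=b_k(b_0^{-1}(p))$ for $p\in\gamma$ near $0$, and let $U_0=U\cap\{z=0\}$. The germ $(S,U)$ is called trivial if there are open neighborhoods $\mathcal V_1,\mathcal V_2$ of $0$ in $\mathbb C^2$ and a biholomorphism $\Phi:\mathcal V_1\cap U\to\mathcal V_2\cap\{\operatorname{Im}w>0\}$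 which extends continuously to $\mathcal V_1\cap S$, in such a way that the extension restricts to a $C^\infty$ CR map from $\mathcal V_1\cap S$ to $\mathcal V_2\cap\{\operatorname{Im}w=0\}$. If $(S,U)$ is trivial, then there is a neighborhood $\mathcal W$ of $0$ in $\mathbb C^2$, independent of $k$ and of the choice of $g$, such that, first, $\mathcal W\cap S$ is covered by a single family of leaves $w=g(t,z)$ as above (so that the $a_k$ are defined on all of $\mathcal W\cap\gamma$), and, second, for each $k\ge1$ there is a function $f_k$ on $\mathcal W\cap(U_0\cup\gamma)$ that is holomorphic on $\mathcal W\cap U_0$, $C^\infty$ up to the boundary curve $\mathcal W\cap\gamma$, and equal to $a_k$ on $\mathcal W\cap\gamma$ (for every choice of $g$, wherever the resulting $a_k$ is defined). -/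

import Mathlib

open scoped ContDiff

namespace LeviFlat

/-- `S` is a `C^∞` embedded real hypersurface of `ℂ²`: near each of its points it is the zero set
of a smooth real function with non-vanishing differential. -/
def IsSmoothHypersurface (S : Set (ℂ × ℂ)) : Prop :=
  ∀ p ∈ S, ∃ (N : Set (ℂ × ℂ)) (ρ : ℂ × ℂ → ℝ),
    IsOpen N ∧ p ∈ N ∧ ContDiffOn ℝ ∞ ρ N ∧ (∀ q ∈ N, fderiv ℝ ρ q ≠ 0) ∧
      S ∩ N = {q ∈ N | ρ q = 0}

/-- `S` is foliated by complex curves: near each of its points there is a smooth foliation chart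
`ψ (t, ζ)`, an injective immersion onto an open piece of `S`, which is holomorphic in `ζ`; the
plaques are the complex curves `ζ ↦ ψ (t, ζ)`. -/
def IsFoliatedByComplexCurves (S : Set (ℂ × ℂ)) : Prop :=
  ∀ p ∈ S, ∃ (N : Set (ℂ × ℂ)) (r : ℝ) (ψ : ℝ × ℂ → ℂ × ℂ),
    IsOpen N ∧ p ∈ N ∧ 0 < r ∧ ψ (0, 0) = p ∧
      ContDiffOn ℝ ∞ ψ (Set.Ioo (-r) r ×ˢ Metric.ball 0 r) ∧
      Set.InjOn ψ (Set.Ioo (-r) r ×ˢ Metric.ball 0 r) ∧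
      (∀ x ∈ Set.Ioo (-r) r ×ˢ Metric.ball (0 : ℂ) r, Function.Injective (fderiv ℝ ψ x)) ∧
      (∀ t ∈ Set.Ioo (-r) r, DifferentiableOn ℂ (fun ζ => ψ (t, ζ)) (Metric.ball 0 r)) ∧
      ψ '' (Set.Ioo (-r) r ×ˢ Metric.ball 0 r) = S ∩ N

/-- `(S, U)` is a smooth Levi flat germ centered at `0`: `S` is a smooth Levi flat hypersurface
through `0` in a domain `𝒰` of `ℂ²`, which divides `𝒰` into the two connected components `U`
and `U'`, and every point of `S` is adherent to both of them. -/
def IsLeviFlatGerm (S U : Set (ℂ × ℂ)) : Prop :=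
  0 ∈ S ∧ IsSmoothHypersurface S ∧ IsFoliatedByComplexCurves S ∧
    ∃ 𝒰 U' : Set (ℂ × ℂ), IsOpen 𝒰 ∧ IsConnected 𝒰 ∧ S ⊆ 𝒰 ∧
      IsOpen U ∧ IsConnected U ∧ IsOpen U' ∧ IsConnected U' ∧ Disjoint U U' ∧
      𝒰 \ S = U ∪ U' ∧ S ⊆ closure U ∧ S ⊆ closure U'

/-- The complex tangent space `H_p(S) = T_p(S) ∩ i T_p(S)`. For a smooth hypersurface, Mathlib's
tangent cone over `ℝ` at a point is the tangent space. -/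
def complexTangent (S : Set (ℂ × ℂ)) (p : ℂ × ℂ) : Set (ℂ × ℂ) :=
  {v | v ∈ tangentConeAt ℝ S p ∧ Complex.I • v ∈ tangentConeAt ℝ S p}

/-- `Φ` restricts to a `C^∞` CR map on the open piece `V ∩ S` of the hypersurface `S`: the
differential of the restriction is complex linear on the complex tangent spaces. (Two derivatives
of `Φ` within `S` agree on the tangent vectors of `S`, so the choice of `L` does not matter.) -/
def IsSmoothCROn (Φ : ℂ × ℂ → ℂ × ℂ) (S V : Set (ℂ × ℂ)) : Prop :=
  ContDiffOn ℝ ∞ Φ (V ∩ S) ∧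
    ∀ p ∈ V ∩ S, ∃ L : ℂ × ℂ →L[ℝ] ℂ × ℂ, HasFDerivWithinAt Φ L (V ∩ S) p ∧
      ∀ v ∈ complexTangent S p, L (Complex.I • v) = Complex.I • L v

/-- `(S₁, U₁)` and `(S₂, U₂)` are (`C^∞`) locally equivalent at `0`: there are neighborhoods `𝒱₁`,
`𝒱₂` of `0` and a biholomorphism `Φ : 𝒱₁ ∩ U₁ → 𝒱₂ ∩ U₂` (with inverse `Ψ`) which extends
continuously to `𝒱₁ ∩ S₁` by a `C^∞` CR map from `𝒱₁ ∩ S₁` to `𝒱₂ ∩ S₂`. -/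
def LocallyEquivalent (S₁ U₁ S₂ U₂ : Set (ℂ × ℂ)) : Prop :=
  ∃ (𝒱₁ 𝒱₂ : Set (ℂ × ℂ)) (Φ Ψ : ℂ × ℂ → ℂ × ℂ),
    IsOpen 𝒱₁ ∧ 0 ∈ 𝒱₁ ∧ IsOpen 𝒱₂ ∧ 0 ∈ 𝒱₂ ∧
      Set.MapsTo Φ (𝒱₁ ∩ U₁) (𝒱₂ ∩ U₂) ∧ Set.MapsTo Ψ (𝒱₂ ∩ U₂) (𝒱₁ ∩ U₁) ∧
      Set.InvOn Ψ Φ (𝒱₁ ∩ U₁) (𝒱₂ ∩ U₂) ∧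
      DifferentiableOn ℂ Φ (𝒱₁ ∩ U₁) ∧ DifferentiableOn ℂ Ψ (𝒱₂ ∩ U₂) ∧
      ContinuousOn Φ (𝒱₁ ∩ (U₁ ∪ S₁)) ∧
      Set.MapsTo Φ (𝒱₁ ∩ S₁) (𝒱₂ ∩ S₂) ∧ IsSmoothCROn Φ S₁ 𝒱₁

/-- `(S, U)` is trivial: it is locally equivalent to the hyperplane `{Im w = 0}` with the side
`{Im w > 0}`. -/
def IsTrivial (S U : Set (ℂ × ℂ)) : Prop :=
  LocallyEquivalent S U {p | p.2.im = 0} {p | 0 < p.2.im}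

/-- The leaves of `S` near `0` are the graphs `w = g t z`, `|t| < δ`, `|z| < ε`: the map
`(t, z) ↦ (z, g t z)` is a smooth regular parametrization of the neighborhood `S ∩ N` of `0`
in `S`, holomorphic in `z`. -/
structure IsLeafParam (S : Set (ℂ × ℂ)) (δ ε : ℝ) (N : Set (ℂ × ℂ)) (g : ℝ → ℂ → ℂ) : Prop where
  pos_δ : 0 < δ
  pos_ε : 0 < ε
  isOpen : IsOpen N
  zero_mem : 0 ∈ N
  map_zero : g 0 0 = 0
  smooth : ContDiffOn ℝ ∞ (fun x : ℝ × ℂ => g x.1 x.2) (Set.Ioo (-δ) δ ×ˢ Metric.ball 0 ε)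
  holo : ∀ t ∈ Set.Ioo (-δ) δ, DifferentiableOn ℂ (g t) (Metric.ball 0 ε)
  regular : ∀ t ∈ Set.Ioo (-δ) δ, ∀ z ∈ Metric.ball (0 : ℂ) ε, deriv (fun s => g s z) t ≠ 0
  inj : Set.InjOn (fun x : ℝ × ℂ => (x.2, g x.1 x.2)) (Set.Ioo (-δ) δ ×ˢ Metric.ball 0 ε)
  image : (fun x : ℝ × ℂ => (x.2, g x.1 x.2)) '' (Set.Ioo (-δ) δ ×ˢ Metric.ball 0 ε) = S ∩ N

/-- The coefficient `b_k(t)` of the expansion `g t z = ∑ b_k(t) z^k`. -/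
noncomputable def paramCoeff (g : ℝ → ℂ → ℂ) (k : ℕ) (t : ℝ) : ℂ :=
  iteratedDeriv k (g t) 0 / (k.factorial : ℂ)

/-- The coefficient `a_k = b_k ∘ b_0⁻¹`, a function on the part of the curve
`γ = S ∩ {z = 0}` parametrized by `b_0 : (-δ, δ) → γ`. -/
noncomputable def leafCoeff (g : ℝ → ℂ → ℂ) (δ : ℝ) (k : ℕ) (p : ℂ) : ℂ :=
  paramCoeff g k (Function.invFunOn (paramCoeff g 0) (Set.Ioo (-δ) δ) p)

end LeviFlat

/-! Let `h` be the second component of the trivializing map `Φ`. It is holomorphic on the side `U`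
near `0`, has positive imaginary part there, and is real on `S`. A real CR function is constant
along complex curves, so `h (z, g t z) = χ t` depends on the leaf only. The plan is to prolong the
leaves into `U` as the level curves of `h`: for `w` in the slice `U₀`, let `G w z` be the solution
`w'` of `h (z, w') = h (0, w)`. If `z ↦ G w z` is defined on a disc not depending on `w`, then
`k!⁻¹` times the `k`-th derivative of `G w` at `0` is holomorphic in `w`, and on the curve `γ` it is
the leaf coefficient, because `G (g t 0) = g t`. The domain of `w` comes from `h` alone, hence does
not depend on `k`.

The difficulty is that `Φ` is only continuous up to `S`, and smooth only along `S`, so the implicit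
function theorem does not apply at `S`. Three facts of one variable replace it, applied to `h (z,
·)` with constants uniform in `z`. A Phragmén–Lindelöf principle (`norm_le_mul_pow_of_frontier`)
propagates the first order expansion along the boundary curve into the domain
(`BoundaryData.expansion`), so that by Cauchy's estimate the derivative of `h (z, ·)` tends to `χ' /
∂g/∂t` at a uniform rate. A Hopf lemma (`BoundaryData.deriv_ne_zero`) shows that this limit is not
zero at the origin. Hence `h (z, ·)` is Lipschitz close to one fixed linear map `w ↦ m w` up to the
boundary (`LeafFamily.exists_lipFamily`), which makes it injective, and surjective onto a half disc
of fixed size (`NearId.half_ball_subset_image`). This gives `G`, Lipschitz in `w` up to `γ`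
uniformly in `z`.

Smoothness of the coefficients up to `γ` is again a consequence of the boundary expansion: a
holomorphic function that is continuous up to the curve with smooth boundary values has a derivative
of the same kind, and one iterates (`SmoothBoundary.contDiffOn`).

To apply all this, a foliation chart is turned into a family of graphs (`exists_graph`), rescaled so
that `∂g/∂t` is close to `1`, and oriented so that `U` lies above the leaves
(`exists_oriented_leafGraph`). Any other parametrization has the same leaves as germs, because `χ`
separates leaves (`IsLeafParam.eventuallyEq`). -/

namespace LeviFlat
-- A Phragmén–Lindelöf principle at a boundary point.
open Set Metric Filter Topology Complex

/-- A Phragmén–Lindelöf principle at a boundary point: a bounded domain avoiding the ray going down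
from `p`, and a power bound on its frontier. -/
lemma norm_le_mul_pow_of_frontier {Ω : Set ℂ} (hb : Bornology.IsBounded Ω) {p : ℂ} (hp : p ∉ Ω)
    (hslit : ∀ w ∈ closure Ω, w ≠ p → -I * (w - p) ∈ slitPlane) {F : ℂ → ℂ}
    (hF : DiffContOnCl ℂ F Ω) {C : ℝ} (n : ℕ)
    (hC : ∀ w ∈ frontier Ω, ‖F w‖ ≤ C * ‖w - p‖ ^ n) :
    ∀ w ∈ closure Ω, ‖F w‖ ≤ C * ‖w - p‖ ^ n := by
  classical
  obtain ⟨M, hM⟩ := (hb.isCompact_closure.exists_bound_of_continuousOn hF.continuousOn)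
  have hcp : 0 < Real.cos (Real.pi / 4) := Real.cos_pos_of_mem_Ioo ⟨by linarith [Real.pi_pos], by linarith [Real.pi_pos]⟩
  set c := Real.cos (Real.pi / 4) with hc
  -- the real part of the barrier
  have hre : ∀ v ∈ slitPlane, c * ‖v‖ ^ (-(1/4) : ℝ) ≤ (v ^ (-(1/4) : ℂ)).re := by
    intro v hv
    have hv0 : v ≠ 0 := slitPlane_ne_zero hv
    have h1 : v ^ (-(1/4) : ℂ) = ((‖v‖ ^ (-(1/4) : ℝ) : ℝ) : ℂ) * exp ((-(v.arg/4) : ℝ) * I) := by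
      rw [cpow_def_of_ne_zero hv0, Complex.log, Real.rpow_def_of_pos (norm_pos_iff.2 hv0), ofReal_exp, ← Complex.exp_add]
      congr 1
      push_cast
      ring
    rw [h1, re_ofReal_mul, exp_ofReal_mul_I_re, mul_comm]
    gcongr
    rw [Real.cos_neg, ← Real.cos_abs (v.arg/4)]
    apply Real.cos_le_cos_of_nonneg_of_le_pi (abs_nonneg _) (by linarith [Real.pi_pos])
    have := abs_arg_le_pi v
    rw [abs_div, abs_of_pos (by norm_num : (0:ℝ) < 4)]
    linarith
  -- On the slit plane `|arg v| ≤ π`, so `v ^ (-1/4)` has argument at most `π/4` in absolute value.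
  -- The factor `exp (-δ v ^ (-1/4))`, with `v = -I (w - p)`, therefore has modulus at most `1` and
  -- decays at `p` faster than any power. It absorbs the pole of `F / (w - p) ^ n`, and the maximum
  -- principle applies to the product.
  have key : ∀ δ > 0, ∀ w ∈ closure Ω, w ≠ p →
      ‖F w / (w - p) ^ n * exp (-(δ : ℝ) * (-I * (w - p)) ^ (-(1/4) : ℂ))‖ ≤ C := by
    intro δ hδ
    set E : ℂ → ℂ := fun w => if w = p then 0 else
      F w / (w - p) ^ n * exp (-(δ : ℝ) * (-I * (w - p)) ^ (-(1/4) : ℂ)) with hE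
    have hEp : ∀ w, w ≠ p → E w = F w / (w - p) ^ n * exp (-(δ : ℝ) * (-I * (w - p)) ^ (-(1/4) : ℂ)) :=
      fun w hw => if_neg hw
    have hEn : ∀ w ∈ closure Ω, ‖E w‖ ≤ M * (‖w - p‖ ^ (-(n:ℝ)) * Real.exp (-(δ * c) * ‖w - p‖ ^ (-(1/4) : ℝ))) := by
      intro w hw
      have hM0 : 0 ≤ M := (norm_nonneg _).trans (hM w hw)
      by_cases hwp : w = p
      · simp only [hE, if_pos hwp, norm_zero]
        positivity
      · rw [hEp w hwp, norm_mul, norm_div, norm_pow, norm_exp]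
        have h2 := hre _ (hslit w hw hwp)
        have h3 : ‖-I * (w - p)‖ = ‖w - p‖ := by simp
        rw [h3] at h2
        rw [Real.rpow_neg (norm_nonneg _), Real.rpow_natCast, div_eq_mul_inv, mul_assoc]
        refine mul_le_mul (hM w hw) ?_ (by positivity) hM0
        refine mul_le_mul_of_nonneg_left ?_ (by positivity)
        apply Real.exp_le_exp.2
        have h4 : (-(δ : ℂ) * (-I * (w - p)) ^ (-(1/4) : ℂ)).re = - δ * ((-I * (w - p)) ^ (-(1/4) : ℂ)).re := by
          rw [← ofReal_neg, re_ofReal_mul]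
        rw [h4]
        nlinarith
    have hlim : Tendsto E (𝓝[closure Ω] p) (𝓝 0) := by
      have h1 : Tendsto (fun x : ℝ => x ^ (4 * (n:ℝ)) * Real.exp (-(δ * c) * x)) atTop (𝓝 0) :=
        tendsto_rpow_mul_exp_neg_mul_atTop_nhds_zero _ _ (by positivity)
      have h2 : Tendsto (fun r : ℝ => r ^ (-(1/4) : ℝ)) (𝓝[>] 0) atTop :=
        tendsto_rpow_neg_nhdsGT_zero (by norm_num)
      have h3 : Tendsto (fun r : ℝ => M * (r ^ (-(n:ℝ)) * Real.exp (-(δ * c) * r ^ (-(1/4) : ℝ)))) (𝓝[>] 0) (𝓝 0) := by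
        have := (h1.comp h2).const_mul M
        rw [mul_zero] at this
        refine this.congr' ?_
        filter_upwards [self_mem_nhdsWithin] with r hr
        have hr' : 0 ≤ r := le_of_lt hr
        simp only [Function.comp]
        rw [← Real.rpow_mul hr']
        congr 3
        ring
      have h4 : Tendsto (fun w : ℂ => ‖w - p‖) (𝓝[closure Ω \ {p}] p) (𝓝[>] 0) := by
        apply tendsto_nhdsWithin_of_tendsto_nhds_of_eventually_within
        · have : Tendsto (fun w : ℂ => ‖w - p‖) (𝓝 p) (𝓝 ‖p - p‖) := by
            apply Continuous.tendsto; fun_prop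
          rw [sub_self, norm_zero] at this
          exact this.mono_left nhdsWithin_le_nhds
        · filter_upwards [self_mem_nhdsWithin] with w hw
          exact norm_pos_iff.2 (sub_ne_zero.2 hw.2)
      have h5 : Tendsto E (𝓝[closure Ω \ {p}] p) (𝓝 0) := by
        apply squeeze_zero_norm' _ (h3.comp h4)
        filter_upwards [self_mem_nhdsWithin] with w hw using hEn w hw.1
      have h6 : Tendsto E (𝓝[{p}] p) (𝓝 0) := by
        rw [nhdsWithin_singleton]
        simp only [hE]
        rw [tendsto_pure_left]
        intro s hs
        simpa using mem_of_mem_nhds hs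
      refine (h5.sup h6).mono_left ?_
      rw [← nhdsWithin_union]
      exact nhdsWithin_mono _ (by intro x hx; by_cases h : x = p <;> simp [h, hx])
    have hopen : ∀ w, w ≠ p → E =ᶠ[𝓝 w] fun w => F w / (w - p) ^ n * exp (-(δ : ℝ) * (-I * (w - p)) ^ (-(1/4) : ℂ)) := by
      intro w hw
      filter_upwards [isOpen_ne.mem_nhds hw] with x hx using hEp x hx
    obtain ⟨B, hBdef⟩ : ∃ B : ℂ → ℂ, B = fun w => ((w - p) ^ n)⁻¹ *
      exp (-(δ : ℝ) * (-I * (w - p)) ^ (-(1/4) : ℂ)) := ⟨_, rfl⟩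
    have hB : ∀ w, w ≠ p → -I * (w - p) ∈ slitPlane → DifferentiableAt ℂ B w := by
      intro w hwp hs
      have h1 : DifferentiableAt ℂ (fun w => -I * (w - p)) w := by fun_prop
      have h2 : DifferentiableAt ℂ (fun w => (w - p) ^ n) w := by fun_prop
      rw [hBdef]
      exact (h2.inv (pow_ne_zero _ (sub_ne_zero.2 hwp))).mul
        ((h1.cpow_const hs).const_mul _).cexp
    have hEd : DiffContOnCl ℂ E Ω := by
      constructor
      · intro w hw
        have hwp : w ≠ p := fun h => hp (h ▸ hw)
        have hs := hslit w (subset_closure hw) hwp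
        refine DifferentiableWithinAt.congr_of_eventuallyEq ?_ ((hopen w hwp).filter_mono nhdsWithin_le_nhds) (hEp w hwp)
        have := (hF.differentiableOn w hw).mul (hB w hwp hs).differentiableWithinAt
        exact this.congr (fun x _ => by simp only [Pi.mul_apply, hBdef]; ring)
          (by simp only [Pi.mul_apply, hBdef]; ring)
      · intro w hw
        by_cases hwp : w = p
        · subst hwp
          unfold ContinuousWithinAt
          have : E w = 0 := by simp [hE]
          rw [this]
          exact hlim
        · have hs := hslit w hw hwp
          refine ContinuousWithinAt.congr_of_eventuallyEq ?_ ((hopen w hwp).filter_mono nhdsWithin_le_nhds) (hEp w hwp)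
          have := (hF.continuousOn w hw).mul (hB w hwp hs).continuousAt.continuousWithinAt
          exact this.congr (fun x _ => by simp only [Pi.mul_apply, hBdef]; ring)
            (by simp only [Pi.mul_apply, hBdef]; ring)
    intro w hw hwp
    -- If `C < 0`, the frontier is contained in `{p}`; the maximum principle for `z - p` then forces
    -- `w = p`.
    have hC0 : 0 ≤ C := by
      by_contra hneg
      push Not at hneg
      have hne : (frontier Ω ⊆ {p}) := by
        intro x hx
        by_contra hxp
        have := hC x hx
        have h1 : 0 < ‖x - p‖ ^ n := by
          have : 0 < ‖x - p‖ := norm_pos_iff.2 (sub_ne_zero.2 hxp)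
          positivity
        nlinarith [norm_nonneg (F x)]
      have hG : DiffContOnCl ℂ (fun z : ℂ => z - p) Ω := by
        apply Differentiable.diffContOnCl; fun_prop
      have := norm_le_of_forall_mem_frontier_norm_le hb hG (C := 0) (fun z hz => by
        rw [norm_le_zero_iff]; exact sub_eq_zero.2 (hne hz)) hw
      exact hwp (sub_eq_zero.1 (norm_le_zero_iff.1 this))
    have hfr : ∀ z ∈ frontier Ω, ‖E z‖ ≤ C := by
      intro z hz
      by_cases hzp : z = p
      · simpa [hE, hzp] using hC0
      · rw [hEp z hzp, norm_mul, norm_div, norm_pow, norm_exp]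
        have hz' : z ∈ closure Ω := frontier_subset_closure hz
        have h2 := hre _ (hslit z hz' hzp)
        have h4 : (-(δ : ℂ) * (-I * (z - p)) ^ (-(1/4) : ℂ)).re = - δ * ((-I * (z - p)) ^ (-(1/4) : ℂ)).re := by
          rw [← ofReal_neg, re_ofReal_mul]
        have h5 : 0 ≤ ((-I * (z - p)) ^ (-(1/4) : ℂ)).re := le_trans (by positivity) h2
        have h6 : 0 < ‖z - p‖ := norm_pos_iff.2 (sub_ne_zero.2 hzp)
        have h7 : ‖F z‖ / ‖z - p‖ ^ n ≤ C := by
          rw [div_le_iff₀ (by positivity)]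
          exact hC z hz
        calc _ ≤ C * 1 := by
              refine mul_le_mul h7 ?_ (Real.exp_nonneg _) hC0
              rw [h4, Real.exp_le_one_iff]
              nlinarith
          _ = C := mul_one C
    have := norm_le_of_forall_mem_frontier_norm_le hb hEd hfr hw
    rwa [hEp w hwp] at this
  intro w hw
  by_cases hwp : w = p
  · subst hwp
    by_cases hfr : w ∈ frontier Ω
    · exact hC w hfr
    · rw [closure_eq_interior_union_frontier] at hw
      exact absurd (interior_subset (hw.resolve_right hfr)) hp
  -- The bound `C` does not depend on `δ`, and the barrier tends to `1` as `δ → 0` at a fixed `w`.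
  · have h1 : Tendsto (fun δ : ℝ => ‖F w / (w - p) ^ n * exp (-(δ : ℝ) * (-I * (w - p)) ^ (-(1/4) : ℂ))‖)
        (𝓝[>] 0) (𝓝 ‖F w / (w - p) ^ n * exp (-((0:ℝ) : ℂ) * (-I * (w - p)) ^ (-(1/4) : ℂ))‖) := by
      refine Tendsto.mono_left (Continuous.tendsto ?_ 0) nhdsWithin_le_nhds
      fun_prop
    have h2 : ‖F w / (w - p) ^ n * exp (-((0:ℝ) : ℂ) * (-I * (w - p)) ^ (-(1/4) : ℂ))‖ ≤ C := by
      refine le_of_tendsto h1 ?_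
      filter_upwards [self_mem_nhdsWithin] with δ hδ using key δ hδ w hw hwp
    simp only [ofReal_zero, neg_zero, zero_mul, Complex.exp_zero, mul_one, norm_div, norm_pow] at h2
    have h6 : 0 < ‖w - p‖ := norm_pos_iff.2 (sub_ne_zero.2 hwp)
    rwa [div_le_iff₀ (by positivity)] at h2

end LeviFlat

/-! ### Curves close to the real line and first order expansions at the boundary. -/

namespace LeviFlat
open Set Metric Filter Topology Complex

/-- A curve that is uniformly close to the real line in the Lipschitz sense. -/
def NearId (b : ℝ → ℂ) : Prop := ∀ t t' : ℝ, ‖b t - b t' - ((t : ℂ) - t')‖ ≤ 1 / 8 * |t - t'|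

/-- The vertical shear taking the real line to the curve `b`. -/
noncomputable def shear (b : ℝ → ℂ) (ζ : ℂ) : ℂ := b ζ.re + ζ.im * I

/-- The open rectangle above the real line. -/
def rect (τ : ℝ) : Set ℂ := Ioo (-τ) τ ×ℂ Ioo 0 τ

/-- The rectangle together with its open lower side. -/
def halfRect (τ : ℝ) : Set ℂ := Ioo (-τ) τ ×ℂ Ico 0 τ

/-- The closed rectangle above the real line. -/
def closedRect (τ : ℝ) : Set ℂ := Icc (-τ) τ ×ℂ Icc 0 τ

lemma isOpen_rect (τ : ℝ) : IsOpen (rect τ) := isOpen_Ioo.reProdIm isOpen_Ioo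

lemma closure_rect {τ : ℝ} (hτ : 0 < τ) : closure (rect τ) = closedRect τ := by
  rw [rect, closure_reProdIm, closure_Ioo (by linarith), closure_Ioo hτ.ne, closedRect]

lemma rect_subset_halfRect (τ : ℝ) : rect τ ⊆ halfRect τ :=
  fun _ h => ⟨h.1, Ioo_subset_Ico_self h.2⟩

lemma halfRect_subset_closedRect (τ : ℝ) : halfRect τ ⊆ closedRect τ :=
  fun _ h => ⟨Ioo_subset_Icc_self h.1, Ico_subset_Icc_self h.2⟩

lemma mem_rect {τ : ℝ} {ζ : ℂ} : ζ ∈ rect τ ↔ |ζ.re| < τ ∧ 0 < ζ.im ∧ ζ.im < τ := by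
  rw [rect, mem_reProdIm, mem_Ioo, mem_Ioo, abs_lt]

lemma mem_halfRect {τ : ℝ} {ζ : ℂ} : ζ ∈ halfRect τ ↔ |ζ.re| < τ ∧ 0 ≤ ζ.im ∧ ζ.im < τ := by
  rw [halfRect, mem_reProdIm, mem_Ioo, mem_Ico, abs_lt]

lemma mem_closedRect {τ : ℝ} {ζ : ℂ} : ζ ∈ closedRect τ ↔ |ζ.re| ≤ τ ∧ 0 ≤ ζ.im ∧ ζ.im ≤ τ := by
  rw [closedRect, mem_reProdIm, mem_Icc, mem_Icc, abs_le]

@[simp] lemma shear_ofReal (b : ℝ → ℂ) (t : ℝ) : shear b t = b t := by simp [shear]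

lemma shear_add_mul_I (b : ℝ → ℂ) (t s : ℝ) : shear b (t + s * I) = b t + s * I := by
  simp [shear]

namespace NearId
variable {b : ℝ → ℂ}

lemma norm_shear_sub_sub_le (hb : NearId b) (ζ ζ' : ℂ) :
    ‖shear b ζ - shear b ζ' - (ζ - ζ')‖ ≤ 1 / 8 * ‖ζ - ζ'‖ := by
  have h1 : shear b ζ - shear b ζ' - (ζ - ζ') = b ζ.re - b ζ'.re - ((ζ.re : ℂ) - ζ'.re) := by
    nth_rewrite 2 [← re_add_im ζ]
    nth_rewrite 2 [← re_add_im ζ']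
    simp only [shear]
    ring
  rw [h1]
  refine (hb _ _).trans ?_
  have := abs_re_le_norm (ζ - ζ')
  rw [sub_re] at this
  linarith

lemma norm_shear_sub_ge (hb : NearId b) (ζ ζ' : ℂ) :
    7 / 8 * ‖ζ - ζ'‖ ≤ ‖shear b ζ - shear b ζ'‖ := by
  have h1 := hb.norm_shear_sub_sub_le ζ ζ'
  have h2 := norm_sub_norm_le (ζ - ζ') (shear b ζ - shear b ζ')
  rw [norm_sub_rev] at h1
  linarith

lemma norm_shear_sub_le (hb : NearId b) (ζ ζ' : ℂ) :
    ‖shear b ζ - shear b ζ'‖ ≤ 9 / 8 * ‖ζ - ζ'‖ := by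
  have h1 := hb.norm_shear_sub_sub_le ζ ζ'
  have h2 := norm_sub_norm_le (shear b ζ - shear b ζ') (ζ - ζ')
  linarith

lemma shear_injective (hb : NearId b) : Function.Injective (shear b) := by
  intro ζ ζ' h
  have := hb.norm_shear_sub_ge ζ ζ'
  rw [h, sub_self, norm_zero] at this
  rw [← sub_eq_zero, ← norm_le_zero_iff]
  linarith

lemma norm_sub_ge (hb : NearId b) (t t' : ℝ) : 7 / 8 * |t - t'| ≤ ‖b t - b t'‖ := by
  have := hb.norm_shear_sub_ge t t'
  rwa [shear_ofReal, shear_ofReal, ← ofReal_sub, norm_real, Real.norm_eq_abs] at this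

lemma approximatesLinearOn (hb : NearId b) : ApproximatesLinearOn (shear b)
    ((ContinuousLinearEquiv.refl ℝ ℂ : ℂ ≃L[ℝ] ℂ) : ℂ →L[ℝ] ℂ) univ (1 / 8) := by
  intro x _ y _
  simpa using hb.norm_shear_sub_sub_le x y

/-- The shear along a curve close to the real line is a homeomorphism of the plane. -/
noncomputable def homeo (hb : NearId b) : ℂ ≃ₜ ℂ :=
  hb.approximatesLinearOn.toHomeomorph _ (Or.inr (by
    have : ‖(((ContinuousLinearEquiv.refl ℝ ℂ).symm : ℂ ≃L[ℝ] ℂ) : ℂ →L[ℝ] ℂ)‖₊ = 1 := by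
      rw [← NNReal.coe_inj, coe_nnnorm]
      exact ContinuousLinearMap.norm_id
    rw [this, inv_one]
    rw [← NNReal.coe_lt_coe]
    norm_num))

lemma coe_homeo (hb : NearId b) : ⇑hb.homeo = shear b := rfl

lemma isOpen_image (hb : NearId b) {s : Set ℂ} (hs : IsOpen s) : IsOpen (shear b '' s) := by
  rw [← hb.coe_homeo]
  exact hb.homeo.isOpenMap s hs

lemma closure_image_rect (hb : NearId b) {τ : ℝ} (hτ : 0 < τ) :
    closure (shear b '' rect τ) = shear b '' closedRect τ := by
  rw [← hb.coe_homeo, ← hb.homeo.image_closure, closure_rect hτ]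

lemma continuous_shear (hb : NearId b) : Continuous (shear b) := hb.homeo.continuous

lemma surjective_shear (hb : NearId b) : Function.Surjective (shear b) := hb.homeo.surjective

lemma closedBall_subset (hb : NearId b) {ζ₀ : ℂ} {r : ℝ} :
    closedBall (shear b ζ₀) (7 / 8 * r) ⊆ shear b '' closedBall ζ₀ r := by
  intro w hw
  obtain ⟨ζ, rfl⟩ := hb.surjective_shear w
  refine ⟨ζ, ?_, rfl⟩
  rw [mem_closedBall, dist_eq_norm] at *
  linarith [hb.norm_shear_sub_ge ζ ζ₀]

lemma ball_subset (hb : NearId b) {ζ₀ : ℂ} {r : ℝ} :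
    ball (shear b ζ₀) (7 / 8 * r) ⊆ shear b '' ball ζ₀ r := by
  intro w hw
  obtain ⟨ζ, rfl⟩ := hb.surjective_shear w
  refine ⟨ζ, ?_, rfl⟩
  rw [mem_ball, dist_eq_norm] at *
  linarith [hb.norm_shear_sub_ge ζ ζ₀]

lemma norm_deriv_sub_one_le (hb : NearId b) {t : ℝ} {b' : ℂ} (h : HasDerivAt b b' t) :
    ‖b' - 1‖ ≤ 1 / 8 := by
  have h1 : HasDerivAt (fun t : ℝ => b t - (t : ℂ)) (b' - 1) t := h.sub (HasDerivAt.ofReal_comp (hasDerivAt_id t))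
  refine h1.le_of_lip' (by norm_num) (Eventually.of_forall fun x => ?_)
  have := hb x t
  rw [Real.norm_eq_abs]
  rwa [sub_sub_sub_comm]

lemma norm_deriv_ge (hb : NearId b) {t : ℝ} {b' : ℂ} (h : HasDerivAt b b' t) :
    7 / 8 ≤ ‖b'‖ := by
  have h1 := hb.norm_deriv_sub_one_le h
  have h2 := norm_sub_norm_le 1 b'
  rw [norm_sub_rev, norm_one] at h2
  linarith

/-- A first order expansion on the boundary curve propagates into the domain above the curve. -/
lemma norm_sub_affine_le (hb : NearId b) {τ : ℝ} (hτ : 0 < τ) {F : ℂ → ℂ}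
    (hF : DiffContOnCl ℂ F (shear b '' rect τ)) {M : ℝ}
    (hM : ∀ w ∈ shear b '' closedRect τ, ‖F w‖ ≤ M) {t₀ : ℝ} (ht₀ : |t₀| ≤ τ / 2) {m : ℂ} {C : ℝ}
    (hC0 : 0 ≤ C)
    (hC : ∀ t : ℝ, |t| ≤ τ → ‖F (b t) - F (b t₀) - m * (b t - b t₀)‖ ≤ C * ‖b t - b t₀‖ ^ 2) :
    ∀ w ∈ shear b '' closedRect τ, ‖F w - F (b t₀) - m * (w - b t₀)‖ ≤
      (C + 12 * M / τ ^ 2 + 3 * ‖m‖ / τ) * ‖w - b t₀‖ ^ 2 := by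
  have hmem : b t₀ ∈ shear b '' closedRect τ :=
    ⟨t₀, mem_closedRect.2 ⟨by simp; linarith, by simp, by simp; linarith⟩, by simp⟩
  have hM0 : 0 ≤ M := (norm_nonneg _).trans (hM _ hmem)
  rw [← hb.closure_image_rect hτ]
  refine norm_le_mul_pow_of_frontier (F := fun w => F w - F (b t₀) - m * (w - b t₀)) ?_ ?_ ?_ ?_ 2 ?_
  · refine (Bornology.IsBounded.subset ?_ subset_closure)
    rw [hb.closure_image_rect hτ]
    exact ((isCompact_Icc.reProdIm isCompact_Icc).image hb.continuous_shear).isBounded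
  · rintro ⟨ζ, hζ, h⟩
    rw [← shear_ofReal b] at h
    have := hb.shear_injective h
    rw [this] at hζ
    simpa using (mem_rect.1 hζ).2.1
  -- The ray going down from `b t₀` is the shear image of the vertical ray below `t₀`; by
  -- injectivity of the shear it meets the image of the closed rectangle only at `b t₀`.
  · rw [hb.closure_image_rect hτ]
    rintro _ ⟨ζ, hζ, rfl⟩ hne
    rw [mem_slitPlane_iff]
    by_contra! hcon
    obtain ⟨h1, h2⟩ := hcon
    simp only [neg_mul, neg_re, mul_re, I_re, zero_mul, I_im, one_mul, zero_sub, neg_neg,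
      neg_im, mul_im, zero_add, neg_eq_zero] at h1 h2
    have h3 : shear b ζ = shear b (t₀ + ((shear b ζ - b t₀).im : ℝ) * I) := by
      rw [shear_add_mul_I]
      have := re_add_im (shear b ζ - b t₀)
      rw [h2, ofReal_zero, zero_add] at this
      rw [this]; ring
    have h4 := hb.shear_injective h3
    have h5 : ζ.im = (shear b ζ - b t₀).im := by
      nth_rewrite 1 [h4]; simp
    have h6 := (mem_closedRect.1 hζ).2.1
    have h7 : (shear b ζ - b t₀).im = 0 := by linarith
    apply hne
    rw [h3, h7]; simp
  · refine (hF.sub diffContOnCl_const).sub ?_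
    exact Differentiable.diffContOnCl (by fun_prop)
  · intro w hw
    rw [← hb.coe_homeo, ← hb.homeo.image_frontier, hb.coe_homeo] at hw
    obtain ⟨ζ, hζ, rfl⟩ := hw
    rw [(isOpen_rect τ).frontier_eq, closure_rect hτ] at hζ
    obtain ⟨hζ1, hζ2⟩ := hζ
    have hFw := hM _ ⟨ζ, hζ1, rfl⟩
    have hF0 := hM _ hmem
    rw [mem_closedRect] at hζ1
    rw [mem_rect] at hζ2
    have e1 : 0 ≤ 12 * M / τ ^ 2 := by positivity
    have e2 : 0 ≤ 3 * ‖m‖ / τ := by positivity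
    by_cases him : ζ.im = 0
    · have : shear b ζ = b ζ.re := by simp [shear, him]
      rw [this]
      refine (hC _ hζ1.1).trans ?_
      refine mul_le_mul_of_nonneg_right (by linarith) (by positivity)
    -- On the other three sides the distance `D` to `b t₀` is at least `7/16 τ`, so the crude bound
    -- `2 M + ‖m‖ D` is already quadratic: `τ ^ 2 ≤ 6 D ^ 2` and `τ ≤ 3 D` give the constants `12`
    -- and `3`.
    · have hfar : τ / 2 ≤ ‖ζ - t₀‖ := by
        by_cases him' : ζ.im < τ
        · have h1 : τ ≤ |ζ.re| := by
            by_contra hlt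
            exact hζ2 ⟨not_le.1 hlt, lt_of_le_of_ne hζ1.2.1 (Ne.symm him), him'⟩
          have h2 := abs_re_le_norm (ζ - t₀)
          simp only [sub_re, ofReal_re] at h2
          have h3 := abs_sub_abs_le_abs_sub ζ.re t₀
          linarith
        · have h2 := abs_im_le_norm (ζ - t₀)
          simp only [sub_im, ofReal_im, sub_zero] at h2
          have := le_abs_self ζ.im
          linarith
      have hD := hb.norm_shear_sub_ge ζ t₀
      rw [shear_ofReal] at hD
      set D := ‖shear b ζ - b t₀‖ with hDdef
      have hD1 : 7 / 16 * τ ≤ D := by linarith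
      have hD0 : 0 < D := by nlinarith
      have h1 : ‖F (shear b ζ) - F (b t₀) - m * (shear b ζ - b t₀)‖ ≤ 2 * M + ‖m‖ * D := by
        refine (norm_sub_le _ _).trans ?_
        rw [norm_mul]
        have := norm_sub_le (F (shear b ζ)) (F (b t₀))
        linarith
      refine h1.trans ?_
      have h2 : 2 * M ≤ 12 * M / τ ^ 2 * D ^ 2 := by
        rw [div_mul_eq_mul_div, le_div_iff₀ (by positivity)]
        have : τ ^ 2 ≤ 6 * D ^ 2 := by nlinarith
        nlinarith
      have h3 : ‖m‖ * D ≤ 3 * ‖m‖ / τ * D ^ 2 := by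
        rw [div_mul_eq_mul_div, le_div_iff₀ (by positivity)]
        have : τ ≤ 3 * D := by linarith
        have h4 : 0 ≤ ‖m‖ * D := by positivity
        nlinarith
      have h4 : 0 ≤ C * D ^ 2 := by positivity
      linarith

/-- Second order contact along the curve: `b'` and `u'` are `L`-Lipschitz. -/
lemma norm_boundary_sub_affine_le (hb : NearId b) {τ L : ℝ} (hL : 0 ≤ L) {b' u u' : ℝ → ℂ}
    (hbd : ∀ t, |t| ≤ τ → HasDerivAt b (b' t) t) (hud : ∀ t, |t| ≤ τ → HasDerivAt u (u' t) t)
    (hbL : ∀ t t', |t| ≤ τ → |t'| ≤ τ → ‖b' t - b' t'‖ ≤ L * |t - t'|)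
    (huL : ∀ t t', |t| ≤ τ → |t'| ≤ τ → ‖u' t - u' t'‖ ≤ L * |t - t'|)
    {t t₀ : ℝ} (ht : |t| ≤ τ) (ht₀ : |t₀| ≤ τ) :
    ‖u t - u t₀ - u' t₀ / b' t₀ * (b t - b t₀)‖ ≤
      2 * (L + ‖u' t₀ / b' t₀‖ * L) * ‖b t - b t₀‖ ^ 2 := by
  set m := u' t₀ / b' t₀ with hm
  have hb0 : b' t₀ ≠ 0 := by
    intro h
    have := hb.norm_deriv_ge (hbd t₀ ht₀)
    rw [h, norm_zero] at this
    linarith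
  have hseg : ∀ x ∈ uIcc t₀ t, |x| ≤ τ ∧ |x - t₀| ≤ |t - t₀| := by
    intro x hx
    refine ⟨?_, abs_sub_left_of_mem_uIcc hx⟩
    have : uIcc t₀ t ⊆ Icc (-τ) τ := uIcc_subset_Icc (abs_le.1 ht₀) (abs_le.1 ht)
    exact abs_le.2 (this hx)
  -- The slope `m` is chosen so that `u - m b` has zero derivative at `t₀`; its derivative is then
  -- `O(|t - t₀|)` and the mean value inequality gives a quadratic bound. The factor `2` exceeds
  -- `(8/7) ^ 2`, the cost of replacing `|t - t₀|` by `‖b t - b t₀‖`.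
  have h1 : ∀ x ∈ uIcc t₀ t, HasDerivWithinAt (fun x => u x - m * b x) (u' x - m * b' x) (uIcc t₀ t) x :=
    fun x hx => ((hud x (hseg x hx).1).sub ((hbd x (hseg x hx).1).const_mul m)).hasDerivWithinAt
  have h2 : ∀ x ∈ uIcc t₀ t, ‖u' x - m * b' x‖ ≤ (L + ‖m‖ * L) * |t - t₀| := by
    intro x hx
    have e : u' x - m * b' x = (u' x - u' t₀) - m * (b' x - b' t₀) := by
      have : m * b' t₀ = u' t₀ := by rw [hm]; field_simp
      linear_combination -this
    rw [e]
    refine (norm_sub_le _ _).trans ?_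
    rw [norm_mul]
    have a1 := huL x t₀ (hseg x hx).1 ht₀
    have a2 := hbL x t₀ (hseg x hx).1 ht₀
    have a3 := (hseg x hx).2
    have a4 : L * |x - t₀| ≤ L * |t - t₀| := mul_le_mul_of_nonneg_left a3 hL
    have a5 : ‖m‖ * ‖b' x - b' t₀‖ ≤ ‖m‖ * (L * |t - t₀|) :=
      mul_le_mul_of_nonneg_left (a2.trans a4) (norm_nonneg _)
    nlinarith
  have h3 := (convex_uIcc t₀ t).norm_image_sub_le_of_norm_hasDerivWithin_le h1 h2
    left_mem_uIcc right_mem_uIcc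
  have e : u t - u t₀ - m * (b t - b t₀) = (u t - m * b t) - (u t₀ - m * b t₀) := by ring
  rw [e]
  refine h3.trans ?_
  have h4 := hb.norm_sub_ge t t₀
  have h5 : |t - t₀| * |t - t₀| ≤ 2 * ‖b t - b t₀‖ ^ 2 := by
    nlinarith [abs_nonneg (t - t₀)]
  have h6 : 0 ≤ L + ‖m‖ * L := by positivity
  rw [Real.norm_eq_abs, mul_assoc]
  nlinarith

end NearId

/-- Data controlled by `L`, `M` on the shear image of the rectangle of size `τ`: a function `F`,
holomorphic inside, with boundary values `u`. -/
structure BoundaryData (b b' : ℝ → ℂ) (F : ℂ → ℂ) (u u' : ℝ → ℂ) (τ L M : ℝ) : Prop where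
  nearId : NearId b
  pos : 0 < τ
  nonneg : 0 ≤ L
  hasDerivAt_b : ∀ t, |t| ≤ τ → HasDerivAt b (b' t) t
  hasDerivAt_u : ∀ t, |t| ≤ τ → HasDerivAt u (u' t) t
  lip_b : ∀ t t', |t| ≤ τ → |t'| ≤ τ → ‖b' t - b' t'‖ ≤ L * |t - t'|
  lip_u : ∀ t t', |t| ≤ τ → |t'| ≤ τ → ‖u' t - u' t'‖ ≤ L * |t - t'|
  bound_u : ∀ t, |t| ≤ τ → ‖u' t‖ ≤ M
  holo : DifferentiableOn ℂ F (shear b '' rect τ)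
  cont : ContinuousOn F (shear b '' closedRect τ)
  bound : ∀ w ∈ shear b '' closedRect τ, ‖F w‖ ≤ M
  boundary : ∀ t : ℝ, |t| ≤ τ → F (b t) = u t

/-- The constant of the boundary expansions. -/
noncomputable def expansionConst (τ L M : ℝ) : ℝ :=
  2 * (L + 2 * M * L) + 12 * M / τ ^ 2 + 3 * (2 * M) / τ

namespace BoundaryData
variable {b b' : ℝ → ℂ} {F : ℂ → ℂ} {u u' : ℝ → ℂ} {τ L M : ℝ}

lemma nonneg_M (h : BoundaryData b b' F u u' τ L M) : 0 ≤ M :=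
  (norm_nonneg _).trans (h.bound_u 0 (by simpa using h.pos.le))

lemma expansionConst_nonneg (h : BoundaryData b b' F u u' τ L M) : 0 ≤ expansionConst τ L M := by
  have := h.nonneg_M
  have := h.nonneg
  have := h.pos
  unfold expansionConst
  positivity

lemma ne_zero (h : BoundaryData b b' F u u' τ L M) {t : ℝ} (ht : |t| ≤ τ) : b' t ≠ 0 := by
  intro h0
  have := h.nearId.norm_deriv_ge (h.hasDerivAt_b t ht)
  rw [h0, norm_zero] at this
  linarith

lemma norm_div_le (h : BoundaryData b b' F u u' τ L M) {t : ℝ} (ht : |t| ≤ τ) :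
    ‖u' t / b' t‖ ≤ 2 * M := by
  have h1 := h.nearId.norm_deriv_ge (h.hasDerivAt_b t ht)
  rw [norm_div, div_le_iff₀ (by linarith)]
  nlinarith [h.bound_u t ht, h.nonneg_M]

lemma diffContOnCl (h : BoundaryData b b' F u u' τ L M) : DiffContOnCl ℂ F (shear b '' rect τ) :=
  ⟨h.holo, by rw [h.nearId.closure_image_rect h.pos]; exact h.cont⟩

/-- Second order contact along the curve is carried inside by `NearId.norm_sub_affine_le`. The
constant depends on `τ`, `L`, `M` only, since the slope is at most `2 M`; this uniformity is what
later allows a parameter `z`. -/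
lemma expansion (h : BoundaryData b b' F u u' τ L M) {t₀ : ℝ} (ht₀ : |t₀| ≤ τ / 2) :
    ∀ w ∈ shear b '' closedRect τ, ‖F w - u t₀ - u' t₀ / b' t₀ * (w - b t₀)‖ ≤
      expansionConst τ L M * ‖w - b t₀‖ ^ 2 := by
  have hpos := h.pos
  have ht₀' : |t₀| ≤ τ := by linarith
  have hm := h.norm_div_le ht₀'
  have hL := h.nonneg
  have hM := h.nonneg_M
  rw [← h.boundary t₀ ht₀']
  intro w hw
  refine (h.nearId.norm_sub_affine_le hpos h.diffContOnCl h.bound ht₀ (m := u' t₀ / b' t₀)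
    (C := 2 * (L + 2 * M * L)) (by positivity) ?_ w hw).trans ?_
  · intro t ht
    rw [h.boundary t ht, h.boundary t₀ ht₀']
    refine (h.nearId.norm_boundary_sub_affine_le hL h.hasDerivAt_b h.hasDerivAt_u h.lip_b h.lip_u
      ht ht₀').trans ?_
    gcongr
  · unfold expansionConst
    gcongr

lemma closedBall_subset (h : BoundaryData b b' F u u' τ L M) {t₀ s : ℝ} (ht₀ : |t₀| ≤ τ / 2)
    (hs : 0 < s) (hs' : s ≤ τ / 4) : closedBall (b t₀ + s * I) (s / 2) ⊆ shear b '' rect τ := by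
  have hpos := h.pos
  rw [← shear_add_mul_I]
  refine (closedBall_subset_closedBall (by linarith : s / 2 ≤ 7 / 8 * (4 / 7 * s))).trans
    (h.nearId.closedBall_subset.trans (image_mono ?_))
  intro ζ hζ
  rw [mem_closedBall, dist_eq_norm] at hζ
  have h1 := (abs_re_le_norm _).trans hζ
  have h2 := (abs_im_le_norm _).trans hζ
  simp only [sub_re, add_re, ofReal_re, mul_re, I_re, mul_zero, ofReal_im, I_im, mul_one, sub_self,
    add_zero, sub_im, add_im, mul_im, zero_add] at h1 h2
  rw [mem_rect]
  rw [abs_le] at h1 h2 ht₀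
  refine ⟨abs_lt.2 ⟨by linarith, by linarith⟩, by linarith, by linarith⟩

/-- Cauchy's estimate for the remainder of `expansion` on the circle of radius `s / 2`: there the
remainder is at most `K (3 s / 2) ^ 2`, and dividing by `s / 2` gives `9/2 K s`. -/
lemma norm_deriv_sub_le (h : BoundaryData b b' F u u' τ L M) {t₀ s : ℝ} (ht₀ : |t₀| ≤ τ / 2)
    (hs : 0 < s) (hs' : s ≤ τ / 4) :
    ‖deriv F (b t₀ + s * I) - u' t₀ / b' t₀‖ ≤ 5 * expansionConst τ L M * s := by
  have hsub := h.closedBall_subset ht₀ hs hs'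
  have hK := h.expansionConst_nonneg
  set K := expansionConst τ L M
  have hopen := h.nearId.isOpen_image (isOpen_rect τ)
  have hd : ∀ w ∈ closedBall (b t₀ + s * I) (s / 2), DifferentiableAt ℂ F w := fun w hw =>
    h.holo.differentiableAt (hopen.mem_nhds (hsub hw))
  set R : ℂ → ℂ := fun w => F w - u t₀ - u' t₀ / b' t₀ * (w - b t₀)
  have hR : DifferentiableOn ℂ R (closedBall (b t₀ + s * I) (s / 2)) := fun w hw =>
    (((hd w hw).sub (by fun_prop)).sub (by fun_prop)).differentiableWithinAt
  have hRd : deriv R (b t₀ + s * I) = deriv F (b t₀ + s * I) - u' t₀ / b' t₀ := by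
    have h1 := (hd _ (mem_closedBall_self (by positivity))).hasDerivAt
    have h2 : HasDerivAt (fun w => u' t₀ / b' t₀ * (w - b t₀)) (u' t₀ / b' t₀ * 1) (b t₀ + s * I) :=
      ((hasDerivAt_id _).sub_const _).const_mul _
    rw [mul_one] at h2
    exact ((h1.sub_const _).sub h2).deriv
  rw [← hRd]
  have hcl : DiffContOnCl ℂ R (ball (b t₀ + s * I) (s / 2)) := by
    apply DifferentiableOn.diffContOnCl
    rwa [closure_ball _ (by positivity)]
  have hbound : ∀ w ∈ sphere (b t₀ + s * I) (s / 2), ‖R w‖ ≤ K * (3 / 2 * s) ^ 2 := by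
    intro w hw
    refine (h.expansion ht₀ w (image_mono ?_ (hsub (sphere_subset_closedBall hw)))).trans ?_
    · exact (rect_subset_halfRect τ).trans (halfRect_subset_closedRect τ)
    · have : ‖w - b t₀‖ ≤ 3 / 2 * s := by
        rw [mem_sphere, dist_eq_norm] at hw
        have e : w - b t₀ = (w - (b t₀ + s * I)) + s * I := by ring
        rw [e]
        refine (norm_add_le _ _).trans ?_
        rw [hw]
        simp [abs_of_pos hs]
        linarith
      gcongr
  refine (norm_deriv_le_of_forall_mem_sphere_norm_le (by positivity) hcl hbound).trans ?_
  rw [div_le_iff₀ (by positivity)]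
  have : 0 ≤ K * s ^ 2 := by positivity
  nlinarith

end BoundaryData
end LeviFlat

/-! ### Harnack's inequality and a Hopf lemma. -/

namespace LeviFlat
open Set Metric Filter Topology Complex

/-- Harnack's inequality for the imaginary part of a holomorphic function. -/
lemma harnack_im {f : ℂ → ℂ} {c z : ℂ} {R r : ℝ} (hR : 0 < R)
    (hf : DifferentiableOn ℂ f (ball c R)) (him : ∀ w ∈ ball c R, 0 < (f w).im)
    (hz : dist z c ≤ r * R) (hr0 : 0 ≤ r) (hr : r < 1) :
    (1 - r) * (f c).im ≤ (1 + r) * (f z).im := by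
  have hc : c ∈ ball c R := mem_ball_self hR
  have hzb : z ∈ ball c R := by
    rw [mem_ball]
    exact hz.trans_lt (by nlinarith)
  have hyc := him c hc
  set a := f c with ha
  have hden : ∀ w ∈ ball c R, f w - (starRingEnd ℂ) a ≠ 0 := by
    intro w hw h
    have h1 := congrArg Complex.im h
    simp only [sub_im, conj_im, zero_im] at h1
    linarith [him w hw]
  -- The Cayley transform sends the upper half plane to the unit disc and `f c` to `0`; the Schwarz
  -- lemma bounds it at `z` by `r`.
  set ψ : ℂ → ℂ := fun w => (f w - a) / (f w - (starRingEnd ℂ) a) with hψ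
  have hψd : DifferentiableOn ℂ ψ (ball c R) :=
    (hf.sub_const _).div (hf.sub_const _) hden
  have hψc : ψ c = 0 := by simp [hψ, ha]
  have hmaps : MapsTo ψ (ball c R) (closedBall (ψ c) 1) := by
    intro w hw
    rw [hψc, mem_closedBall, dist_zero_right, hψ, norm_div]
    refine div_le_one_of_le₀ ?_ (norm_nonneg _)
    rw [← sq_le_sq₀ (norm_nonneg _) (norm_nonneg _), ← normSq_eq_norm_sq, ← normSq_eq_norm_sq,
      normSq_apply, normSq_apply]
    simp only [sub_re, sub_im, conj_re, conj_im]
    nlinarith [him w hw]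
  have h1 := dist_le_div_mul_dist_of_mapsTo_ball hψd hmaps hzb
  rw [hψc, dist_zero_right] at h1
  have h2 : ‖ψ z‖ ≤ r := h1.trans (by
    rw [one_div, inv_mul_le_iff₀ hR]; linarith)
  have hz0 := him z hzb
  rw [hψ, norm_div, div_le_iff₀ (norm_pos_iff.2 (hden z hzb)),
    ← sq_le_sq₀ (norm_nonneg _) (by positivity), mul_pow, ← normSq_eq_norm_sq, ← normSq_eq_norm_sq,
      normSq_apply, normSq_apply] at h2
  simp only [sub_re, sub_im, conj_re, conj_im] at h2
  by_contra! hcon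
  have h3 : 0 < (a.im - (f z).im) - r * ((f z).im + a.im) := by linarith
  have h4 : 0 ≤ r * ((f z).im + a.im) := by positivity
  have h5 : (r * ((f z).im + a.im)) ^ 2 < (a.im - (f z).im) ^ 2 := by
    apply pow_lt_pow_left₀ (by linarith) h4 (by norm_num)
  have h6 : r ^ 2 ≤ 1 := by nlinarith
  have h7 : 0 ≤ (1 - r ^ 2) * ((f z).re - a.re) ^ 2 := mul_nonneg (by linarith) (sq_nonneg _)
  nlinarith

namespace BoundaryData
variable {b b' : ℝ → ℂ} {F : ℂ → ℂ} {u u' : ℝ → ℂ} {τ L M : ℝ}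

/-- A Hopf lemma: a holomorphic function to the upper half plane with real boundary values has
non-vanishing derivative at the boundary. -/
lemma deriv_ne_zero (h : BoundaryData b b' F u u' τ L M) (hre : (u 0).im = 0)
    (him : ∀ w ∈ shear b '' rect τ, 0 < (F w).im) : u' 0 ≠ 0 := by
  intro h0
  have hτ := h.pos
  have h00 : |(0 : ℝ)| ≤ τ / 2 := by simp; positivity
  have hmem : ∀ s : ℝ, 0 < s → s ≤ τ / 4 → b 0 + s * I ∈ shear b '' rect τ := fun s hs hs' =>
    h.closedBall_subset h00 hs hs' (mem_closedBall_self (by positivity))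
  -- Halving the height costs at most the Harnack factor `(1 - 4/7) / (1 + 4/7) = 3/11`, where `4/7
  -- = (s/2) / (7s/8)`. If `u' 0 = 0`, the expansion bounds the imaginary part by a multiple of `s ^
  -- 2`, which shrinks by `1/4` at each halving. Since `3/11 > 1/4`, the two are incompatible.
  have hhalf : ∀ s : ℝ, 0 < s → s ≤ τ / 4 →
      3 / 11 * (F (b 0 + s * I)).im ≤ (F (b 0 + (s / 2 : ℝ) * I)).im := by
    intro s hs hs'
    have hsub : ball (b 0 + s * I) (7 / 8 * s) ⊆ shear b '' rect τ := by
      have e : b 0 + s * I = shear b ((0 : ℝ) + s * I) := by rw [shear_add_mul_I]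
      rw [e]
      refine h.nearId.ball_subset.trans (image_mono ?_)
      intro ζ hζ
      rw [mem_ball, dist_eq_norm] at hζ
      have h1 := (abs_re_le_norm _).trans_lt hζ
      have h2 := (abs_im_le_norm _).trans_lt hζ
      simp only [sub_re, add_re, ofReal_re, mul_re, I_re, mul_zero, ofReal_im, I_im, mul_one,
        sub_self, add_zero, sub_im, add_im, mul_im, zero_add, sub_zero] at h1 h2
      rw [abs_lt] at h2
      rw [mem_rect]
      exact ⟨by linarith, by linarith, by linarith⟩
    have := harnack_im (f := F) (c := b 0 + s * I) (z := b 0 + (s / 2 : ℝ) * I) (R := 7 / 8 * s)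
      (r := 4 / 7) (by positivity) (h.holo.mono hsub) (fun w hw => him w (hsub hw)) ?_
      (by norm_num) (by norm_num)
    · linarith
    · have e : b 0 + (s / 2 : ℝ) * I - (b 0 + s * I) = ((-(s / 2) : ℝ) : ℂ) * I := by
        push_cast; ring
      rw [dist_eq_norm, e, norm_mul, norm_I, mul_one, norm_real, Real.norm_eq_abs, abs_neg,
        abs_of_pos (by positivity)]
      linarith
  set s₀ := τ / 4 with hs₀
  have hs₀pos : 0 < s₀ := by positivity
  set y := (F (b 0 + s₀ * I)).im with hy
  have hy0 : 0 < y := him _ (hmem s₀ hs₀pos le_rfl)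
  have hsn : ∀ n : ℕ, 0 < s₀ / 2 ^ n ∧ s₀ / 2 ^ n ≤ s₀ := fun n =>
    ⟨by positivity, div_le_self hs₀pos.le (one_le_pow₀ (by norm_num))⟩
  have hlow : ∀ n : ℕ, (3 / 11) ^ n * y ≤ (F (b 0 + (s₀ / 2 ^ n : ℝ) * I)).im := by
    intro n
    induction n with
    | zero => simp [hy]
    | succ n ih =>
      have h1 := hhalf _ (hsn n).1 (hsn n).2
      have e : s₀ / 2 ^ (n + 1) = s₀ / 2 ^ n / 2 := by rw [pow_succ]; field_simp
      rw [e, pow_succ]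
      linarith
  have hup : ∀ n : ℕ, (F (b 0 + (s₀ / 2 ^ n : ℝ) * I)).im ≤
      expansionConst τ L M * (s₀ / 2 ^ n) ^ 2 := by
    intro n
    have h1 := h.expansion h00 _ (image_mono ((rect_subset_halfRect τ).trans
      (halfRect_subset_closedRect τ)) (hmem _ (hsn n).1 (hsn n).2))
    rw [h0, zero_div, zero_mul, sub_zero, add_sub_cancel_left, norm_mul, norm_I, mul_one, norm_real,
      Real.norm_eq_abs, abs_of_pos (hsn n).1] at h1
    have h2 := (le_abs_self _).trans ((abs_im_le_norm _).trans h1)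
    rwa [sub_im, hre, sub_zero] at h2
  obtain ⟨n, hn⟩ := pow_unbounded_of_one_lt (expansionConst τ L M * s₀ ^ 2 / y)
    (by norm_num : (1 : ℝ) < 12 / 11)
  rw [div_lt_iff₀ hy0] at hn
  have h1 := (hlow n).trans (hup n)
  have e : (s₀ / 2 ^ n) ^ 2 = s₀ ^ 2 * (1 / 4) ^ n := by
    rw [div_pow, ← pow_mul, mul_comm n 2, pow_mul, one_div, inv_pow]
    norm_num
    rfl
  have e2 : (3 / 11 : ℝ) ^ n = (12 / 11) ^ n * (1 / 4) ^ n := by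
    rw [← mul_pow]; norm_num
  rw [e, e2] at h1
  have h4 : (0 : ℝ) < (1 / 4) ^ n := by positivity
  nlinarith

end BoundaryData

/-! ### Smoothness up to the boundary. -/

lemma NearId.translate {b : ℝ → ℂ} (hb : NearId b) (t₁ : ℝ) : NearId fun t => b (t₁ + t) := by
  intro t t'
  have := hb (t₁ + t) (t₁ + t')
  rw [add_sub_add_left_eq_sub] at this
  push_cast at this
  rwa [add_sub_add_left_eq_sub] at this

lemma shear_translate (b : ℝ → ℂ) (t₁ : ℝ) (ζ : ℂ) :
    shear (fun t => b (t₁ + t)) ζ = shear b (t₁ + ζ) := by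
  simp [shear]

/-- A function holomorphic above a curve, continuous up to it. -/
structure SmoothBoundary (b : ℝ → ℂ) (τ : ℝ) (F : ℂ → ℂ) : Prop where
  nearId : NearId b
  pos : 0 < τ
  smooth_b : ContDiffOn ℝ ∞ b (Ioo (-τ) τ)
  cont : ContinuousOn F (shear b '' halfRect τ)
  holo : DifferentiableOn ℂ F (shear b '' rect τ)
  smooth_u : ContDiffOn ℝ ∞ (fun t : ℝ => F (b t)) (Ioo (-τ) τ)

lemma exists_deriv_lipschitz {v : ℝ → ℂ} {s : Set ℝ} (hs : IsOpen s) (hv : ContDiffOn ℝ ∞ v s)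
    {a c : ℝ} (hac : Icc a c ⊆ s) :
    ∃ L : ℝ, 0 ≤ L ∧ ∀ t ∈ Icc a c, ∀ t' ∈ Icc a c, ‖deriv v t - deriv v t'‖ ≤ L * |t - t'| := by
  have h1 : ContDiffOn ℝ ∞ (deriv v) s := hv.deriv_of_isOpen hs (by simp)
  obtain ⟨K, hK⟩ := (h1.mono hac).exists_lipschitzOnWith (by simp) (convex_Icc a c) isCompact_Icc
  refine ⟨K, K.2, fun t ht t' ht' => ?_⟩
  have := hK.dist_le_mul t ht t' ht'
  rwa [dist_eq_norm, Real.dist_eq] at this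

namespace SmoothBoundary
variable {b : ℝ → ℂ} {τ : ℝ} {F : ℂ → ℂ}

/-- Moves a point of the curve to parameter `0` and reads off the constants `L`, `M` by compactness,
so that the quantitative estimates apply near every boundary point. -/
lemma exists_boundaryData (h : SmoothBoundary b τ F) {t₁ : ℝ} (ht₁ : t₁ ∈ Ioo (-τ) τ) :
    ∃ ρ L M : ℝ, |t₁| + ρ < τ ∧ BoundaryData (fun t => b (t₁ + t)) (fun t => deriv b (t₁ + t)) F
      (fun t => F (b (t₁ + t))) (fun t => deriv (fun t : ℝ => F (b t)) (t₁ + t)) ρ L M := by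
  set u : ℝ → ℂ := fun t => F (b t) with hu
  set ρ := (τ - |t₁|) / 2 with hρ
  have ht₁' := abs_lt.2 ht₁
  have hρ0 : 0 < ρ := by rw [hρ]; linarith
  have hlt : |t₁| + ρ < τ := by rw [hρ]; linarith
  have hin : ∀ t, |t| ≤ ρ → t₁ + t ∈ Icc (t₁ - ρ) (t₁ + ρ) := fun t ht => by
    rw [abs_le] at ht; exact ⟨by linarith, by linarith⟩
  have hsub : Icc (t₁ - ρ) (t₁ + ρ) ⊆ Ioo (-τ) τ := fun t ht => by
    have := neg_abs_le t₁
    have := le_abs_self t₁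
    exact ⟨by linarith [ht.1], by linarith [ht.2]⟩
  obtain ⟨L₁, hL₁, hL₁'⟩ := exists_deriv_lipschitz isOpen_Ioo h.smooth_b hsub
  obtain ⟨L₂, hL₂, hL₂'⟩ := exists_deriv_lipschitz isOpen_Ioo h.smooth_u hsub
  have hderiv : ∀ v : ℝ → ℂ, ContDiffOn ℝ ∞ v (Ioo (-τ) τ) → ∀ t, |t| ≤ ρ →
      HasDerivAt (fun t => v (t₁ + t)) (deriv v (t₁ + t)) t := by
    intro v hv t ht
    have h1 : HasDerivAt v (deriv v (t₁ + t)) (t₁ + t) :=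
      ((hv.differentiableOn (by simp)).differentiableAt
        (isOpen_Ioo.mem_nhds (hsub (hin t ht)))).hasDerivAt
    simpa using h1.comp_const_add t₁ t
  have himg : shear (fun t => b (t₁ + t)) '' closedRect ρ ⊆ shear b '' halfRect τ := by
    rintro _ ⟨ζ, hζ, rfl⟩
    rw [mem_closedRect] at hζ
    refine ⟨t₁ + ζ, ?_, (shear_translate b t₁ ζ).symm⟩
    rw [mem_halfRect]
    simp only [add_re, ofReal_re, add_im, ofReal_im, zero_add]
    have := abs_add_le t₁ ζ.re
    have := abs_nonneg t₁
    exact ⟨by linarith, hζ.2.1, by linarith⟩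
  have himg' : shear (fun t => b (t₁ + t)) '' rect ρ ⊆ shear b '' rect τ := by
    rintro _ ⟨ζ, hζ, rfl⟩
    rw [mem_rect] at hζ
    refine ⟨t₁ + ζ, ?_, (shear_translate b t₁ ζ).symm⟩
    rw [mem_rect]
    simp only [add_re, ofReal_re, add_im, ofReal_im, zero_add]
    have := abs_add_le t₁ ζ.re
    have := abs_nonneg t₁
    exact ⟨by linarith, hζ.2.1, by linarith⟩
  have hcpt : IsCompact (shear (fun t => b (t₁ + t)) '' closedRect ρ) :=
    (isCompact_Icc.reProdIm isCompact_Icc).image (h.nearId.translate t₁).continuous_shear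
  obtain ⟨M₁, hM₁⟩ := hcpt.exists_bound_of_continuousOn (h.cont.mono himg)
  have hdu : ContinuousOn (deriv u) (Icc (t₁ - ρ) (t₁ + ρ)) :=
    (h.smooth_u.continuousOn_deriv_of_isOpen isOpen_Ioo (by simp)).mono hsub
  obtain ⟨M₂, hM₂⟩ := isCompact_Icc.exists_bound_of_continuousOn hdu
  refine ⟨ρ, max L₁ L₂, max M₁ M₂, hlt, ?_⟩
  constructor
  · exact h.nearId.translate t₁
  · exact hρ0
  · exact le_max_of_le_left hL₁
  · exact hderiv b h.smooth_b
  · exact hderiv u h.smooth_u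
  · intro t t' ht ht'
    refine (hL₁' _ (hin t ht) _ (hin t' ht')).trans ?_
    rw [add_sub_add_left_eq_sub]
    exact mul_le_mul_of_nonneg_right (le_max_left _ _) (abs_nonneg _)
  · intro t t' ht ht'
    refine (hL₂' _ (hin t ht) _ (hin t' ht')).trans ?_
    rw [add_sub_add_left_eq_sub]
    exact mul_le_mul_of_nonneg_right (le_max_right _ _) (abs_nonneg _)
  · exact fun t ht => (hM₂ _ (hin t ht)).trans (le_max_right _ _)
  · exact h.holo.mono himg'
  · exact h.cont.mono himg
  · exact fun w hw => (hM₁ w hw).trans (le_max_left _ _)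
  · exact fun t _ => rfl

/-- The derivative of `F`, extended to the boundary curve. -/
noncomputable def derivExt (h : SmoothBoundary b τ F) (w : ℂ) : ℂ :=
  let ζ := h.nearId.homeo.symm w
  if 0 < ζ.im then deriv F w else deriv (fun t : ℝ => F (b t)) ζ.re / deriv b ζ.re

lemma homeo_symm_shear (h : SmoothBoundary b τ F) (ζ : ℂ) :
    h.nearId.homeo.symm (shear b ζ) = ζ := by
  rw [← h.nearId.coe_homeo]
  exact h.nearId.homeo.symm_apply_apply ζ

lemma derivExt_of_pos (h : SmoothBoundary b τ F) {ζ : ℂ} (hζ : 0 < ζ.im) :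
    h.derivExt (shear b ζ) = deriv F (shear b ζ) := by
  simp only [derivExt, h.homeo_symm_shear, if_pos hζ]

lemma derivExt_of_im_eq_zero (h : SmoothBoundary b τ F) {ζ : ℂ} (hζ : ζ.im = 0) :
    h.derivExt (shear b ζ) = deriv (fun t : ℝ => F (b t)) ζ.re / deriv b ζ.re := by
  simp only [derivExt, h.homeo_symm_shear, hζ, lt_irrefl, if_false]

lemma deriv_b_ne_zero (h : SmoothBoundary b τ F) {t : ℝ} (ht : t ∈ Ioo (-τ) τ) :
    deriv b t ≠ 0 := by
  intro h0
  have h1 : HasDerivAt b (deriv b t) t := ((h.smooth_b.differentiableOn (by simp)).differentiableAt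
        (isOpen_Ioo.mem_nhds ht)).hasDerivAt
  have := h.nearId.norm_deriv_ge h1
  rw [h0, norm_zero] at this
  linarith

lemma smooth_quotient (h : SmoothBoundary b τ F) :
    ContDiffOn ℝ ∞ (fun t => deriv (fun t : ℝ => F (b t)) t / deriv b t) (Ioo (-τ) τ) := by
  have h1 : ContDiffOn ℝ ∞ (deriv fun t : ℝ => F (b t)) (Ioo (-τ) τ) :=
    h.smooth_u.deriv_of_isOpen isOpen_Ioo (by simp)
  have h2 : ContDiffOn ℝ ∞ (deriv b) (Ioo (-τ) τ) := h.smooth_b.deriv_of_isOpen isOpen_Ioo (by simp)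
  exact (h1.mul (h2.inv fun _ ht => h.deriv_b_ne_zero ht)).congr fun t _ => div_eq_mul_inv _ _

/-- Only points of the curve need an argument: there the quadratic remainder in
`BoundaryData.expansion` is exactly differentiability relative to the half-open domain. -/
lemma hasDerivWithinAt (h : SmoothBoundary b τ F) {w : ℂ} (hw : w ∈ shear b '' halfRect τ) :
    HasDerivWithinAt F (h.derivExt w) (shear b '' halfRect τ) w := by
  obtain ⟨ζ, hζ, rfl⟩ := hw
  have hζ' := mem_halfRect.1 hζ
  rcases hζ'.2.1.lt_or_eq with hpos | h0
  · rw [h.derivExt_of_pos hpos]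
    exact (h.holo.differentiableAt ((h.nearId.isOpen_image (isOpen_rect τ)).mem_nhds
      ⟨ζ, mem_rect.2 ⟨hζ'.1, hpos, hζ'.2.2⟩, rfl⟩)).hasDerivAt.hasDerivWithinAt
  · rw [h.derivExt_of_im_eq_zero h0.symm]
    obtain ⟨ρ, L, M, hρ, hB⟩ := h.exists_boundaryData hζ.1
    have hexp := hB.expansion (t₀ := 0) (by rw [abs_zero]; linarith [hB.pos])
    simp only [add_zero] at hexp
    have hbζ : shear b ζ = b ζ.re := by simp [shear, h0.symm]
    rw [hbζ]
    set m := deriv (fun t : ℝ => F (b t)) ζ.re / deriv b ζ.re with hm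
    -- The expansion is available on the image of a closed rectangle based at `ζ.re`; that image
    -- contains all points of the half-open domain near `b ζ.re`.
    have hnear : shear (fun t => b (ζ.re + t)) '' closedRect ρ ∈
        𝓝[shear b '' halfRect τ] (b ζ.re) := by
      have hopen : IsOpen (shear (fun t => b (ζ.re + t)) '' ball 0 ρ) :=
        (h.nearId.translate ζ.re).isOpen_image isOpen_ball
      have hmem : b ζ.re ∈ shear (fun t => b (ζ.re + t)) '' ball 0 ρ :=
        ⟨0, mem_ball_self hB.pos, by simp [shear]⟩
      filter_upwards [self_mem_nhdsWithin, mem_nhdsWithin_of_mem_nhds (hopen.mem_nhds hmem)]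
      rintro _ ⟨ξ, hξ, rfl⟩ ⟨ξ', hξ', he⟩
      refine ⟨ξ', ?_, he⟩
      rw [shear_translate] at he
      have he' := h.nearId.shear_injective he
      have him : ξ'.im = ξ.im := by rw [← he']; simp
      rw [mem_ball_zero_iff] at hξ'
      have h1 := abs_re_le_norm ξ'
      have h2 := abs_im_le_norm ξ'
      have h3 := le_abs_self ξ'.im
      rw [mem_closedRect]
      exact ⟨by linarith, by rw [him]; exact (mem_halfRect.1 hξ).2.1, by linarith⟩
    have hmemS : b ζ.re ∈ shear b '' halfRect τ := ⟨ζ, hζ, hbζ⟩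
    have hO : (fun w => F w - F (b ζ.re) - m * (w - b ζ.re)) =O[𝓝[shear b '' halfRect τ] (b ζ.re)]
        fun w => ‖w - b ζ.re‖ ^ 2 := by
      refine Asymptotics.IsBigO.of_bound (expansionConst ρ L M) ?_
      filter_upwards [hnear] with w hw
      rw [Real.norm_of_nonneg (by positivity)]
      exact hexp w hw
    have hR := (hO.hasFDerivWithinAt hmemS (by norm_num)).hasDerivWithinAt
    have h2 : HasDerivWithinAt (fun w => m * (w - b ζ.re)) (m * 1) (shear b '' halfRect τ) (b ζ.re) :=
      (((hasDerivAt_id _).sub_const _).const_mul _).hasDerivWithinAt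
    have h3 := (hR.add h2).add_const (F (b ζ.re))
    simp only [_root_.zero_apply, zero_add, mul_one] at h3
    refine h3.congr (fun w _ => ?_) ?_ <;> simp

/-- Near a boundary point the difference between the derivative at height `s` and the quotient `q`
at the foot of the vertical is at most `5 K s`, with the same `K` for all nearby feet; continuity of
`q` along the curve does the rest. -/
lemma continuousOn_derivExt (h : SmoothBoundary b τ F) :
    ContinuousOn h.derivExt (shear b '' halfRect τ) := by
  have key : ContinuousOn (fun ζ => h.derivExt (shear b ζ)) (halfRect τ) := by
    intro ζ hζ
    have hζ' := mem_halfRect.1 hζ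
    rcases hζ'.2.1.lt_or_eq with hpos | h0
    · have hopen := h.nearId.isOpen_image (isOpen_rect τ)
      have h1 : ContinuousAt (deriv F) (shear b ζ) :=
        (h.holo.deriv hopen).continuousOn.continuousAt (hopen.mem_nhds
          ⟨ζ, mem_rect.2 ⟨hζ'.1, hpos, hζ'.2.2⟩, rfl⟩)
      have h2 : ContinuousAt (fun ζ => deriv F (shear b ζ)) ζ :=
        ContinuousAt.comp (f := shear b) h1 h.nearId.continuous_shear.continuousAt
      refine (h2.congr ?_).continuousWithinAt
      filter_upwards [(isOpen_lt continuous_const continuous_im).mem_nhds hpos] with ξ hξ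
      exact (h.derivExt_of_pos hξ).symm
    · obtain ⟨ρ, L, M, hρ, hB⟩ := h.exists_boundaryData hζ.1
      set q : ℝ → ℂ := fun t => deriv (fun t : ℝ => F (b t)) t / deriv b t with hq
      have hqc : ContinuousAt q ζ.re :=
        h.smooth_quotient.continuousOn.continuousAt (isOpen_Ioo.mem_nhds hζ.1)
      have hqc' : Tendsto (fun ξ : ℂ => q ξ.re) (𝓝[halfRect τ] ζ) (𝓝 (q ζ.re)) :=
        (ContinuousAt.comp (f := Complex.re) hqc continuous_re.continuousAt).tendsto.mono_left
          nhdsWithin_le_nhds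
      have hval : h.derivExt (shear b ζ) = q ζ.re := h.derivExt_of_im_eq_zero h0.symm
      have hK := hB.expansionConst_nonneg
      have hsmall : Tendsto (fun ξ : ℂ => h.derivExt (shear b ξ) - q ξ.re) (𝓝[halfRect τ] ζ)
          (𝓝 0) := by
        have hlim : Tendsto (fun ξ : ℂ => 5 * expansionConst ρ L M * ξ.im) (𝓝[halfRect τ] ζ)
            (𝓝 0) := by
          have : Tendsto (fun ξ : ℂ => 5 * expansionConst ρ L M * ξ.im) (𝓝 ζ)
              (𝓝 (5 * expansionConst ρ L M * ζ.im)) :=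
            (continuous_const.mul continuous_im).tendsto ζ
          rw [← h0, mul_zero] at this
          exact this.mono_left nhdsWithin_le_nhds
        refine squeeze_zero_norm' ?_ hlim
        have hn : ball ζ (ρ / 4) ∈ 𝓝 ζ := ball_mem_nhds _ (by have := hB.pos; positivity)
        filter_upwards [self_mem_nhdsWithin, mem_nhdsWithin_of_mem_nhds hn] with ξ hξ hξ'
        rw [mem_ball, dist_eq_norm] at hξ'
        have h1 := abs_re_le_norm (ξ - ζ)
        have h2 := abs_im_le_norm (ξ - ζ)
        rw [sub_re] at h1
        rw [sub_im, ← h0, sub_zero] at h2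
        have h3 := le_abs_self ξ.im
        rcases (mem_halfRect.1 hξ).2.1.lt_or_eq with hp | hz
        · have hB' := hB.norm_deriv_sub_le (t₀ := ξ.re - ζ.re) (s := ξ.im)
            (by linarith [hB.pos]) hp (by linarith)
          simp only [add_sub_cancel] at hB'
          rw [h.derivExt_of_pos hp]
          exact hB'
        · rw [h.derivExt_of_im_eq_zero hz.symm, ← hz]
          simp [hq]
      change Tendsto (fun ξ => h.derivExt (shear b ξ)) _ (𝓝 (h.derivExt (shear b ζ)))
      rw [hval]
      have := hsmall.add hqc'
      simpa using this
  have h2 : ContinuousOn ((fun ζ => h.derivExt (shear b ζ)) ∘ h.nearId.homeo.symm)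
      (shear b '' halfRect τ) := by
    refine key.comp h.nearId.homeo.symm.continuous.continuousOn ?_
    rintro _ ⟨ζ, hζ, rfl⟩
    rwa [h.homeo_symm_shear]
  refine h2.congr ?_
  rintro _ ⟨ζ, hζ, rfl⟩
  simp only [Function.comp, h.homeo_symm_shear]

/-- The class is stable under differentiation: the boundary values of the derivative are the smooth
quotient `u' / b'`. This is what makes the induction on the order of smoothness run. -/
lemma smoothBoundary_derivExt (h : SmoothBoundary b τ F) : SmoothBoundary b τ h.derivExt where
  nearId := h.nearId
  pos := h.pos
  smooth_b := h.smooth_b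
  cont := h.continuousOn_derivExt
  holo := by
    have hopen := h.nearId.isOpen_image (isOpen_rect τ)
    refine (h.holo.deriv hopen).congr ?_
    rintro _ ⟨ζ, hζ, rfl⟩
    exact h.derivExt_of_pos (mem_rect.1 hζ).2.1
  smooth_u := by
    refine h.smooth_quotient.congr ?_
    intro t _
    have := h.derivExt_of_im_eq_zero (ζ := t) (by simp)
    simpa using this

lemma contDiffOn_nat (n : ℕ) : ∀ {F : ℂ → ℂ}, SmoothBoundary b τ F →
    ContDiffOn ℂ n F (shear b '' halfRect τ) := by
  induction n with
  | zero => exact fun h => contDiffOn_zero.2 h.cont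
  | succ n ih =>
    intro F h
    rw [Nat.cast_succ]
    refine (contDiffOn_succ_iff_hasFDerivWithinAt (n := (n : WithTop ℕ∞)) (by simp)).2 fun w hw =>
      ⟨shear b '' halfRect τ, ?_, by simp,
        fun x => ContinuousLinearMap.toSpanSingletonCLE (𝕜 := ℂ) (h.derivExt x), ?_, ?_⟩
    · rw [insert_eq_of_mem hw]; exact self_mem_nhdsWithin
    · exact fun x hx => (h.hasDerivWithinAt hx).hasFDerivWithinAt
    · exact (ContinuousLinearEquiv.contDiff _).comp_contDiffOn (ih h.smoothBoundary_derivExt)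

/-- A holomorphic function which is continuous up to a smooth boundary curve, with smooth boundary
values, is smooth up to the boundary. -/
lemma contDiffOn (h : SmoothBoundary b τ F) : ContDiffOn ℝ ∞ F (shear b '' halfRect τ) := by
  have : ContDiffOn ℂ ∞ F (shear b '' halfRect τ) := contDiffOn_infty.2 fun n => contDiffOn_nat n h
  exact this.restrict_scalars ℝ

end SmoothBoundary
end LeviFlat

/-! ### Holomorphic dependence of Taylor coefficients on a parameter. -/

namespace LeviFlat
open Set Metric Filter Topology Complex

/-- A holomorphic function minus its affine approximation, on a ball where it is bounded. -/
lemma norm_sub_affine_le_of_bound {φ : ℂ → ℂ} {z h : ℂ} {r M : ℝ} (hr : 0 < r)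
    (hφ : DifferentiableOn ℂ φ (ball z (2 * r))) (hM : ∀ x ∈ ball z (2 * r), ‖φ x‖ ≤ M)
    (hh : ‖h‖ < r) : ‖φ (z + h) - φ z - deriv φ z * h‖ ≤ 3 * M / r ^ 2 * ‖h‖ ^ 2 := by
  have hz : z ∈ ball z (2 * r) := mem_ball_self (by positivity)
  have hd := (hφ.differentiableAt (isOpen_ball.mem_nhds hz)).hasDerivAt
  have hcl : closedBall z r ⊆ ball z (2 * r) := closedBall_subset_ball (by linarith)
  have hder : ‖deriv φ z‖ ≤ M / r := by
    refine norm_deriv_le_of_forall_mem_sphere_norm_le hr ?_ fun x hx =>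
      hM x (hcl (sphere_subset_closedBall hx))
    apply DifferentiableOn.diffContOnCl
    rw [closure_ball _ hr.ne']
    exact hφ.mono hcl
  set ψ : ℂ → ℂ := fun x => φ x - deriv φ z * (x - z) with hψ
  have hψd : DifferentiableOn ℂ ψ (ball z r) :=
    (hφ.mono (ball_subset_ball (by linarith))).sub (by fun_prop)
  have hψz : ψ z = φ z := by simp [hψ]
  have hmaps : MapsTo ψ (ball z r) (closedBall (ψ z) (3 * M)) := by
    intro x hx
    rw [mem_closedBall, dist_eq_norm, hψz]
    have h1 := hM x (hcl (ball_subset_closedBall hx))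
    have h2 := hM z hz
    have h3 : ‖deriv φ z * (x - z)‖ ≤ M := by
      rw [norm_mul]
      rw [mem_ball, dist_eq_norm] at hx
      calc ‖deriv φ z‖ * ‖x - z‖ ≤ M / r * r :=
            mul_le_mul hder hx.le (norm_nonneg _) ((norm_nonneg _).trans hder)
        _ = M := by field_simp
    have h4 := norm_sub_le (φ x - φ z) (deriv φ z * (x - z))
    have h5 := norm_sub_le (φ x) (φ z)
    have e : ψ x - φ z = φ x - φ z - deriv φ z * (x - z) := by simp only [hψ]; ring
    rw [e]
    linarith
  -- Since `ψ` has zero derivative at `z` and deviates from `ψ z` by at most `3 M`, the Schwarz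
  -- lemma for a zero of order two gives the quadratic bound.
  have ho : (fun x => ψ x - ψ z) =o[𝓝 z] fun x => ‖x - z‖ ^ 1 := by
    have h1 := (hasDerivAt_iff_isLittleO.1 hd).norm_right
    simp only [pow_one]
    refine h1.congr_left fun x => ?_
    simp only [hψ, smul_eq_mul]; ring
  have hzh : z + h ∈ ball z r := by simpa [mem_ball, dist_eq_norm] using hh
  have h1 := dist_le_mul_div_pow_of_mapsTo_ball_of_isLittleO hψd hmaps ho hzh
  have e : ψ (z + h) - ψ z = φ (z + h) - φ z - deriv φ z * h := by simp only [hψ]; ring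
  rw [dist_eq_norm, e, dist_eq_norm, add_sub_cancel_left] at h1
  refine h1.trans (le_of_eq ?_)
  rw [one_add_one_eq_two, div_pow]
  ring

/-- The derivative in `x` is a limit of difference quotients, each holomorphic in `w`. The second
order bound depends on `M` and `r` only, so the limit is uniform in `w`; separate holomorphy and a
uniform bound suffice. -/
lemma differentiableOn_deriv_param {T : Set ℂ} (hT : IsOpen T) {z : ℂ} {r M : ℝ} (hr : 0 < r)
    {F : ℂ → ℂ → ℂ} (h1 : ∀ w ∈ T, DifferentiableOn ℂ (F w) (ball z (2 * r)))
    (h2 : ∀ x ∈ ball z (2 * r), DifferentiableOn ℂ (fun w => F w x) T)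
    (hM : ∀ w ∈ T, ∀ x ∈ ball z (2 * r), ‖F w x‖ ≤ M) :
    DifferentiableOn ℂ (fun w => deriv (F w) z) T := by
  -- The denominator `n + 2` keeps every step strictly shorter than `r`.
  set a : ℕ → ℂ := fun n => ((r / (n + 2) : ℝ) : ℂ) with ha
  have ha0 : ∀ n : ℕ, 0 < r / ((n : ℝ) + 2) := fun n => by positivity
  have han : ∀ n, ‖a n‖ = r / (n + 2) := fun n => by
    rw [ha]; simp only [norm_real, Real.norm_eq_abs, abs_of_pos (ha0 n)]
  have hane : ∀ n, a n ≠ 0 := fun n => by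
    rw [← norm_pos_iff, han]; exact ha0 n
  have halt : ∀ n, ‖a n‖ < r := fun n => by
    rw [han]; exact div_lt_self hr (by linarith [n.cast_nonneg (α := ℝ)])
  have hlim : Tendsto (fun n : ℕ => r / ((n : ℝ) + 2)) atTop (𝓝 0) :=
    tendsto_const_nhds.div_atTop (tendsto_atTop_add_const_right _ _ tendsto_natCast_atTop_atTop)
  have hu : TendstoUniformlyOn (fun n w => (F w (z + a n) - F w z) / a n)
      (fun w => deriv (F w) z) atTop T := by
    rw [Metric.tendstoUniformlyOn_iff]
    intro η hη
    have hl2 : Tendsto (fun n : ℕ => 3 * M / r ^ 2 * (r / ((n : ℝ) + 2))) atTop (𝓝 0) := by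
      simpa using hlim.const_mul (3 * M / r ^ 2)
    filter_upwards [hl2.eventually_lt_const hη] with n hn w hw
    refine lt_of_le_of_lt ?_ hn
    have := norm_sub_affine_le_of_bound hr (h1 w hw) (hM w hw) (halt n)
    have e : deriv (F w) z - (F w (z + a n) - F w z) / a n =
        -((F w (z + a n) - F w z - deriv (F w) z * a n) / a n) := by
      field_simp [hane n]; ring
    rw [dist_eq_norm, e, norm_neg, norm_div, div_le_iff₀ (norm_pos_iff.2 (hane n)), ← han n]
    refine this.trans (le_of_eq (by ring))
  refine hu.tendstoLocallyUniformlyOn.differentiableOn (Eventually.of_forall fun n => ?_) hT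
  refine DifferentiableOn.div_const (DifferentiableOn.sub ?_ ?_) _
  · refine h2 _ ?_
    rw [mem_ball, dist_eq_norm, add_sub_cancel_left]
    linarith [halt n]
  · exact h2 _ (mem_ball_self (by positivity))

/-- Each differentiation halves the disc, and Cauchy's estimate on circles of radius `ε / 4`
supplies the uniform bound for the next one. -/
lemma differentiableOn_iteratedDeriv_param {T : Set ℂ} (hT : IsOpen T) (k : ℕ) :
    ∀ {ε M : ℝ}, 0 < ε → ∀ {F : ℂ → ℂ → ℂ}, (∀ w ∈ T, DifferentiableOn ℂ (F w) (ball 0 ε)) →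
    (∀ x ∈ ball (0 : ℂ) ε, DifferentiableOn ℂ (fun w => F w x) T) →
    (∀ w ∈ T, ∀ x ∈ ball (0 : ℂ) ε, ‖F w x‖ ≤ M) →
    DifferentiableOn ℂ (fun w => iteratedDeriv k (F w) 0) T := by
  induction k with
  | zero =>
    intro ε M hε F _ h2 _
    simpa using h2 0 (mem_ball_self hε)
  | succ k ih =>
    intro ε M hε F h1 h2 hM
    simp only [iteratedDeriv_succ']
    have hsub : ∀ x ∈ ball (0 : ℂ) (ε / 2), ball x (2 * (ε / 4)) ⊆ ball 0 ε := by
      intro x hx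
      refine ball_subset_ball' ?_
      rw [mem_ball] at hx
      linarith
    refine ih (M := M / (ε / 4)) (half_pos hε) (F := fun w => deriv (F w)) ?_ ?_ ?_
    · exact fun w hw => ((h1 w hw).deriv isOpen_ball).mono (ball_subset_ball (by linarith))
    · exact fun x hx => differentiableOn_deriv_param hT (r := ε / 4) (M := M) (by positivity)
        (fun w hw => (h1 w hw).mono (hsub x hx)) (fun y hy => h2 y (hsub x hx hy))
        (fun w hw y hy => hM w hw y (hsub x hx hy))
    · intro w hw x hx
      have hcl : closedBall x (ε / 4) ⊆ ball 0 ε :=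
        (closedBall_subset_ball (by linarith)).trans (hsub x hx)
      refine norm_deriv_le_of_forall_mem_sphere_norm_le (by positivity) ?_ fun y hy =>
        hM w hw y (hcl (sphere_subset_closedBall hy))
      apply DifferentiableOn.diffContOnCl
      rw [closure_ball _ (by positivity)]
      exact (h1 w hw).mono hcl

/-! ### Holomorphic functions Lipschitz close to a linear map. -/

lemma convex_rect (τ : ℝ) : Convex ℝ (rect τ) := by
  have : rect τ = {ζ : ℂ | -τ < ζ.re} ∩ {ζ | ζ.re < τ} ∩ ({ζ | 0 < ζ.im} ∩ {ζ | ζ.im < τ}) := by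
    ext ζ; simp [rect, mem_reProdIm, and_assoc]
  rw [this]
  exact ((convex_halfSpace_re_gt _).inter (convex_halfSpace_re_lt _)).inter
    ((convex_halfSpace_im_gt _).inter (convex_halfSpace_im_lt _))

/-- A holomorphic function above a curve whose derivative is close to `m` is close to `m w` in the
Lipschitz sense. -/
lemma NearId.norm_sub_sub_mul_le {b : ℝ → ℂ} (hb : NearId b) {τ : ℝ} (hτ : 0 < τ) {F : ℂ → ℂ}
    (hbd : ∀ t, |t| < τ → DifferentiableAt ℝ b t)
    (hF : DifferentiableOn ℂ F (shear b '' rect τ)) (hFc : ContinuousOn F (shear b '' closedRect τ))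
    {m : ℂ} {c : ℝ} (hc : ∀ ζ ∈ rect τ, ‖deriv F (shear b ζ) - m‖ ≤ c) :
    ∀ w ∈ shear b '' closedRect τ, ∀ w' ∈ shear b '' closedRect τ,
      ‖F w - F w' - m * (w - w')‖ ≤ 2 * c * ‖w - w'‖ := by
  have hc0 : 0 ≤ c := (norm_nonneg _).trans (hc ((τ / 2 : ℝ) * I) (mem_rect.2
    ⟨by simpa using hτ, by simpa using hτ, by simpa using hτ⟩))
  have hin : ∀ ζ ∈ rect τ, ∀ ζ' ∈ rect τ,
      ‖F (shear b ζ) - F (shear b ζ') - m * (shear b ζ - shear b ζ')‖ ≤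
        2 * c * ‖shear b ζ - shear b ζ'‖ := by
    intro ζ hζ ζ' hζ'
    -- The image domain need not be convex, so the mean value inequality is applied along the shear
    -- image of a segment. Its speed is at most `9/8 ‖ζ - ζ'‖`, and `9/8 ≤ 2 * 7/8` accounts for the
    -- factor `2`.
    set γ : ℝ → ℂ := fun x => ζ' + x * (ζ - ζ') with hγ
    have hγm : ∀ x ∈ Icc (0 : ℝ) 1, γ x ∈ rect τ := by
      intro x hx
      have := (convex_rect τ).add_smul_sub_mem hζ' hζ hx
      simpa [hγ] using this
    have hγd : ∀ x, HasDerivAt γ (ζ - ζ') x := by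
      intro x
      have := ((HasDerivAt.ofReal_comp (hasDerivAt_id x)).mul_const (ζ - ζ')).const_add ζ'
      simpa [hγ] using this
    have hsd : ∀ x ∈ Icc (0 : ℝ) 1, ∃ d : ℂ, HasDerivAt (fun x => shear b (γ x)) d x ∧
        ‖d‖ ≤ 9 / 8 * ‖ζ - ζ'‖ := by
      intro x hx
      have h1 : HasDerivAt (fun x => (γ x).re) (ζ - ζ').re x :=
        HasFDerivAt.comp_hasDerivAt (l := Complex.re) x (reCLM.hasFDerivAt) (hγd x)
      have h2 : HasDerivAt (fun x => (γ x).im) (ζ - ζ').im x :=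
        HasFDerivAt.comp_hasDerivAt (l := Complex.im) x (imCLM.hasFDerivAt) (hγd x)
      have h3 := (hbd (γ x).re (mem_rect.1 (hγm x hx)).1).hasDerivAt
      have h4 : HasDerivAt (fun x => shear b (γ x))
          ((ζ - ζ').re • deriv b (γ x).re + ((ζ - ζ').im : ℂ) * I) x :=
        (HasDerivAt.scomp x h3 h1).add ((HasDerivAt.ofReal_comp h2).mul_const I)
      refine ⟨_, h4, h4.le_of_lip' (by positivity) (Eventually.of_forall fun y => ?_)⟩
      refine (hb.norm_shear_sub_le _ _).trans (le_of_eq ?_)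
      have e : γ y - γ x = ((y - x : ℝ) : ℂ) * (ζ - ζ') := by simp only [hγ]; push_cast; ring
      rw [e, norm_mul, norm_real]
      ring
    choose! d hd hdn using hsd
    set k : ℝ → ℂ := fun x => F (shear b (γ x)) - m * shear b (γ x) with hk
    have hkd : ∀ x ∈ Icc (0 : ℝ) 1,
        HasDerivWithinAt k ((deriv F (shear b (γ x)) - m) * d x) (Icc 0 1) x := by
      intro x hx
      have h1 : HasDerivAt F (deriv F (shear b (γ x))) (shear b (γ x)) :=
        (hF.differentiableAt ((hb.isOpen_image (isOpen_rect τ)).mem_nhds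
          ⟨_, hγm x hx, rfl⟩)).hasDerivAt
      have h2 := (h1.comp_of_eq (h := fun x => shear b (γ x)) x (hd x hx) rfl).sub
        ((hd x hx).const_mul m)
      rw [← sub_mul] at h2
      exact h2.hasDerivWithinAt
    have hkb := norm_image_sub_le_of_norm_deriv_le_segment_01' (C := c * (9 / 8 * ‖ζ - ζ'‖)) hkd
      fun x hx => by
        rw [norm_mul]
        exact mul_le_mul (hc _ (hγm x (Ico_subset_Icc_self hx))) (hdn x (Ico_subset_Icc_self hx))
          (norm_nonneg _) hc0
    have e : k 1 - k 0 = F (shear b ζ) - F (shear b ζ') - m * (shear b ζ - shear b ζ') := by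
      simp only [hk, hγ]
      simp only [ofReal_one, one_mul, add_sub_cancel, ofReal_zero, zero_mul, add_zero]
      ring
    rw [← e]
    refine hkb.trans ?_
    have := hb.norm_shear_sub_ge ζ ζ'
    have h5 : 9 / 8 * ‖ζ - ζ'‖ ≤ 2 * ‖shear b ζ - shear b ζ'‖ := by
      nlinarith [norm_nonneg (ζ - ζ')]
    nlinarith
  have hs : ContinuousOn (fun ζ => F (shear b ζ)) (closedRect τ) :=
    hFc.comp hb.continuous_shear.continuousOn fun ζ hζ => ⟨ζ, hζ, rfl⟩
  have hsc := hb.continuous_shear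
  have hcl : closure (rect τ ×ˢ rect τ) = closedRect τ ×ˢ closedRect τ := by
    rw [closure_prod_eq, closure_rect hτ]
  rintro _ ⟨ζ, hζ, rfl⟩ _ ⟨ζ', hζ', rfl⟩
  have h1 : ContinuousOn (fun x : ℂ × ℂ => F (shear b x.1)) (closedRect τ ×ˢ closedRect τ) :=
    hs.comp continuousOn_fst fun x hx => hx.1
  have h2 : ContinuousOn (fun x : ℂ × ℂ => F (shear b x.2)) (closedRect τ ×ˢ closedRect τ) :=
    hs.comp continuousOn_snd fun x hx => hx.2
  refine le_on_closure (s := rect τ ×ˢ rect τ)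
    (f := fun x : ℂ × ℂ => ‖F (shear b x.1) - F (shear b x.2) - m * (shear b x.1 - shear b x.2)‖)
    (g := fun x : ℂ × ℂ => 2 * c * ‖shear b x.1 - shear b x.2‖)
    (fun x hx => hin _ hx.1 _ hx.2) ?_ ?_ (x := (ζ, ζ')) ?_
  · rw [hcl]
    refine ((h1.sub h2).sub (Continuous.continuousOn ?_)).norm
    fun_prop
  · apply Continuous.continuousOn
    fun_prop
  · rw [hcl]; exact ⟨hζ, hζ'⟩

/-- Surjectivity onto a half disc. -/
lemma NearId.half_ball_subset_image {b : ℝ → ℂ} (hb : NearId b) {τ : ℝ} (hτ : 0 < τ) {F : ℂ → ℂ}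
    (hF : DifferentiableOn ℂ F (shear b '' rect τ)) (hFc : ContinuousOn F (shear b '' closedRect τ))
    {m : ℂ} (hm : m ≠ 0) (hder : ∀ ζ ∈ rect τ, deriv F (shear b ζ) ≠ 0)
    (hlip : ∀ w ∈ shear b '' closedRect τ, ∀ w' ∈ shear b '' closedRect τ,
      ‖F w - F w' - m * (w - w')‖ ≤ ‖m‖ / 2 * ‖w - w'‖)
    (hreal : ∀ t : ℝ, |t| ≤ τ → (F (b t)).im = 0)
    (him : ∀ ζ ∈ rect τ, 0 < (F (shear b ζ)).im)
    {c : ℂ} (hc : 0 < c.im) (hcr : ‖c - F (b 0)‖ < ‖m‖ * τ / 4) :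
    ∃ ζ ∈ rect τ, F (shear b ζ) = c := by
  have hmpos : 0 < ‖m‖ := norm_pos_iff.2 hm
  have h0mem : b 0 ∈ shear b '' closedRect τ :=
    ⟨(0 : ℝ), mem_closedRect.2 ⟨by simpa using hτ.le, by simp, by simpa using hτ.le⟩, by simp [shear]⟩
  set V : Set ℂ := F '' (shear b '' rect τ) with hV
  set B : Set ℂ := ball (F (b 0)) (‖m‖ * τ / 4) ∩ {c | 0 < c.im} with hB
  have hBpre : IsPreconnected B :=
    ((convex_ball _ _).inter (convex_halfSpace_im_gt 0)).isPreconnected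
  have hopenQ := hb.isOpen_image (isOpen_rect τ)
  have hVo : IsOpen V := by
    rw [isOpen_iff_mem_nhds]
    rintro _ ⟨_, ⟨ζ, hζ, rfl⟩, rfl⟩
    have hmem : shear b '' rect τ ∈ 𝓝 (shear b ζ) := hopenQ.mem_nhds ⟨ζ, hζ, rfl⟩
    have h1 : HasStrictDerivAt F (deriv F (shear b ζ)) (shear b ζ) :=
      (hF.analyticAt hmem).hasStrictDerivAt
    rw [← h1.map_nhds_eq (hder ζ hζ)]
    exact image_mem_map hmem
  have hsub : shear b '' rect τ ⊆ shear b '' closedRect τ :=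
    image_mono ((rect_subset_halfRect τ).trans (halfRect_subset_closedRect τ))
  -- Connectedness: the image `V` is open as the derivative does not vanish, meets the half disc
  -- `B`, and is closed relative to `B`. A limit value in `B` is attained on the closed rectangle;
  -- positivity of its imaginary part excludes the lower side, where `F` is real. Points with `‖ζ‖ ≥
  -- τ` are excluded since there `F` is at distance at least `7/16 ‖m‖ τ` from `F (b 0)`.
  have hVB : B ⊆ V := by
    refine hBpre.subset_of_closure_inter_subset hVo ?_ ?_
    -- At height `τ / 8` the value of `F` is within `3/2 ‖m‖ * 9/64 τ = 27/128 ‖m‖ τ` of `F (b 0)`,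
    -- inside the half disc.
    · set ζ : ℂ := ((τ / 8 : ℝ) : ℂ) * I with hζ
      have hζm : ζ ∈ rect τ := mem_rect.2
        ⟨by simpa [hζ] using hτ, by simpa [hζ] using hτ, by simp [hζ]; linarith⟩
      refine ⟨F (shear b ζ), ⟨?_, him ζ hζm⟩, ⟨_, ⟨ζ, hζm, rfl⟩, rfl⟩⟩
      rw [mem_ball, dist_eq_norm]
      have h1 := hlip _ (hsub ⟨ζ, hζm, rfl⟩) _ h0mem
      have h2 := hb.norm_shear_sub_le ζ ((0 : ℝ) : ℂ)
      rw [shear_ofReal, ofReal_zero, sub_zero] at h2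
      have h3 : ‖ζ‖ = τ / 8 := by
        rw [hζ, norm_mul, norm_I, mul_one, norm_real, Real.norm_of_nonneg (by positivity)]
      rw [h3] at h2
      have h4 := norm_sub_norm_le (F (shear b ζ) - F (b 0)) (m * (shear b ζ - b 0))
      rw [norm_mul] at h4
      have h5 : ‖m‖ * ‖shear b ζ - b 0‖ ≤ ‖m‖ * (9 / 8 * (τ / 8)) :=
        mul_le_mul_of_nonneg_left h2 hmpos.le
      have h6 : 0 < ‖m‖ * τ := by positivity
      nlinarith
    · rintro c ⟨hc1, hc2, hc3⟩
      have hcpt : IsCompact (shear b '' closedRect τ) :=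
        (isCompact_Icc.reProdIm isCompact_Icc).image hb.continuous_shear
      have hclosed : IsClosed (F '' (shear b '' closedRect τ)) :=
        (hcpt.image_of_continuousOn hFc).isClosed
      have hc4 : c ∈ F '' (shear b '' closedRect τ) :=
        closure_minimal (image_mono hsub) hclosed hc1
      obtain ⟨_, ⟨ζ, hζ, rfl⟩, rfl⟩ := hc4
      refine ⟨_, ⟨ζ, ?_, rfl⟩, rfl⟩
      have hζ' := mem_closedRect.1 hζ
      have hζ0 : ζ.im ≠ 0 := by
        intro h0
        have : shear b ζ = b ζ.re := by simp [shear, h0]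
        have hc4 : 0 < (F (shear b ζ)).im := hc3
        rw [this, hreal _ hζ'.1] at hc4
        exact lt_irrefl _ hc4
      have hsmall : ‖ζ‖ < τ := by
        by_contra! hge
        rw [mem_ball, dist_eq_norm] at hc2
        have h1 := hlip _ ⟨ζ, hζ, rfl⟩ _ h0mem
        have h2 := hb.norm_shear_sub_ge ζ ((0 : ℝ) : ℂ)
        rw [shear_ofReal, ofReal_zero, sub_zero] at h2
        have h4 := norm_sub_norm_le (m * (shear b ζ - b 0)) (F (shear b ζ) - F (b 0))
        rw [norm_mul, norm_sub_rev (m * _)] at h4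
        have h5 : ‖m‖ * (7 / 8 * τ) ≤ ‖m‖ * ‖shear b ζ - b 0‖ :=
          mul_le_mul_of_nonneg_left (by linarith) hmpos.le
        nlinarith
      rw [mem_rect]
      exact ⟨(abs_re_le_norm ζ).trans_lt hsmall, lt_of_le_of_ne hζ'.2.1 (Ne.symm hζ0),
        (le_abs_self _).trans_lt ((abs_im_le_norm ζ).trans_lt hsmall)⟩
  obtain ⟨_, ⟨ζ, hζ, rfl⟩, h⟩ := hVB ⟨by rwa [mem_ball, dist_eq_norm], hc⟩
  exact ⟨ζ, hζ, h⟩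

end LeviFlat

/-! ### Level curves of `h` above a family of leaves. -/

namespace LeviFlat
open Set Metric Filter Topology Complex

/-- The images of `O` form an open set as `z` varies: each contains a disc of radius `7/8 r` about
the image of `ζ₀`, with `r` independent of `z`, and this centre moves continuously. -/
lemma eventually_mem_shear_image {g : ℝ → ℂ → ℂ} {ε : ℝ}
    (hN : ∀ z ∈ ball (0 : ℂ) ε, NearId fun t => g t z) (hc : ∀ t, ContinuousOn (g t) (ball 0 ε))
    {z₀ : ℂ} (hz₀ : z₀ ∈ ball (0 : ℂ) ε) {O : Set ℂ} (hO : IsOpen O) {ζ₀ : ℂ} (hζ₀ : ζ₀ ∈ O) :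
    ∀ᶠ x : ℂ × ℂ in 𝓝 (z₀, shear (fun t => g t z₀) ζ₀),
      x.1 ∈ ball 0 ε ∧ x.2 ∈ shear (fun t => g t x.1) '' O := by
  obtain ⟨r, hr, hrO⟩ := Metric.isOpen_iff.1 hO ζ₀ hζ₀
  have h1 : ContinuousAt (fun x : ℂ × ℂ => ‖x.2 - shear (fun t => g t x.1) ζ₀‖)
      (z₀, shear (fun t => g t z₀) ζ₀) := by
    have h2 : ContinuousAt (fun x : ℂ × ℂ => g ζ₀.re x.1) (z₀, shear (fun t => g t z₀) ζ₀) :=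
      ContinuousAt.comp (f := Prod.fst) (g := g ζ₀.re)
        ((hc ζ₀.re).continuousAt (isOpen_ball.mem_nhds hz₀)) continuousAt_fst
    exact (continuousAt_snd.sub (h2.add continuousAt_const)).norm
  have h3 : ∀ᶠ x : ℂ × ℂ in 𝓝 (z₀, shear (fun t => g t z₀) ζ₀),
      ‖x.2 - shear (fun t => g t x.1) ζ₀‖ < 7 / 8 * r := by
    refine h1.eventually_lt_const ?_
    simp only [sub_self, norm_zero]
    positivity
  have h4 : ∀ᶠ x : ℂ × ℂ in 𝓝 (z₀, shear (fun t => g t z₀) ζ₀), x.1 ∈ ball (0 : ℂ) ε :=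
    continuousAt_fst.eventually (isOpen_ball.mem_nhds hz₀)
  filter_upwards [h3, h4] with x hx hx'
  refine ⟨hx', ?_⟩
  refine image_mono hrO ((hN _ hx').ball_subset (r := r) ?_)
  rwa [mem_ball, dist_eq_norm]

lemma BoundaryData.mono {b b' : ℝ → ℂ} {F : ℂ → ℂ} {u u' : ℝ → ℂ} {τ L M τ' : ℝ}
    (h : BoundaryData b b' F u u' τ L M) (hpos : 0 < τ') (hle : τ' ≤ τ) :
    BoundaryData b b' F u u' τ' L M := by
  have hR : rect τ' ⊆ rect τ := fun ζ hζ => by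
    rw [mem_rect] at *; exact ⟨by linarith, by linarith, by linarith⟩
  have hC : closedRect τ' ⊆ closedRect τ := fun ζ hζ => by
    rw [mem_closedRect] at *; exact ⟨by linarith, by linarith, by linarith⟩
  exact
  { nearId := h.nearId
    pos := hpos
    nonneg := h.nonneg
    hasDerivAt_b := fun t ht => h.hasDerivAt_b t (ht.trans hle)
    hasDerivAt_u := fun t ht => h.hasDerivAt_u t (ht.trans hle)
    lip_b := fun t t' ht ht' => h.lip_b t t' (ht.trans hle) (ht'.trans hle)
    lip_u := fun t t' ht ht' => h.lip_u t t' (ht.trans hle) (ht'.trans hle)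
    bound_u := fun t ht => h.bound_u t (ht.trans hle)
    holo := h.holo.mono (image_mono hR)
    cont := h.cont.mono (image_mono hC)
    bound := fun w hw => h.bound w (image_mono hC hw)
    boundary := fun t ht => h.boundary t (ht.trans hle) }

/-- A family of leaves `w = g t z` and a holomorphic function `h` above them, with values in the
upper half plane, continuous up to the leaves and equal to the real constant `χ t` on each leaf. -/
structure LeafFamily (g gt : ℝ → ℂ → ℂ) (h : ℂ × ℂ → ℂ) (χ χ' : ℝ → ℂ) (ε τ L M : ℝ) : Prop where
  pos_ε : 0 < ε
  data : ∀ z ∈ ball (0 : ℂ) ε,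
    BoundaryData (fun t => g t z) (fun t => gt t z) (fun w => h (z, w)) χ χ' τ L M
  real : ∀ t, |t| ≤ τ → (χ t).im = 0
  im_pos : ∀ z ∈ ball (0 : ℂ) ε, ∀ w ∈ shear (fun t => g t z) '' rect τ, 0 < (h (z, w)).im
  cont_gt : ContinuousAt (fun x : ℝ × ℂ => gt x.1 x.2) (0, 0)
  cont_g : ∀ t, ContinuousOn (g t) (ball 0 ε)
  holo_g : ∀ t, |t| < τ → DifferentiableOn ℂ (g t) (ball 0 ε)
  holo_h : ∀ z ∈ ball (0 : ℂ) ε, ∀ w ∈ shear (fun t => g t z) '' rect τ, DifferentiableAt ℂ h (z, w)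
  smooth_coeff : ∀ k : ℕ, ContDiffOn ℝ ∞ (fun t => iteratedDeriv k (g t) 0) (Ioo (-τ) τ)

/-- A family of leaves on which `h (z, ·)` is uniformly close to the linear map `m`. -/
structure LipFamily (g gt : ℝ → ℂ → ℂ) (h : ℂ × ℂ → ℂ) (χ χ' : ℝ → ℂ) (ε τ L M : ℝ) (m : ℂ) : Prop
    extends LeafFamily g gt h χ χ' ε τ L M where
  ne_zero : m ≠ 0
  deriv_ne : ∀ z ∈ ball (0 : ℂ) ε, ∀ ζ ∈ rect τ,
    deriv (fun w => h (z, w)) (shear (fun t => g t z) ζ) ≠ 0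
  lip : ∀ z ∈ ball (0 : ℂ) ε, ∀ w ∈ shear (fun t => g t z) '' closedRect τ,
    ∀ w' ∈ shear (fun t => g t z) '' closedRect τ,
      ‖h (z, w) - h (z, w') - m * (w - w')‖ ≤ ‖m‖ / 2 * ‖w - w'‖

variable {g gt : ℝ → ℂ → ℂ} {h : ℂ × ℂ → ℂ} {χ χ' : ℝ → ℂ} {ε τ L M : ℝ} {m : ℂ}

lemma LeafFamily.mono (H : LeafFamily g gt h χ χ' ε τ L M) {ε' τ' : ℝ} (hε : 0 < ε') (hε' : ε' ≤ ε)
    (hτ : 0 < τ') (hτ' : τ' ≤ τ) : LeafFamily g gt h χ χ' ε' τ' L M := by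
  have hR : rect τ' ⊆ rect τ := fun ζ hζ => by
    rw [mem_rect] at *; exact ⟨by linarith, by linarith, by linarith⟩
  have hB : ball (0 : ℂ) ε' ⊆ ball 0 ε := ball_subset_ball hε'
  exact
  { pos_ε := hε
    data := fun z hz => (H.data z (hB hz)).mono hτ hτ'
    real := fun t ht => H.real t (ht.trans hτ')
    im_pos := fun z hz w hw => H.im_pos z (hB hz) w (image_mono hR hw)
    cont_gt := H.cont_gt
    cont_g := fun t => (H.cont_g t).mono hB
    holo_g := fun t ht => (H.holo_g t (ht.trans_le hτ')).mono hB
    holo_h := fun z hz w hw => H.holo_h z (hB hz) w (image_mono hR hw)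
    smooth_coeff := fun k => (H.smooth_coeff k).mono (Ioo_subset_Ioo (by linarith) hτ') }

lemma LeafFamily.zero_mem (H : LeafFamily g gt h χ χ' ε τ L M) : (0 : ℂ) ∈ ball (0 : ℂ) ε :=
  mem_ball_self H.pos_ε

lemma LeafFamily.pos_τ (H : LeafFamily g gt h χ χ' ε τ L M) : 0 < τ := (H.data 0 H.zero_mem).pos

/-- The boundary derivative of `h (z, ·)` is `χ' / gt`, continuous at the origin with value `m`, and
`m ≠ 0` by the Hopf lemma. The rate of convergence to it is the same for all `z`, so on a small
region the derivative stays within `‖m‖ / 4` of `m`; integrating doubles this to `‖m‖ / 2`. -/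
lemma LeafFamily.exists_lipFamily (H : LeafFamily g gt h χ χ' ε τ L M) :
    ∃ (m : ℂ) (ε' τ' : ℝ), ε' ≤ ε ∧ τ' ≤ τ ∧ LipFamily g gt h χ χ' ε' τ' L M m := by
  have hτ := H.pos_τ
  have h0 : |(0 : ℝ)| ≤ τ := by simpa using hτ.le
  have hχ : χ' 0 ≠ 0 := (H.data 0 H.zero_mem).deriv_ne_zero (H.real 0 h0) (H.im_pos 0 H.zero_mem)
  have hgt : gt 0 0 ≠ 0 := (H.data 0 H.zero_mem).ne_zero h0
  set m : ℂ := χ' 0 / gt 0 0 with hm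
  have hm0 : m ≠ 0 := div_ne_zero hχ hgt
  have hmpos : 0 < ‖m‖ := norm_pos_iff.2 hm0
  have hχc : ContinuousAt χ' 0 := by
    rw [Metric.continuousAt_iff']
    intro η hη
    have hlim : Tendsto (fun t : ℝ => L * |t - 0|) (𝓝 0) (𝓝 (L * |(0 : ℝ) - 0|)) := by
      apply Continuous.tendsto; fun_prop
    rw [sub_zero, abs_zero, mul_zero] at hlim
    filter_upwards [hlim.eventually_lt_const hη, closedBall_mem_nhds (0 : ℝ) hτ] with t ht ht'
    rw [mem_closedBall, Real.dist_eq, sub_zero] at ht'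
    rw [dist_eq_norm]
    exact ((H.data 0 H.zero_mem).lip_u t 0 ht' h0).trans_lt ht
  have hq : ContinuousAt (fun x : ℝ × ℂ => χ' x.1 / gt x.1 x.2) (0, 0) :=
    ContinuousAt.div (ContinuousAt.comp (f := Prod.fst) (g := χ') hχc continuousAt_fst) H.cont_gt hgt
  obtain ⟨r, hr, hrq⟩ := Metric.continuousAt_iff.1 hq (‖m‖ / 8) (by positivity)
  set K := expansionConst τ L M with hK
  have hK0 : 0 ≤ K := (H.data 0 H.zero_mem).expansionConst_nonneg
  set ε' := min ε r with hε'
  have hε'0 : 0 < ε' := lt_min H.pos_ε hr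
  obtain ⟨τ', hτ'0, hτ'1, hτ'2, hτ'3⟩ : ∃ τ' : ℝ, 0 < τ' ∧ τ' ≤ τ / 4 ∧ τ' ≤ r ∧
      5 * K * τ' ≤ ‖m‖ / 8 := by
    -- The `+ 1` keeps the denominator positive when `K = 0`.
    refine ⟨min (min (τ / 4) r) (‖m‖ / 8 / (5 * K + 1)), by positivity,
      (min_le_left _ _).trans (min_le_left _ _), (min_le_left _ _).trans (min_le_right _ _), ?_⟩
    have h1 := min_le_right (min (τ / 4) r) (‖m‖ / 8 / (5 * K + 1))
    rw [le_div_iff₀ (by positivity)] at h1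
    have h2 : 0 < min (min (τ / 4) r) (‖m‖ / 8 / (5 * K + 1)) := by positivity
    nlinarith
  have Hm := H.mono hε'0 (min_le_left _ _) hτ'0 (by linarith : τ' ≤ τ)
  have hder : ∀ z ∈ ball (0 : ℂ) ε', ∀ ζ ∈ rect τ',
      ‖deriv (fun w => h (z, w)) (shear (fun t => g t z) ζ) - m‖ ≤ ‖m‖ / 4 := by
    intro z hz ζ hζ
    rw [mem_rect] at hζ
    have hz' : z ∈ ball (0 : ℂ) ε := ball_subset_ball (min_le_left _ _) hz
    have h1 := (H.data z hz').norm_deriv_sub_le (t₀ := ζ.re) (s := ζ.im) (by linarith) hζ.2.1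
      (by linarith)
    have h2 : dist ((ζ.re, z) : ℝ × ℂ) (0, 0) < r := by
      rw [Prod.dist_eq, max_lt_iff, Real.dist_eq, sub_zero]
      exact ⟨by linarith, (mem_ball.1 hz).trans_le (min_le_right _ _)⟩
    have h3 := hrq h2
    rw [dist_eq_norm] at h3
    have h4 := norm_add_le (deriv (fun w => h (z, w)) (shear (fun t => g t z) ζ) -
      χ' ζ.re / gt ζ.re z) (χ' ζ.re / gt ζ.re z - m)
    rw [sub_add_sub_cancel] at h4
    have h5 : 5 * K * ζ.im ≤ 5 * K * τ' := mul_le_mul_of_nonneg_left hζ.2.2.le (by positivity)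
    have h6 : ‖deriv (fun w => h (z, w)) (shear (fun t => g t z) ζ) - χ' ζ.re / gt ζ.re z‖ ≤
      5 * K * ζ.im := h1
    have h7 : ‖χ' ζ.re / gt ζ.re z - m‖ < ‖m‖ / 8 := h3
    linarith
  refine ⟨m, ε', τ', min_le_left _ _, by linarith, { toLeafFamily := Hm, ne_zero := hm0, deriv_ne := ?_, lip := ?_ }⟩
  · intro z hz ζ hζ h0
    have := hder z hz ζ hζ
    rw [h0, zero_sub, norm_neg] at this
    linarith
  · intro z hz
    have hd := Hm.data z hz
    have := hd.nearId.norm_sub_sub_mul_le hτ'0 (fun t ht =>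
      (hd.hasDerivAt_b t ht.le).differentiableAt) hd.holo hd.cont (hder z hz)
    intro w hw w' hw'
    refine (this w hw w' hw').trans (le_of_eq (by ring))

namespace LipFamily

lemma norm_sub_le (H : LipFamily g gt h χ χ' ε τ L M m) {z : ℂ} (hz : z ∈ ball (0 : ℂ) ε) {w w' : ℂ}
    (hw : w ∈ shear (fun t => g t z) '' closedRect τ)
    (hw' : w' ∈ shear (fun t => g t z) '' closedRect τ) :
    ‖w - w'‖ ≤ 2 / ‖m‖ * ‖h (z, w) - h (z, w')‖ := by
  have hm := norm_pos_iff.2 H.ne_zero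
  have h1 := H.lip z hz w hw w' hw'
  have h2 := norm_sub_norm_le (m * (w - w')) (h (z, w) - h (z, w'))
  rw [norm_mul, norm_sub_rev (m * _)] at h2
  rw [div_mul_eq_mul_div, le_div_iff₀ hm]
  linarith

lemma norm_h_sub_le (H : LipFamily g gt h χ χ' ε τ L M m) {z : ℂ} (hz : z ∈ ball (0 : ℂ) ε)
    {w w' : ℂ} (hw : w ∈ shear (fun t => g t z) '' closedRect τ)
    (hw' : w' ∈ shear (fun t => g t z) '' closedRect τ) :
    ‖h (z, w) - h (z, w')‖ ≤ 3 / 2 * ‖m‖ * ‖w - w'‖ := by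
  have h1 := H.lip z hz w hw w' hw'
  have h2 := norm_sub_norm_le (h (z, w) - h (z, w')) (m * (w - w'))
  rw [norm_mul] at h2
  linarith

lemma injOn (H : LipFamily g gt h χ χ' ε τ L M m) {z : ℂ} (hz : z ∈ ball (0 : ℂ) ε) {w w' : ℂ}
    (hw : w ∈ shear (fun t => g t z) '' closedRect τ)
    (hw' : w' ∈ shear (fun t => g t z) '' closedRect τ) (he : h (z, w) = h (z, w')) : w = w' := by
  have := H.norm_sub_le hz hw hw'
  rw [he, sub_self, norm_zero, mul_zero, norm_le_zero_iff] at this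
  exact sub_eq_zero.1 this

lemma ofReal_mem (_H : LipFamily g gt h χ χ' ε τ L M m) {z : ℂ} {t : ℝ} (ht : |t| ≤ τ) :
    g t z ∈ shear (fun t => g t z) '' closedRect τ :=
  ⟨t, mem_closedRect.2 ⟨by simpa using ht, by simp, by simpa using (abs_nonneg t).trans ht⟩,
    by simp⟩

lemma h_leaf (H : LipFamily g gt h χ χ' ε τ L M m) {z : ℂ} (hz : z ∈ ball (0 : ℂ) ε) {t : ℝ}
    (ht : |t| ≤ τ) : h (z, g t z) = χ t := (H.data z hz).boundary t ht

/-- Distinct leaves lie on distinct levels; this later identifies leaves of two different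
parametrizations. -/
lemma χ_injOn (H : LipFamily g gt h χ χ' ε τ L M m) {t t' : ℝ} (ht : |t| ≤ τ) (ht' : |t'| ≤ τ)
    (he : χ t = χ t') : t = t' := by
  have h0 := H.zero_mem
  rw [← H.h_leaf h0 ht, ← H.h_leaf h0 ht'] at he
  have h1 := H.injOn h0 (H.ofReal_mem ht) (H.ofReal_mem ht') he
  have h2 := (H.data 0 h0).nearId.norm_sub_ge t t'
  rw [h1, sub_self, norm_zero] at h2
  rw [← sub_eq_zero, ← abs_nonpos_iff]
  linarith

/-- Above the curve this is surjectivity onto a half disc whose centre `χ 0` is the same for every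
`z`; on the curve the leaf itself solves the equation. The fraction `1/16` gives `‖w - g 0 0‖ < 9/64
τ`, whence `h (0, w)` is within `27/128 ‖m‖ τ < ‖m‖ τ / 4` of the centre. -/
lemma exists_level (H : LipFamily g gt h χ χ' ε τ L M m) {w z : ℂ}
    (hw : w ∈ shear (fun t => g t 0) '' halfRect (τ / 16)) (hz : z ∈ ball (0 : ℂ) ε) :
    ∃ w' ∈ shear (fun t => g t z) '' closedRect τ, h (z, w') = h (0, w) := by
  have hτ := H.pos_τ
  obtain ⟨ζ, hζ, rfl⟩ := hw
  have hζ' := mem_halfRect.1 hζ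
  rcases hζ'.2.1.lt_or_eq with hpos | h0
  · have hd := H.data z hz
    have hd0 := H.data 0 H.zero_mem
    have hmem : shear (fun t => g t 0) ζ ∈ shear (fun t => g t 0) '' rect τ :=
      ⟨ζ, mem_rect.2 ⟨by linarith, hpos, by linarith⟩, rfl⟩
    have h00 : |(0 : ℝ)| ≤ τ := by simpa using hτ.le
    have hcl : rect τ ⊆ closedRect τ := (rect_subset_halfRect τ).trans (halfRect_subset_closedRect τ)
    obtain ⟨ξ, hξ, he⟩ := hd.nearId.half_ball_subset_image hτ hd.holo hd.cont H.ne_zero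
      (H.deriv_ne z hz) (H.lip z hz)
      (fun t ht => by rw [H.h_leaf hz ht]; exact H.real t ht)
      (fun ζ hζ => H.im_pos z hz _ ⟨ζ, hζ, rfl⟩) (H.im_pos 0 H.zero_mem _ hmem) (by
        rw [H.h_leaf hz h00, ← H.h_leaf H.zero_mem h00]
        have h1 := H.norm_h_sub_le H.zero_mem (image_mono hcl hmem) (H.ofReal_mem h00)
        have h2 := hd0.nearId.norm_shear_sub_le ζ ((0 : ℝ) : ℂ)
        rw [shear_ofReal, ofReal_zero, sub_zero] at h2
        have h3 := norm_le_abs_re_add_abs_im ζ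
        rw [abs_of_pos hpos] at h3
        have h4 : ‖shear (fun t => g t 0) ζ - g 0 0‖ < 9 / 64 * τ := by linarith
        have hm := norm_pos_iff.2 H.ne_zero
        have h5 : 3 / 2 * ‖m‖ * ‖shear (fun t => g t 0) ζ - g 0 0‖ < 3 / 2 * ‖m‖ * (9 / 64 * τ) :=
          mul_lt_mul_of_pos_left h4 (by positivity)
        have h6 : 0 < ‖m‖ * τ := by positivity
        linarith)
    exact ⟨_, ⟨ξ, hcl hξ, rfl⟩, he⟩
  · have he : shear (fun t => g t 0) ζ = g ζ.re 0 := by simp [shear, h0.symm]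
    have ht : |ζ.re| ≤ τ := by linarith
    exact ⟨g ζ.re z, H.ofReal_mem ht, by rw [he, H.h_leaf hz ht, H.h_leaf H.zero_mem ht]⟩

/-- `G w z` is the point over `z` of the level curve of `h` through `(0, w)`. -/
def IsLevel (g : ℝ → ℂ → ℂ) (h : ℂ × ℂ → ℂ) (ε τ : ℝ) (G : ℂ → ℂ → ℂ) : Prop :=
  ∀ w ∈ shear (fun t => g t 0) '' halfRect (τ / 16), ∀ z ∈ ball (0 : ℂ) ε,
    G w z ∈ shear (fun t => g t z) '' closedRect τ ∧ h (z, G w z) = h (0, w)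

lemma exists_isLevel (H : LipFamily g gt h χ χ' ε τ L M m) : ∃ G, IsLevel g h ε τ G := by
  have : ∀ w z, ∃ w', w ∈ shear (fun t => g t 0) '' halfRect (τ / 16) → z ∈ ball (0 : ℂ) ε →
      w' ∈ shear (fun t => g t z) '' closedRect τ ∧ h (z, w') = h (0, w) := by
    intro w z
    by_cases hw : w ∈ shear (fun t => g t 0) '' halfRect (τ / 16)
    · by_cases hz : z ∈ ball (0 : ℂ) ε
      · obtain ⟨w', h1, h2⟩ := H.exists_level hw hz
        exact ⟨w', fun _ _ => ⟨h1, h2⟩⟩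
      · exact ⟨0, fun _ h => absurd h hz⟩
    · exact ⟨0, fun h => absurd h hw⟩
  choose G hG using this
  exact ⟨G, fun w hw z hz => hG w z hw hz⟩

variable {G : ℂ → ℂ → ℂ}

lemma small_subset (H : LipFamily g gt h χ χ' ε τ L M m) :
    shear (fun t => g t 0) '' halfRect (τ / 16) ⊆ shear (fun t => g t 0) '' closedRect τ := by
  have hτ := H.pos_τ
  refine image_mono fun ζ hζ => ?_
  rw [mem_halfRect] at hζ
  rw [mem_closedRect]
  exact ⟨by linarith, hζ.2.1, by linarith⟩

/-- Injectivity of `h (z, ·)` up to the boundary leaves no choice: through a point of the boundary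
curve the level curve is the leaf. -/
lemma level_leaf (H : LipFamily g gt h χ χ' ε τ L M m) (hG : IsLevel g h ε τ G) {t : ℝ}
    (ht : |t| < τ / 16) {z : ℂ} (hz : z ∈ ball (0 : ℂ) ε) : G (g t 0) z = g t z := by
  have hτ := H.pos_τ
  have hmem : g t 0 ∈ shear (fun t => g t 0) '' halfRect (τ / 16) :=
    ⟨t, mem_halfRect.2 ⟨by simpa using ht, by simp, by simpa using hτ⟩, by simp⟩
  obtain ⟨h1, h2⟩ := hG _ hmem z hz
  have ht' : |t| ≤ τ := by linarith
  refine H.injOn hz h1 (H.ofReal_mem ht') ?_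
  rw [h2, H.h_leaf hz ht', H.h_leaf H.zero_mem ht']

/-- The constant is `(2 / ‖m‖) * (3/2 ‖m‖)`. Being uniform in `z` and valid up to the boundary, this
bound makes the Taylor coefficients of `G w` continuous up to the curve. -/
lemma norm_level_sub_le (H : LipFamily g gt h χ χ' ε τ L M m) (hG : IsLevel g h ε τ G) {w w' z : ℂ}
    (hw : w ∈ shear (fun t => g t 0) '' halfRect (τ / 16))
    (hw' : w' ∈ shear (fun t => g t 0) '' halfRect (τ / 16)) (hz : z ∈ ball (0 : ℂ) ε) :
    ‖G w z - G w' z‖ ≤ 3 * ‖w - w'‖ := by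
  have hm := norm_pos_iff.2 H.ne_zero
  have h1 := hG w hw z hz
  have h2 := hG w' hw' z hz
  have h3 := H.norm_sub_le hz h1.1 h2.1
  rw [h1.2, h2.2] at h3
  have h4 := H.norm_h_sub_le H.zero_mem (H.small_subset hw) (H.small_subset hw')
  calc _ ≤ 2 / ‖m‖ * (3 / 2 * ‖m‖ * ‖w - w'‖) := h3.trans (by gcongr)
    _ = 3 * ‖w - w'‖ := by field_simp

lemma im_pos_of_mem (H : LipFamily g gt h χ χ' ε τ L M m) {w : ℂ}
    (hw : w ∈ shear (fun t => g t 0) '' rect (τ / 16)) :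
    w ∈ shear (fun t => g t 0) '' rect τ ∧ 0 < (h (0, w)).im := by
  have hτ := H.pos_τ
  have h1 : w ∈ shear (fun t => g t 0) '' rect τ := by
    refine image_mono (fun ζ hζ => ?_) hw
    rw [mem_rect] at *
    exact ⟨by linarith, by linarith, by linarith⟩
  exact ⟨h1, H.im_pos 0 H.zero_mem w h1⟩

/-- The level curve cannot reach the edge of the domain: it stays within `27/64 τ` of the leaf `g
0`, and it cannot touch any leaf because `h` is real there while its level is not. -/
lemma level_mem_rect (H : LipFamily g gt h χ χ' ε τ L M m) (hG : IsLevel g h ε τ G) {w z : ℂ}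
    (hw : w ∈ shear (fun t => g t 0) '' rect (τ / 16)) (hz : z ∈ ball (0 : ℂ) ε) :
    G w z ∈ shear (fun t => g t z) '' rect τ := by
  have hτ := H.pos_τ
  have hw' := image_mono (rect_subset_halfRect _) hw
  obtain ⟨⟨ξ, hξ, hξG⟩, h2⟩ := hG w hw' z hz
  refine ⟨ξ, ?_, hξG⟩
  have hξ' := mem_closedRect.1 hξ
  have h00 : |(0 : ℝ)| < τ / 16 := by simpa using hτ
  have h0mem : g 0 0 ∈ shear (fun t => g t 0) '' halfRect (τ / 16) :=
    ⟨(0 : ℝ), mem_halfRect.2 ⟨by simpa using hτ, by simp, by simpa using hτ⟩, by simp [shear]⟩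
  have h3 := H.norm_level_sub_le hG hw' h0mem hz
  rw [H.level_leaf hG h00 hz, ← hξG] at h3
  have h4 := (H.data z hz).nearId.norm_shear_sub_ge ξ ((0 : ℝ) : ℂ)
  rw [shear_ofReal, ofReal_zero, sub_zero] at h4
  have h5 : ‖w - g 0 0‖ ≤ 9 / 64 * τ := by
    obtain ⟨ζ, hζ, rfl⟩ := hw
    rw [mem_rect] at hζ
    have h6 := (H.data 0 H.zero_mem).nearId.norm_shear_sub_le ζ ((0 : ℝ) : ℂ)
    rw [shear_ofReal, ofReal_zero, sub_zero] at h6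
    have h7 := norm_le_abs_re_add_abs_im ζ
    rw [abs_of_pos hζ.2.1] at h7
    linarith
  have hsmall : ‖ξ‖ < τ := by linarith
  have him : ξ.im ≠ 0 := by
    intro h0
    have he : G w z = g ξ.re z := by rw [← hξG]; simp [shear, h0]
    have := (H.im_pos_of_mem hw).2
    rw [← h2, he, H.h_leaf hz hξ'.1, H.real _ hξ'.1] at this
    exact lt_irrefl _ this
  rw [mem_rect]
  exact ⟨(abs_re_le_norm ξ).trans_lt hsmall, lt_of_le_of_ne hξ'.2.1 (Ne.symm him),
    (le_abs_self _).trans_lt ((abs_im_le_norm ξ).trans_lt hsmall)⟩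

end LipFamily
end LeviFlat

/-! ### Holomorphy of the level curves and extension of the coefficients. -/

namespace LeviFlat
open Set Metric Filter Topology Complex

namespace LipFamily

variable {g gt : ℝ → ℂ → ℂ} {h : ℂ × ℂ → ℂ} {χ χ' : ℝ → ℂ} {ε τ L M : ℝ} {m : ℂ} {G : ℂ → ℂ → ℂ}

/-- With `v = G w z` frozen, the inverse Lipschitz bound over a nearby `z'` gives `‖G w' z' - v‖ ≤ 2
/ ‖m‖ * ‖h (0, w') - h (z', v)‖`, and the right side tends to `0`. -/
lemma continuousAt_level (H : LipFamily g gt h χ χ' ε τ L M m) (hG : IsLevel g h ε τ G) {w z : ℂ}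
    (hw : w ∈ shear (fun t => g t 0) '' rect (τ / 16)) (hz : z ∈ ball (0 : ℂ) ε) :
    ContinuousAt (fun x : ℂ × ℂ => G x.1 x.2) (w, z) := by
  have hopen := (H.data 0 H.zero_mem).nearId.isOpen_image (isOpen_rect (τ / 16))
  have hcl : rect τ ⊆ closedRect τ := (rect_subset_halfRect τ).trans (halfRect_subset_closedRect τ)
  have hGm := H.level_mem_rect hG hw hz
  set v := G w z with hv
  have hh1 : ContinuousAt h (0, w) :=
    (H.holo_h 0 H.zero_mem w (H.im_pos_of_mem hw).1).continuousAt
  have hh2 : ContinuousAt h (z, v) := (H.holo_h z hz v hGm).continuousAt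
  have hval : h (0, w) = h (z, v) := (hG w (image_mono (rect_subset_halfRect _) hw) z hz).2.symm
  have hc : ContinuousAt (fun x : ℂ × ℂ => 2 / ‖m‖ * ‖h (0, x.1) - h (x.2, v)‖) (w, z) := by
    refine continuousAt_const.mul (ContinuousAt.norm (ContinuousAt.sub ?_ ?_))
    · exact ContinuousAt.comp (f := fun x : ℂ × ℂ => ((0 : ℂ), x.1)) (g := h) hh1 (by fun_prop)
    · exact ContinuousAt.comp (f := fun x : ℂ × ℂ => (x.2, v)) (g := h) hh2 (by fun_prop)
  have hlim : Tendsto (fun x : ℂ × ℂ => 2 / ‖m‖ * ‖h (0, x.1) - h (x.2, v)‖) (𝓝 (w, z)) (𝓝 0) := by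
    have := hc.tendsto
    simpa only [hval, sub_self, norm_zero, mul_zero] using this
  have hsq : Tendsto (fun x : ℂ × ℂ => G x.1 x.2 - v) (𝓝 (w, z)) (𝓝 0) := by
    refine squeeze_zero_norm' ?_ hlim
    obtain ⟨ζ, hζ, hζv⟩ := hGm
    have he := eventually_mem_shear_image (fun z hz => (H.data z hz).nearId) H.cont_g hz
      (isOpen_rect τ) hζ
    rw [hζv] at he
    have h1 : ContinuousAt (fun x : ℂ × ℂ => (x.2, v)) (w, z) := by fun_prop
    filter_upwards [h1.eventually he, continuousAt_fst.eventually (hopen.mem_nhds hw)] with x hx hx'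
    have h2 := hG x.1 (image_mono (rect_subset_halfRect _) hx') x.2 hx.1
    have h3 := H.norm_sub_le hx.1 h2.1 (image_mono hcl hx.2)
    rwa [h2.2] at h3
  have := hsq.add_const v
  simp only [sub_add_cancel, zero_add] at this
  exact this

/-- The argument of the implicit function theorem, with `G` already known and continuous: composing
`(z, w') ↦ (z, h (z, w'))` with `(w, z) ↦ (z, G w z)` gives a differentiable map, and the former has
invertible derivative because `∂h/∂w ≠ 0`. -/
lemma differentiableAt_level (H : LipFamily g gt h χ χ' ε τ L M m) (hG : IsLevel g h ε τ G)
    {w z : ℂ} (hw : w ∈ shear (fun t => g t 0) '' rect (τ / 16)) (hz : z ∈ ball (0 : ℂ) ε) :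
    DifferentiableAt ℂ (fun x : ℂ × ℂ => G x.1 x.2) (w, z) := by
  have hopen := (H.data 0 H.zero_mem).nearId.isOpen_image (isOpen_rect (τ / 16))
  have hGm := H.level_mem_rect hG hw hz
  have hh1 := (H.holo_h 0 H.zero_mem w (H.im_pos_of_mem hw).1)
  have hh2 := (H.holo_h z hz (G w z) hGm).hasFDerivAt
  set D := fderiv ℂ h (z, G w z) with hD
  set d : ℂ := D (0, 1) with hd
  have hd0 : d ≠ 0 := by
    obtain ⟨ζ, hζ, hζv⟩ := hGm
    have h1 := H.deriv_ne z hz ζ hζ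
    rw [hζv] at h1
    have h2 : HasDerivAt (fun w => h (z, w)) (D (0, 1)) (G w z) :=
      HasFDerivAt.comp_hasDerivAt (l := h) (G w z) hh2
        ((hasDerivAt_const _ _).prodMk (hasDerivAt_id _))
    rwa [h2.deriv] at h1
  have hΘ : ContinuousAt (fun x : ℂ × ℂ => (x.2, G x.1 x.2)) (w, z) :=
    continuousAt_snd.prodMk (H.continuousAt_level hG hw hz)
  have hf : HasFDerivAt (fun y : ℂ × ℂ => (y.1, h y))
      ((ContinuousLinearMap.fst ℂ ℂ ℂ).prod D) (z, G w z) :=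
    hasFDerivAt_fst.prodMk hh2
  have hk : DifferentiableAt ℂ (fun x : ℂ × ℂ => (x.2, h (0, x.1))) (w, z) := by
    refine differentiableAt_snd.prodMk ?_
    exact DifferentiableAt.comp (f := fun x : ℂ × ℂ => ((0 : ℂ), x.1)) (g := h) (w, z) hh1
      (by fun_prop)
  have hcomp : (fun y : ℂ × ℂ => (y.1, h y)) ∘ (fun x : ℂ × ℂ => (x.2, G x.1 x.2)) =ᶠ[𝓝 (w, z)]
      fun x : ℂ × ℂ => (x.2, h (0, x.1)) := by
    filter_upwards [continuousAt_fst.eventually (hopen.mem_nhds hw),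
      continuousAt_snd.eventually (isOpen_ball.mem_nhds hz)] with x hx hx'
    simp only [Function.comp]
    rw [(hG x.1 (image_mono (rect_subset_halfRect _) hx) x.2 hx').2]
  -- Inverse of the triangular derivative: `(a, c) ↦ (a, d⁻¹ (c - D (a, 0)))`.
  set E : ℂ × ℂ →L[ℂ] ℂ × ℂ := (ContinuousLinearMap.fst ℂ ℂ ℂ).prod
    (d⁻¹ • (ContinuousLinearMap.snd ℂ ℂ ℂ -
      D.comp ((ContinuousLinearMap.fst ℂ ℂ ℂ).prod 0))) with hE
  have hinv : Function.LeftInverse E ((ContinuousLinearMap.fst ℂ ℂ ℂ).prod D) := by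
    rintro ⟨a, c⟩
    have h1 : D (a, c) = D (a, 0) + c * d := by
      have : ((a, c) : ℂ × ℂ) = (a, 0) + c • (0, 1) := by simp
      rw [this, map_add, map_smul, smul_eq_mul, hd]
    simp only [hE]
    simp [h1]
    field_simp
  have := HasFDerivAt.of_comp_of_leftInverse (f'symm := E) hΘ hf hk.hasFDerivAt hcomp hinv
  exact this.differentiableAt.snd

lemma differentiableOn_level_left (H : LipFamily g gt h χ χ' ε τ L M m) (hG : IsLevel g h ε τ G)
    {z : ℂ} (hz : z ∈ ball (0 : ℂ) ε) :
    DifferentiableOn ℂ (fun w => G w z) (shear (fun t => g t 0) '' rect (τ / 16)) := fun w hw =>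
  (DifferentiableAt.comp (f := fun w : ℂ => (w, z)) (g := fun x : ℂ × ℂ => G x.1 x.2) w
    (H.differentiableAt_level hG hw hz) (by fun_prop)).differentiableWithinAt

lemma differentiableOn_level (H : LipFamily g gt h χ χ' ε τ L M m) (hG : IsLevel g h ε τ G)
    {w : ℂ} (hw : w ∈ shear (fun t => g t 0) '' halfRect (τ / 16)) :
    DifferentiableOn ℂ (G w) (ball 0 ε) := by
  have hτ := H.pos_τ
  obtain ⟨ζ, hζ, rfl⟩ := hw
  have hζ' := mem_halfRect.1 hζ
  rcases hζ'.2.1.lt_or_eq with hpos | h0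
  · intro z hz
    have hw : shear (fun t => g t 0) ζ ∈ shear (fun t => g t 0) '' rect (τ / 16) :=
      ⟨ζ, mem_rect.2 ⟨hζ'.1, hpos, hζ'.2.2⟩, rfl⟩
    exact (DifferentiableAt.comp (f := fun z : ℂ => (shear (fun t => g t 0) ζ, z))
      (g := fun x : ℂ × ℂ => G x.1 x.2) z
      (H.differentiableAt_level hG hw hz) (by fun_prop)).differentiableWithinAt
  · have he : shear (fun t => g t 0) ζ = g ζ.re 0 := by simp [shear, h0.symm]
    rw [he]
    exact (H.holo_g ζ.re (by linarith)).congr fun z hz => H.level_leaf hG hζ'.1 hz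

/-- Continuity up to the curve is Cauchy's estimate for `G w - G w'` on the disc of radius `ε / 2`;
holomorphy is the parameter lemma; smoothness of the boundary values holds because `G (g t 0)`
agrees with `g t` near `0`. -/
lemma smoothBoundary_coeff (H : LipFamily g gt h χ χ' ε τ L M m) (hG : IsLevel g h ε τ G) (k : ℕ) :
    SmoothBoundary (fun t => g t 0) (τ / 16) (fun w => iteratedDeriv k (G w) 0) ∧
      ∀ t : ℝ, |t| < τ / 16 → iteratedDeriv k (G (g t 0)) 0 = iteratedDeriv k (g t) 0 := by
  have hτ := H.pos_τ
  have hε := H.pos_ε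
  have hbd : ∀ t : ℝ, |t| < τ / 16 → iteratedDeriv k (G (g t 0)) 0 = iteratedDeriv k (g t) 0 := by
    intro t ht
    refine Filter.EventuallyEq.iteratedDeriv_eq k ?_
    filter_upwards [ball_mem_nhds (0 : ℂ) hε] with z hz using H.level_leaf hG ht hz
  have hI : Ioo (-(τ / 16)) (τ / 16) ⊆ Ioo (-τ) τ := Ioo_subset_Ioo (by linarith) (by linarith)
  have hcl : closedBall (0 : ℂ) (ε / 2) ⊆ ball 0 ε := closedBall_subset_ball (by linarith)
  refine ⟨{ nearId := (H.data 0 H.zero_mem).nearId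
            pos := by positivity
            smooth_b := ?_
            cont := ?_
            holo := ?_
            smooth_u := ?_ }, hbd⟩
  · simpa using (H.smooth_coeff 0).mono hI
  · set T := shear (fun t => g t 0) '' halfRect (τ / 16)
    have hlip : ∀ w ∈ T, ∀ w' ∈ T, ‖iteratedDeriv k (G w) 0 - iteratedDeriv k (G w') 0‖ ≤
        k.factorial * 3 / (ε / 2) ^ k * ‖w - w'‖ := by
      intro w hw w' hw'
      have hd : ∀ w ∈ T, ContDiffAt ℂ k (G w) 0 := fun w hw =>
        ((H.differentiableOn_level hG hw).analyticAt (ball_mem_nhds 0 hε)).contDiffAt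
      rw [← iteratedDeriv_sub (hd w hw) (hd w' hw')]
      have hdiff : DiffContOnCl ℂ (G w - G w') (ball 0 (ε / 2)) := by
        apply DifferentiableOn.diffContOnCl
        rw [closure_ball _ (by positivity)]
        exact ((H.differentiableOn_level hG hw).sub (H.differentiableOn_level hG hw')).mono hcl
      refine (norm_iteratedDeriv_le_of_forall_mem_sphere_norm_le k (half_pos hε) hdiff
        (C := 3 * ‖w - w'‖) fun z hz => H.norm_level_sub_le hG hw hw'
          (hcl (sphere_subset_closedBall hz))).trans (le_of_eq ?_)
      ring
    refine LipschitzOnWith.continuousOn (K := (k.factorial * 3 / (ε / 2) ^ k).toNNReal)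
      (LipschitzOnWith.of_dist_le_mul fun w hw w' hw' => ?_)
    rw [dist_eq_norm, dist_eq_norm, Real.coe_toNNReal _ (by positivity)]
    exact hlip w hw w' hw'
  · have hopen := (H.data 0 H.zero_mem).nearId.isOpen_image (isOpen_rect (τ / 16))
    have h00 : |(0 : ℝ)| < τ / 16 := by simpa using hτ
    have h0mem : g 0 0 ∈ shear (fun t => g t 0) '' halfRect (τ / 16) :=
      ⟨(0 : ℝ), mem_halfRect.2 ⟨by simpa using hτ, by simp, by simpa using hτ⟩, by simp [shear]⟩
    have hrh := image_mono (f := shear (fun t => g t 0)) (rect_subset_halfRect (τ / 16))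
    obtain ⟨C, hC⟩ := (isCompact_closedBall (0 : ℂ) (ε / 2)).exists_bound_of_continuousOn
      ((H.cont_g 0).mono hcl)
    have hballs : ball (0 : ℂ) (ε / 2) ⊆ ball 0 ε := ball_subset_closedBall.trans hcl
    -- The uniform bound: `C` bounds the central leaf `g 0`, and `G w` stays within `3 τ` of it.
    refine differentiableOn_iteratedDeriv_param hopen k (M := C + 3 * τ) (half_pos hε)
      (fun w hw => (H.differentiableOn_level hG (hrh hw)).mono hballs)
      (fun z hz => H.differentiableOn_level_left hG (hballs hz)) fun w hw z hz => ?_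
    have h1 := H.norm_level_sub_le hG (hrh hw) h0mem (hballs hz)
    rw [H.level_leaf hG h00 (hballs hz)] at h1
    have h2 := hC z (ball_subset_closedBall hz)
    have h5 : ‖w - g 0 0‖ ≤ τ := by
      obtain ⟨ζ, hζ, rfl⟩ := hw
      rw [mem_rect] at hζ
      have h6 := (H.data 0 H.zero_mem).nearId.norm_shear_sub_le ζ ((0 : ℝ) : ℂ)
      rw [shear_ofReal, ofReal_zero, sub_zero] at h6
      have h7 := norm_le_abs_re_add_abs_im ζ
      rw [abs_of_pos hζ.2.1] at h7
      linarith
    have h8 := norm_sub_norm_le (G w z) (g 0 z)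
    linarith
  · refine ((H.smooth_coeff k).mono hI).congr fun t ht => hbd t (abs_lt.2 ht)

end LipFamily

/-- The coefficients of the leaves extend smoothly to the domain above, holomorphically inside. -/
lemma LeafFamily.exists_coeff {g gt : ℝ → ℂ → ℂ} {h : ℂ × ℂ → ℂ} {χ χ' : ℝ → ℂ} {ε τ L M : ℝ}
    (H : LeafFamily g gt h χ χ' ε τ L M) :
    ∃ τ' : ℝ, 0 < τ' ∧ τ' ≤ τ ∧
      (∀ t t', |t| < τ' → |t'| < τ' → χ t = χ t' → t = t') ∧
      ∀ k : ℕ, ∃ f : ℂ → ℂ, DifferentiableOn ℂ f (shear (fun t => g t 0) '' rect τ') ∧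
        ContDiffOn ℝ ∞ f (shear (fun t => g t 0) '' halfRect τ') ∧
        ∀ t : ℝ, |t| < τ' → f (g t 0) = iteratedDeriv k (g t) 0 := by
  obtain ⟨m, ε', τ₁, -, hτ₁, H₁⟩ := H.exists_lipFamily
  obtain ⟨G, hG⟩ := H₁.exists_isLevel
  have hτ := H₁.pos_τ
  refine ⟨τ₁ / 16, by positivity, by linarith, fun t t' ht ht' he =>
    H₁.χ_injOn (by linarith) (by linarith) he, fun k => ?_⟩
  obtain ⟨hs, hbd⟩ := H₁.smoothBoundary_coeff hG k
  exact ⟨_, hs.holo, hs.contDiffOn, hbd⟩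

end LeviFlat

/-! ### Real CR functions are constant on leaves. -/

namespace LeviFlat
open Set Metric Filter Topology Complex

/-- The tangent vectors of a complex curve in `S` are complex tangent vectors of `S`. -/
lemma smul_mem_complexTangent {S : Set (ℂ × ℂ)} {φ : ℂ → ℂ × ℂ} {v : ℂ × ℂ} {ζ₀ : ℂ}
    (hφ : HasDerivAt φ v ζ₀) (hS : ∀ᶠ ζ in 𝓝 ζ₀, φ ζ ∈ S) (c : ℂ) :
    c • v ∈ complexTangent S (φ ζ₀) := by
  have h1 : HasFDerivWithinAt φ ((ContinuousLinearMap.toSpanSingleton ℂ v).restrictScalars ℝ)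
      {ζ | φ ζ ∈ S} ζ₀ := (hφ.hasFDerivAt.restrictScalars ℝ).hasFDerivWithinAt
  have key : ∀ c : ℂ, c • v ∈ tangentConeAt ℝ S (φ ζ₀) := by
    intro c
    have hc : c ∈ tangentConeAt ℝ {ζ | φ ζ ∈ S} ζ₀ := by
      rw [tangentConeAt_of_mem_nhds hS]; exact mem_univ _
    have h2 := h1.mapsTo_tangent_cone hc
    refine tangentConeAt_mono ?_ (by simpa using h2)
    rintro _ ⟨ζ, hζ, rfl⟩
    exact hζ
  exact ⟨key c, by rw [smul_smul]; exact key _⟩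

/-- A CR map whose second component is real on `S` has constant second component on the complex
curves in `S`. -/
lemma snd_eq_of_mem {S V : Set (ℂ × ℂ)} {Φ : ℂ × ℂ → ℂ × ℂ} (hCR : IsSmoothCROn Φ S V)
    (hre : ∀ p ∈ V ∩ S, (Φ p).2.im = 0) {ε : ℝ} {φ : ℂ → ℂ}
    (hφ : DifferentiableOn ℂ φ (ball 0 ε)) (hmem : ∀ z ∈ ball (0 : ℂ) ε, (z, φ z) ∈ V ∩ S)
    {z : ℂ} (hz : z ∈ ball (0 : ℂ) ε) : (Φ (z, φ z)).2 = (Φ (0, φ 0)).2 := by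
  have h0 : (0 : ℂ) ∈ ball (0 : ℂ) ε := mem_ball_self (pos_of_mem_ball hz)
  set f : ℂ → ℂ := fun z => (Φ (z, φ z)).2 with hf
  have key : ∀ z ∈ ball (0 : ℂ) ε, HasFDerivAt f (0 : ℂ →L[ℝ] ℂ) z := by
    intro z hz
    have hnhds := isOpen_ball.mem_nhds hz
    obtain ⟨L, hL, hLC⟩ := hCR.2 _ (hmem z hz)
    have hd : HasDerivAt (fun z => (z, φ z)) ((1 : ℂ), deriv φ z) z :=
      (hasDerivAt_id z).prodMk (hφ.differentiableAt hnhds).hasDerivAt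
    have hdR := (hd.hasFDerivAt.restrictScalars ℝ)
    have h1 := (hL.comp z (t := V ∩ S) hdR.hasFDerivWithinAt (s := ball 0 ε)
      (fun z hz => hmem z hz)).hasFDerivAt hnhds
    set D := L.comp ((ContinuousLinearMap.toSpanSingleton ℂ ((1 : ℂ), deriv φ z)).restrictScalars ℝ)
    have h2 : HasFDerivAt f ((ContinuousLinearMap.snd ℝ ℂ ℂ).comp D) z :=
      HasFDerivAt.comp z (g := Prod.snd) hasFDerivAt_snd h1
    have h3 : HasFDerivAt (fun z => (f z).im)
        (imCLM.comp ((ContinuousLinearMap.snd ℝ ℂ ℂ).comp D)) z :=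
      HasFDerivAt.comp z (g := Complex.im) imCLM.hasFDerivAt h2
    have h4 : HasFDerivAt (fun z => (f z).im) (0 : ℂ →L[ℝ] ℝ) z := by
      refine (hasFDerivAt_const (0 : ℝ) z).congr_of_eventuallyEq ?_
      filter_upwards [hnhds] with y hy using hre _ (hmem y hy)
    have h5 := h3.unique h4
    have h6 : ∀ c : ℂ, ((D c).2).im = 0 := fun c => by
      have := congrArg (fun T : ℂ →L[ℝ] ℝ => T c) h5
      simpa using this
    have h7 : ∀ c : ℂ, (D (I * c)).2 = I * (D c).2 := by
      intro c
      have h8 := hLC (c • ((1 : ℂ), deriv φ z))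
        (smul_mem_complexTangent hd (by filter_upwards [hnhds] with y hy using (hmem y hy).2) c)
      have h9 := congrArg Prod.snd h8
      rw [smul_smul] at h9
      exact h9
    -- The differential of the second component along the curve is complex linear with real values,
    -- hence zero.
    have h10 : (ContinuousLinearMap.snd ℝ ℂ ℂ).comp D = 0 := by
      ext c
      have a := h6 (I * c)
      rw [h7] at a
      simp only [mul_im, I_re, zero_mul, I_im, one_mul, zero_add] at a
      exact Complex.ext a (h6 c)
    rwa [h10] at h2
  refine (convex_ball (0 : ℂ) ε).is_const_of_fderivWithin_eq_zero (𝕜 := ℝ)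
    (fun z hz => (key z hz).differentiableAt.differentiableWithinAt) (fun z hz => ?_) hz h0
  exact ((key z hz).hasFDerivWithinAt).fderivWithin (isOpen_ball.uniqueDiffWithinAt hz)

/-! ### Leaves as graphs over the complex tangent line. -/

/-- A smooth family of holomorphic graphs `w = g t z` in `S`, close to `lam t` in the Lipschitz
sense. -/
structure LeafGraph (S : Set (ℂ × ℂ)) (r ε : ℝ) (g : ℝ → ℂ → ℂ) (lam : ℂ) : Prop where
  pos_r : 0 < r
  pos_ε : 0 < ε
  smooth : ContDiffOn ℝ ∞ (fun x : ℝ × ℂ => g x.1 x.2) (Ioo (-r) r ×ˢ ball 0 ε)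
  holo : ∀ t ∈ Ioo (-r) r, DifferentiableOn ℂ (g t) (ball 0 ε)
  mem : ∀ t ∈ Ioo (-r) r, ∀ z ∈ ball (0 : ℂ) ε, (z, g t z) ∈ S
  map_zero : g 0 0 = 0
  ne_zero : lam ≠ 0
  hasDerivAt : HasDerivAt (fun t => g t 0) lam 0
  near : ∀ z ∈ ball (0 : ℂ) ε, ∀ t ∈ Ioo (-r) r, ∀ t' ∈ Ioo (-r) r,
    ‖g t z - g t' z - lam * ((t : ℂ) - t')‖ ≤ ‖lam‖ / 8 * |t - t'|

/-- Solving the first component of a foliation chart for the leaf coordinate. -/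
lemma exists_graph {S : Set (ℂ × ℂ)} {r : ℝ} {ψ : ℝ × ℂ → ℂ × ℂ} (hr : 0 < r) (hψ0 : ψ (0, 0) = 0)
    (hψ : ContDiffOn ℝ ∞ ψ (Ioo (-r) r ×ˢ ball 0 r))
    (hinj : Function.Injective (fderiv ℝ ψ (0, 0)))
    (hholo : ∀ t ∈ Ioo (-r) r, DifferentiableOn ℂ (fun ζ => ψ (t, ζ)) (ball 0 r))
    (hS : ψ '' (Ioo (-r) r ×ˢ ball 0 r) ⊆ S)
    (hH : complexTangent S 0 = {v : ℂ × ℂ | v.2 = 0}) :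
    ∃ (r' ε : ℝ) (g : ℝ → ℂ → ℂ) (lam : ℂ), 0 < r' ∧ 0 < ε ∧
      ContDiffOn ℝ ∞ (fun x : ℝ × ℂ => g x.1 x.2) (Ioo (-r') r' ×ˢ ball 0 ε) ∧
      (∀ t ∈ Ioo (-r') r', DifferentiableOn ℂ (g t) (ball 0 ε)) ∧
      (∀ t ∈ Ioo (-r') r', ∀ z ∈ ball (0 : ℂ) ε, (z, g t z) ∈ S) ∧
      g 0 0 = 0 ∧ lam ≠ 0 ∧ HasDerivAt (fun t => g t 0) lam 0 := by
  set B : Set (ℝ × ℂ) := Ioo (-r) r ×ˢ ball 0 r with hB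
  have hBo : IsOpen B := isOpen_Ioo.prod isOpen_ball
  have h0B : ((0, 0) : ℝ × ℂ) ∈ B := ⟨by simpa using hr, mem_ball_self hr⟩
  have hψd : ∀ x ∈ B, HasFDerivAt ψ (fderiv ℝ ψ x) x := fun x hx =>
    ((hψ.differentiableOn (by simp)).differentiableAt (hBo.mem_nhds hx)).hasFDerivAt
  -- the derivative along the leaves is complex linear
  have hlin : ∀ x ∈ B, ∃ v : ℂ × ℂ, HasDerivAt (fun ζ => ψ (x.1, ζ)) v x.2 ∧
      ∀ c : ℂ, fderiv ℝ ψ x (0, c) = c • v := by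
    intro x hx
    have h1 := ((hholo x.1 hx.1).differentiableAt (isOpen_ball.mem_nhds hx.2)).hasDerivAt
    refine ⟨_, h1, fun c => ?_⟩
    have h2 := h1.hasFDerivAt.restrictScalars ℝ
    have h3 : HasFDerivAt (fun ζ => ψ (x.1, ζ))
        ((fderiv ℝ ψ x).comp (ContinuousLinearMap.inr ℝ ℝ ℂ)) x.2 :=
      HasFDerivAt.comp x.2 (f := fun ζ => (x.1, ζ)) (hψd x hx) (hasFDerivAt_prodMk_right x.1 x.2)
    have h4 := congrArg (fun T : ℂ →L[ℝ] ℂ × ℂ => T c) (h3.unique h2)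
    simpa using h4
  obtain ⟨v, hv, hvl⟩ := hlin _ h0B
  -- The leaf through `0` is tangent to `H_0(S) = {w = 0}`, so its velocity is horizontal, and
  -- nonzero because `ψ` is an immersion. Hence `z` can replace `ζ` as the coordinate on nearby
  -- leaves.
  have hv2 : v.2 = 0 := by
    have := smul_mem_complexTangent (S := S) hv (by
      filter_upwards [isOpen_ball.mem_nhds (mem_ball_self hr)] with ζ hζ
      exact hS ⟨(0, ζ), ⟨h0B.1, hζ⟩, rfl⟩) 1
    simp only [hψ0, one_smul, hH] at this
    exact this
  have hv1 : v.1 ≠ 0 := by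
    intro h
    have h1 : fderiv ℝ ψ (0, 0) (0, 1) = 0 := by rw [hvl, one_smul]; exact Prod.ext h hv2
    have h2 := hinj (h1.trans (map_zero _).symm)
    exact one_ne_zero (congrArg Prod.snd h2)
  set A : Set (ℝ × ℂ) := {x ∈ B | (fderiv ℝ ψ x (0, 1)).1 ≠ 0} with hA
  have hAo : IsOpen A := by
    have hc : ContinuousOn (fun x => (fderiv ℝ ψ x (0, 1)).1) B :=
      ((hψ.continuousOn_fderiv_of_isOpen hBo (by simp)).clm_apply continuousOn_const).fst
    exact hc.isOpen_inter_preimage hBo isOpen_ne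
  have h0A : ((0, 0) : ℝ × ℂ) ∈ A := ⟨h0B, by rw [hvl, one_smul]; exact hv1⟩
  set K : ℝ × ℂ → ℝ × ℂ := fun x => (x.1, (ψ x).1) with hK
  have hKsm : ContDiffOn ℝ ∞ K B := contDiffOn_fst.prodMk hψ.fst
  have hKd : ∀ x ∈ A, ∃ E : (ℝ × ℂ) ≃L[ℝ] ℝ × ℂ, HasFDerivAt K (E : ℝ × ℂ →L[ℝ] ℝ × ℂ) x ∧
      ∀ y, (E y).1 = y.1 := by
    intro x hx
    set T : ℝ × ℂ →L[ℝ] ℝ × ℂ := (ContinuousLinearMap.fst ℝ ℝ ℂ).prod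
      ((ContinuousLinearMap.fst ℝ ℂ ℂ).comp (fderiv ℝ ψ x)) with hT
    have hTd : HasFDerivAt K T x := hasFDerivAt_fst.prodMk (hψd x hx.1).fst
    have hTi : Function.Injective (T : ℝ × ℂ →ₗ[ℝ] ℝ × ℂ) := by
      rw [← LinearMap.ker_eq_bot, LinearMap.ker_eq_bot']
      rintro ⟨a, c⟩ h
      have ha : a = 0 := congrArg Prod.fst h
      have hc : (fderiv ℝ ψ x (a, c)).1 = 0 := congrArg Prod.snd h
      obtain ⟨u, -, hul⟩ := hlin x hx.1
      have hx2 := hx.2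
      rw [hul, one_smul] at hx2
      rw [ha, hul] at hc
      have hc' : c * u.1 = 0 := hc
      rw [ha, (mul_eq_zero.1 hc').resolve_right hx2]
      rfl
    refine ⟨(LinearEquiv.ofInjectiveEndo (T : ℝ × ℂ →ₗ[ℝ] ℝ × ℂ) hTi).toContinuousLinearEquiv, ?_, ?_⟩
    · convert hTd
      ext <;> rfl
    · intro y; rfl
  obtain ⟨E₀, hE₀, -⟩ := hKd _ h0A
  have hstrict : HasStrictFDerivAt K (E₀ : ℝ × ℂ →L[ℝ] ℝ × ℂ) (0, 0) :=
    (hKsm.contDiffAt (hBo.mem_nhds h0B)).hasStrictFDerivAt' hE₀ (by simp)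
  set Kh := hstrict.toOpenPartialHomeomorph K with hKh
  have hKhc : ⇑Kh = K := hstrict.toOpenPartialHomeomorph_coe
  have hK0 : K (0, 0) = (0, 0) := by simp [hK, hψ0]
  set T' : Set (ℝ × ℂ) := Kh.target ∩ Kh.symm ⁻¹' A with hT'
  have hT'o : IsOpen T' := Kh.symm.isOpen_inter_preimage hAo
  have h0s : ((0, 0) : ℝ × ℂ) ∈ Kh.source := hstrict.mem_toOpenPartialHomeomorph_source
  have hsymm0 : Kh.symm (0, 0) = (0, 0) := by
    have := Kh.left_inv h0s
    rwa [hKhc, hK0] at this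
  have h0T : ((0, 0) : ℝ × ℂ) ∈ T' := by
    refine ⟨?_, ?_⟩
    · have := Kh.map_source h0s
      rwa [hKhc, hK0] at this
    · rw [mem_preimage, hsymm0]; exact h0A
  obtain ⟨ρ, hρ, hρT⟩ := Metric.isOpen_iff.1 hT'o _ h0T
  have hbox : Ioo (-ρ) ρ ×ˢ ball (0 : ℂ) ρ ⊆ T' := by
    rintro ⟨t, z⟩ ⟨ht, hz⟩
    refine hρT ?_
    rw [mem_ball, Prod.dist_eq, max_lt_iff]
    refine ⟨?_, hz⟩
    simpa [Real.dist_eq, abs_lt] using ht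
  have hinv : ∀ y ∈ T', K (Kh.symm y) = y := fun y hy => by
    have := Kh.right_inv hy.1
    rwa [hKhc] at this
  have hinv1 : ∀ y ∈ T', (Kh.symm y).1 = y.1 := fun y hy =>
    (congrArg Prod.fst (hinv y hy) : (K (Kh.symm y)).1 = y.1)
  have hinv2 : ∀ y ∈ T', (ψ (Kh.symm y)).1 = y.2 := fun y hy =>
    (congrArg Prod.snd (hinv y hy) : (K (Kh.symm y)).2 = y.2)
  have hsd : ∀ y ∈ T', ContDiffAt ℝ ∞ Kh.symm y := by
    intro y hy
    obtain ⟨E, hE, -⟩ := hKd _ hy.2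
    refine Kh.contDiffAt_symm hy.1 (f₀' := E) ?_ ?_
    · rw [hKhc]; exact hE
    · rw [hKhc]; exact hKsm.contDiffAt (hBo.mem_nhds hy.2.1)
  have hgsm : ∀ y ∈ T', ContDiffAt ℝ ∞ (fun y => (ψ (Kh.symm y)).2) y := fun y hy =>
    (ContDiffAt.comp y (g := ψ) (hψ.contDiffAt (hBo.mem_nhds hy.2.1)) (hsd y hy)).snd
  have hmemS : ∀ y ∈ T', (y.2, (ψ (Kh.symm y)).2) ∈ S := by
    intro y hy
    have : (y.2, (ψ (Kh.symm y)).2) = ψ (Kh.symm y) := by rw [← hinv2 y hy]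
    rw [this]
    exact hS ⟨_, hy.2.1, rfl⟩
  -- the time derivative at the origin
  obtain ⟨D, hD⟩ : ∃ D : ℝ × ℂ →L[ℝ] ℝ × ℂ, HasFDerivAt Kh.symm D (0, 0) :=
    ⟨_, ((hsd _ h0T).differentiableAt (by simp)).hasFDerivAt⟩
  have hcurve : HasDerivAt (fun t : ℝ => Kh.symm (t, 0)) (D (1, 0)) 0 :=
    HasFDerivAt.comp_hasDerivAt (l := Kh.symm) (f := fun t : ℝ => ((t, 0) : ℝ × ℂ)) 0 hD
      ((hasDerivAt_id _).prodMk (hasDerivAt_const _ _))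
  have hψ' : HasFDerivAt ψ (fderiv ℝ ψ (0, 0)) (Kh.symm (0, 0)) := by
    rw [hsymm0]; exact hψd _ h0B
  have hcurve2 : HasDerivAt (fun t : ℝ => ψ (Kh.symm (t, 0))) (fderiv ℝ ψ (0, 0) (D (1, 0))) 0 :=
    HasFDerivAt.comp_hasDerivAt (l := ψ) (f := fun t : ℝ => Kh.symm (t, 0)) 0 hψ' hcurve
  have hTev : ∀ᶠ t : ℝ in 𝓝 0, ((t, 0) : ℝ × ℂ) ∈ T' := by
    have : ContinuousAt (fun t : ℝ => ((t, 0) : ℝ × ℂ)) 0 := by fun_prop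
    exact this.eventually (hT'o.mem_nhds h0T)
  have hD1 : (D (1, 0)).1 = 1 := by
    have h1 : HasDerivAt (fun t : ℝ => (Kh.symm (t, 0)).1) (D (1, 0)).1 0 :=
      (ContinuousLinearMap.fst ℝ ℝ ℂ).hasFDerivAt.comp_hasDerivAt 0 hcurve
    have h2 : HasDerivAt (fun t : ℝ => (Kh.symm (t, 0)).1) 1 0 := by
      refine (hasDerivAt_id (0 : ℝ)).congr_of_eventuallyEq ?_
      filter_upwards [hTev] with t ht using hinv1 _ ht
    exact h1.unique h2
  have hfst : (fderiv ℝ ψ (0, 0) (D (1, 0))).1 = 0 := by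
    have h1 : HasDerivAt (fun t : ℝ => (ψ (Kh.symm (t, 0))).1) (fderiv ℝ ψ (0, 0) (D (1, 0))).1 0 :=
      (ContinuousLinearMap.fst ℝ ℂ ℂ).hasFDerivAt.comp_hasDerivAt 0 hcurve2
    have h2 : HasDerivAt (fun t : ℝ => (ψ (Kh.symm (t, 0))).1) 0 0 := by
      refine (hasDerivAt_const (0 : ℝ) (0 : ℂ)).congr_of_eventuallyEq ?_
      filter_upwards [hTev] with t ht using hinv2 _ ht
    exact h1.unique h2
  refine ⟨ρ, ρ, fun t z => (ψ (Kh.symm (t, z))).2, (fderiv ℝ ψ (0, 0) (D (1, 0))).2, hρ, hρ,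
    ?_, ?_, ?_, ?_, ?_, ?_⟩
  · exact fun y hy => (hgsm y (hbox hy)).contDiffWithinAt
  -- On one leaf, `ζ ↦ z` has nonzero complex derivative, so its local inverse is holomorphic and so
  -- is its composition with the second component of `ψ`.
  · intro t ht z hz
    have hy : ((t, z) : ℝ × ℂ) ∈ T' := hbox ⟨ht, hz⟩
    set x := Kh.symm (t, z) with hx
    obtain ⟨u, hu, hul⟩ := hlin x hy.2.1
    have hx1 : x.1 = t := hinv1 _ hy
    have hu1 : u.1 ≠ 0 := by
      have := hy.2.2
      rwa [← hx, hul, one_smul] at this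
    have hev : ∀ᶠ z' in 𝓝 z, ((t, z') : ℝ × ℂ) ∈ T' := by
      have : ContinuousAt (fun z' : ℂ => ((t, z') : ℝ × ℂ)) z := by fun_prop
      exact this.eventually (hT'o.mem_nhds hy)
    have hZc : ContinuousAt (fun z' => (Kh.symm (t, z')).2) z :=
      (ContinuousAt.comp (f := fun z' : ℂ => ((t, z') : ℝ × ℂ)) (g := Kh.symm)
        (hsd _ hy).continuousAt (by fun_prop)).snd
    have hu' : HasDerivAt (fun ζ => (ψ (t, ζ)).1) u.1 x.2 := by
      rw [hx1] at hu
      exact HasFDerivAt.comp_hasDerivAt (l := Prod.fst) x.2 hasFDerivAt_fst hu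
    have hpair : ∀ z', ((t, z') : ℝ × ℂ) ∈ T' → (t, (Kh.symm (t, z')).2) = Kh.symm (t, z') :=
      fun z' hz' => Prod.ext (hinv1 _ hz').symm rfl
    have hZd : HasDerivAt (fun z' => (Kh.symm (t, z')).2) (u.1)⁻¹ z := by
      refine HasDerivAt.of_local_left_inverse hZc hu' hu1 ?_
      filter_upwards [hev] with z' hz'
      rw [hpair z' hz']
      exact hinv2 _ hz'
    have hu'' : HasDerivAt (fun ζ => (ψ (t, ζ)).2) u.2 x.2 := by
      rw [hx1] at hu
      exact HasFDerivAt.comp_hasDerivAt (l := Prod.snd) x.2 hasFDerivAt_snd hu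
    have h1 := hu''.comp_of_eq (h := fun z' => (Kh.symm (t, z')).2) z hZd rfl
    refine (h1.congr_of_eventuallyEq ?_).differentiableAt.differentiableWithinAt
    filter_upwards [hev] with z' hz'
    simp only [Function.comp]
    rw [hpair z' hz']
  · exact fun t ht z hz => hmemS (t, z) (hbox ⟨ht, hz⟩)
  · simp only
    rw [hsymm0, hψ0]; rfl
  -- The first component of this time derivative already vanishes, as `z` is fixed. Were `lam = 0`,
  -- injectivity of the differential would give `D (1, 0) = 0`, although its `t`-component is `1`.
  · intro h
    have h1 : fderiv ℝ ψ (0, 0) (D (1, 0)) = 0 := Prod.ext hfst h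
    have h2 := hinj (h1.trans (map_zero _).symm)
    rw [h2] at hD1
    exact zero_ne_one hD1
  · exact HasFDerivAt.comp_hasDerivAt (l := Prod.snd) 0 hasFDerivAt_snd hcurve2

end LeviFlat

/-! ### Normalization of the leaves and flattening coordinates. -/

namespace LeviFlat
open Set Metric Filter Topology Complex

lemma hasDerivAt_time {g : ℝ → ℂ → ℂ} {O : Set (ℝ × ℂ)} (hO : IsOpen O)
    (hg : ContDiffOn ℝ ∞ (fun x : ℝ × ℂ => g x.1 x.2) O) {t : ℝ} {z : ℂ} (h : (t, z) ∈ O) :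
    HasDerivAt (fun s => g s z) (fderiv ℝ (fun x : ℝ × ℂ => g x.1 x.2) (t, z) (1, 0)) t :=
  HasFDerivAt.comp_hasDerivAt (l := fun x : ℝ × ℂ => g x.1 x.2) (f := fun s : ℝ => (s, z)) t
    ((hg.differentiableOn (by simp)).differentiableAt (hO.mem_nhds h)).hasFDerivAt
    ((hasDerivAt_id _).prodMk (hasDerivAt_const _ _))

/-- After shrinking, `∂g/∂t` is within `‖lam‖ / 8` of its value `lam` at the origin; the mean value
inequality turns this into the Lipschitz condition `near`. -/
lemma exists_leafGraph {S : Set (ℂ × ℂ)} (h0 : (0 : ℂ × ℂ) ∈ S)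
    (hF : IsFoliatedByComplexCurves S) (hH : complexTangent S 0 = {v : ℂ × ℂ | v.2 = 0}) :
    ∃ (r ε : ℝ) (g : ℝ → ℂ → ℂ) (lam : ℂ), LeafGraph S r ε g lam := by
  obtain ⟨N, r, ψ, -, -, hr, hψ0, hψ, -, hinj, hholo, himg⟩ := hF 0 h0
  obtain ⟨r₁, ε₁, g, lam, hr₁, hε₁, hsm, hho, hmem, hz, hlam, hd⟩ := exists_graph hr hψ0 hψ
    (hinj (0, 0) ⟨by simpa using hr, mem_ball_self hr⟩) hholo (himg ▸ inter_subset_left) hH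
  set B : Set (ℝ × ℂ) := Ioo (-r₁) r₁ ×ˢ ball 0 ε₁ with hB
  have hBo : IsOpen B := isOpen_Ioo.prod isOpen_ball
  have h0B : ((0, 0) : ℝ × ℂ) ∈ B := ⟨by simpa using hr₁, mem_ball_self hε₁⟩
  set gt : ℝ × ℂ → ℂ := fun x => fderiv ℝ (fun x : ℝ × ℂ => g x.1 x.2) x (1, 0) with hgt
  have hgtc : ContinuousAt gt (0, 0) :=
    ((hsm.continuousOn_fderiv_of_isOpen hBo (by simp)).clm_apply continuousOn_const).continuousAt
      (hBo.mem_nhds h0B)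
  have hgt0 : gt (0, 0) = lam := (hasDerivAt_time hBo hsm h0B).unique hd
  have hlpos : 0 < ‖lam‖ := norm_pos_iff.2 hlam
  have hev : ∀ᶠ x in 𝓝 ((0, 0) : ℝ × ℂ), x ∈ B ∧ ‖gt x - lam‖ ≤ ‖lam‖ / 8 := by
    have h1 := (Metric.continuousAt_iff'.1 hgtc (‖lam‖ / 8) (by positivity))
    filter_upwards [h1, hBo.mem_nhds h0B] with x hx hx'
    rw [hgt0, dist_eq_norm] at hx
    exact ⟨hx', hx.le⟩
  obtain ⟨ρ, hρ, hρB⟩ := Metric.eventually_nhds_iff.1 hev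
  have hbox : ∀ t ∈ Ioo (-ρ) ρ, ∀ z ∈ ball (0 : ℂ) ρ,
      (t, z) ∈ B ∧ ‖gt (t, z) - lam‖ ≤ ‖lam‖ / 8 := by
    intro t ht z hz
    refine hρB ?_
    rw [Prod.dist_eq, max_lt_iff]
    exact ⟨by simpa [Real.dist_eq, abs_lt] using ht, hz⟩
  have h0I : (0 : ℝ) ∈ Ioo (-ρ) ρ := by simpa using hρ
  have hbB : ball (0 : ℂ) ρ ⊆ ball 0 ε₁ := fun z hz => (hbox 0 h0I z hz).1.2
  have hIB : Ioo (-ρ) ρ ⊆ Ioo (-r₁) r₁ := fun t ht => (hbox t ht 0 (mem_ball_self hρ)).1.1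
  refine ⟨ρ, ρ, g, lam, hρ, hρ, hsm.mono (prod_mono hIB hbB), fun t ht => (hho t (hIB ht)).mono hbB,
    fun t ht z hz => hmem t (hIB ht) z (hbB hz), hz, hlam, hd, ?_⟩
  intro z hz t ht t' ht'
  have h1 : ∀ s ∈ Ioo (-ρ) ρ, HasDerivWithinAt (fun s : ℝ => g s z - lam * s)
      (gt (s, z) - lam) (Ioo (-ρ) ρ) s := by
    intro s hs
    have h2 : HasDerivAt (fun s : ℝ => lam * (s : ℂ)) (lam * 1) s :=
      (HasDerivAt.ofReal_comp (hasDerivAt_id s)).const_mul lam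
    rw [mul_one] at h2
    exact ((hasDerivAt_time hBo hsm (hbox s hs z hz).1).sub h2).hasDerivWithinAt
  have h2 := (convex_Ioo (-ρ) ρ).norm_image_sub_le_of_norm_hasDerivWithin_le h1
    (fun s hs => (hbox s hs z hz).2) ht' ht
  rw [Real.norm_eq_abs] at h2
  refine le_of_eq_of_le ?_ h2
  congr 1
  ring

namespace LeafGraph
variable {S : Set (ℂ × ℂ)} {r ε : ℝ} {g : ℝ → ℂ → ℂ} {lam : ℂ}

/-- Time reversal, needed to orient the family when `U` lies below the leaves. -/
lemma neg (H : LeafGraph S r ε g lam) : LeafGraph S r ε (fun t => g (-t)) (-lam) := by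
  have hI : ∀ t ∈ Ioo (-r) r, -t ∈ Ioo (-r) r := fun t ht => ⟨by linarith [ht.2], by linarith [ht.1]⟩
  refine ⟨H.pos_r, H.pos_ε, ?_, fun t ht => H.holo _ (hI t ht), fun t ht => H.mem _ (hI t ht),
    by simpa using H.map_zero, neg_ne_zero.2 H.ne_zero, ?_, ?_⟩
  · exact H.smooth.comp (f := fun x : ℝ × ℂ => (-x.1, x.2)) (by fun_prop)
      fun x hx => ⟨hI _ hx.1, hx.2⟩
  · have h0 : HasDerivAt (fun t => g t 0) lam (-0) := by rw [neg_zero]; exact H.hasDerivAt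
    have := h0.scomp (0 : ℝ) (hasDerivAt_neg (0 : ℝ))
    simpa [Function.comp_def] using this
  · intro z hz t ht t' ht'
    have := H.near z hz _ (hI t ht) _ (hI t' ht')
    rw [norm_neg]
    have e : |-t - -t'| = |t - t'| := by rw [← abs_neg]; congr 1; ring
    rw [e] at this
    refine le_of_eq_of_le ?_ this
    congr 1
    push_cast
    ring

end LeafGraph

/-- Truncation to the interval `[-τ, τ]`. -/
noncomputable def clamp (τ t : ℝ) : ℝ := max (-τ) (min τ t)

lemma abs_clamp_sub_le (τ t t' : ℝ) : |clamp τ t - clamp τ t'| ≤ |t - t'| := by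
  unfold clamp
  refine (abs_max_sub_max_le_max _ _ _ _).trans ?_
  rw [sub_self, abs_zero]
  refine max_le (abs_nonneg _) ((abs_min_sub_min_le_max _ _ _ _).trans ?_)
  rw [sub_self, abs_zero]
  exact max_le (abs_nonneg _) le_rfl

lemma clamp_eq {τ t : ℝ} (h : |t| ≤ τ) : clamp τ t = t := by
  rw [abs_le] at h
  rw [clamp, min_eq_right h.2, max_eq_right h.1]

lemma abs_clamp_le {τ t : ℝ} (h : 0 ≤ τ) : |clamp τ t| ≤ τ := by
  rw [abs_le]
  exact ⟨le_max_left _ _, max_le (by linarith) (min_le_left _ _)⟩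

lemma continuous_clamp (τ : ℝ) : Continuous (clamp τ) := by
  unfold clamp; fun_prop

/-- The normalized family of leaves, defined for all times. -/
noncomputable def normFam (g : ℝ → ℂ → ℂ) (lam : ℂ) (τ t : ℝ) (z : ℂ) : ℂ :=
  g (clamp τ t) z / lam + ((t : ℂ) - clamp τ t)

/-- Flattening coordinates: the leaves are the images of the real values of the second variable. -/
noncomputable def flat (g : ℝ → ℂ → ℂ) (lam : ℂ) (τ : ℝ) (x : ℂ × ℂ) : ℂ × ℂ :=
  (x.1, lam * shear (fun t => normFam g lam τ t x.1) x.2)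

lemma normFam_neg (g : ℝ → ℂ → ℂ) (lam : ℂ) {τ : ℝ} {t : ℝ} (ht : |t| ≤ τ) (z : ℂ) :
    normFam (fun t => g (-t)) (-lam) τ t z = -normFam g lam τ (-t) z := by
  have ht' : |-t| ≤ τ := by rwa [abs_neg]
  simp only [normFam, clamp_eq ht, clamp_eq ht', sub_self, add_zero, div_neg]

/-- Reversing time together with the sign of `lam` is the substitution `ζ ↦ -ζ`, which exchanges the
two sides of `S`. -/
lemma flat_neg (g : ℝ → ℂ → ℂ) (lam : ℂ) {τ : ℝ} (z ζ : ℂ) (hζ : |ζ.re| ≤ τ) :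
    flat (fun t => g (-t)) (-lam) τ (z, ζ) = flat g lam τ (z, -ζ) := by
  simp only [flat, shear, normFam_neg g lam hζ, neg_re, neg_im, ofReal_neg]
  refine Prod.ext rfl ?_
  simp only
  ring

/-- The open square. -/
def square (τ : ℝ) : Set ℂ := Ioo (-τ) τ ×ℂ Ioo (-τ) τ

lemma mem_square {τ : ℝ} {ζ : ℂ} : ζ ∈ square τ ↔ |ζ.re| < τ ∧ |ζ.im| < τ := by
  rw [square, mem_reProdIm, mem_Ioo, mem_Ioo, abs_lt, abs_lt]

lemma isOpen_square (τ : ℝ) : IsOpen (square τ) := isOpen_Ioo.reProdIm isOpen_Ioo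

namespace LeafGraph
variable {S : Set (ℂ × ℂ)} {r ε : ℝ} {g : ℝ → ℂ → ℂ} {lam : ℂ}

lemma clamp_mem (H : LeafGraph S r ε g lam) (t : ℝ) : clamp (r / 2) t ∈ Ioo (-r) r := by
  have := H.pos_r
  have h1 := abs_clamp_le (t := t) (half_pos this).le
  exact abs_lt.1 (by linarith)

/-- Dividing by `lam` normalizes the time derivative to nearly `1`. Outside the window of the clamp
the family is continued with slope exactly `1`; since the clamp is `1`-Lipschitz, the bound `1/8`
holds for all times, as `NearId` requires. -/
lemma nearId (H : LeafGraph S r ε g lam) {z : ℂ} (hz : z ∈ ball (0 : ℂ) ε) :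
    NearId fun t => normFam g lam (r / 2) t z := by
  intro t t'
  have hl := norm_pos_iff.2 H.ne_zero
  have h1 := H.near z hz _ (H.clamp_mem t) _ (H.clamp_mem t')
  have hlam := H.ne_zero
  have e : normFam g lam (r / 2) t z - normFam g lam (r / 2) t' z - ((t : ℂ) - t') =
      (g (clamp (r / 2) t) z - g (clamp (r / 2) t') z -
        lam * ((clamp (r / 2) t : ℂ) - clamp (r / 2) t')) / lam := by
    simp only [normFam]
    field_simp
    ring
  rw [e, norm_div, div_le_iff₀ hl]
  refine h1.trans ?_
  have := abs_clamp_sub_le (r / 2) t t'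
  have h2 : ‖lam‖ / 8 * |clamp (r / 2) t - clamp (r / 2) t'| ≤ ‖lam‖ / 8 * |t - t'| :=
    mul_le_mul_of_nonneg_left this (by positivity)
  linarith

lemma lam_mul_normFam (H : LeafGraph S r ε g lam) {t : ℝ} (ht : |t| ≤ r / 2) (z : ℂ) :
    lam * normFam g lam (r / 2) t z = g t z := by
  have := H.ne_zero
  rw [normFam, clamp_eq ht]
  field_simp
  ring

lemma normFam_eq (H : LeafGraph S r ε g lam) {t : ℝ} (ht : |t| ≤ r / 2) (z : ℂ) :
    normFam g lam (r / 2) t z = g t z / lam := by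
  rw [← H.lam_mul_normFam ht, mul_div_cancel_left₀ _ H.ne_zero]

lemma continuousOn_normFam (H : LeafGraph S r ε g lam) :
    ContinuousOn (fun x : ℝ × ℂ => normFam g lam (r / 2) x.1 x.2) (univ ×ˢ ball 0 ε) := by
  have hc := continuous_clamp (r / 2)
  have h1 : ContinuousOn (fun x : ℝ × ℂ => g (clamp (r / 2) x.1) x.2) (univ ×ˢ ball 0 ε) :=
    H.smooth.continuousOn.comp (f := fun x : ℝ × ℂ => (clamp (r / 2) x.1, x.2))
      (by fun_prop) fun x hx => ⟨H.clamp_mem _, hx.2⟩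
  exact (h1.div_const _).add (by fun_prop)

lemma continuousOn_normFam_right (H : LeafGraph S r ε g lam) (t : ℝ) :
    ContinuousOn (normFam g lam (r / 2) t) (ball 0 ε) :=
  H.continuousOn_normFam.comp (f := fun z : ℂ => (t, z)) (by fun_prop) fun _ hz => ⟨mem_univ _, hz⟩

lemma continuousOn_flat (H : LeafGraph S r ε g lam) :
    ContinuousOn (flat g lam (r / 2)) (ball 0 ε ×ˢ univ) := by
  have h1 : ContinuousOn (fun x : ℂ × ℂ => normFam g lam (r / 2) x.2.re x.1) (ball 0 ε ×ˢ univ) :=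
    H.continuousOn_normFam.comp (f := fun x : ℂ × ℂ => (x.2.re, x.1)) (by fun_prop)
      fun x hx => ⟨mem_univ _, hx.1⟩
  exact continuousOn_fst.prodMk (continuousOn_const.mul (h1.add (by fun_prop)))

lemma flat_zero (H : LeafGraph S r ε g lam) : flat g lam (r / 2) (0, 0) = 0 := by
  have h := H.lam_mul_normFam (t := 0) (by rw [abs_zero]; exact (half_pos H.pos_r).le) 0
  rw [H.map_zero] at h
  refine Prod.ext rfl ?_
  simpa [flat, shear] using h

lemma flat_of_im_eq_zero (H : LeafGraph S r ε g lam) {z ζ : ℂ} (hζ : |ζ.re| ≤ r / 2)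
    (h0 : ζ.im = 0) : flat g lam (r / 2) (z, ζ) = (z, g ζ.re z) := by
  simp only [flat, shear, h0, ofReal_zero, zero_mul, add_zero, H.lam_mul_normFam hζ]

lemma exists_small (H : LeafGraph S r ε g lam) {A : Set (ℂ × ℂ)} (hA : A ∈ 𝓝 (0 : ℂ × ℂ)) :
    ∃ ρ > 0, ρ ≤ r / 4 ∧ ρ ≤ ε / 2 ∧ ∀ z ∈ ball (0 : ℂ) ρ, ∀ ζ : ℂ, |ζ.re| ≤ ρ → |ζ.im| ≤ ρ →
      flat g lam (r / 2) (z, ζ) ∈ A := by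
  have h0 : ((0, 0) : ℂ × ℂ) ∈ ball (0 : ℂ) ε ×ˢ univ := ⟨mem_ball_self H.pos_ε, mem_univ _⟩
  have hc := H.continuousOn_flat.continuousAt ((isOpen_ball.prod isOpen_univ).mem_nhds h0)
  have hA' : A ∈ 𝓝 (flat g lam (r / 2) (0, 0)) := by rwa [H.flat_zero]
  obtain ⟨ρ, hρ, hρA⟩ := Metric.eventually_nhds_iff.1 (hc.eventually hA')
  have := H.pos_r
  have := H.pos_ε
  refine ⟨min (ρ / 3) (min (r / 4) (ε / 2)), by positivity,
    (min_le_right _ _).trans (min_le_left _ _), (min_le_right _ _).trans (min_le_right _ _),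
    fun z hz ζ h1 h2 => hρA ?_⟩
  have h3 := min_le_left (ρ / 3) (min (r / 4) (ε / 2))
  rw [mem_ball, dist_zero_right] at hz
  rw [Prod.dist_eq, max_lt_iff, dist_zero_right, dist_zero_right]
  have h4 := norm_le_abs_re_add_abs_im ζ
  exact ⟨by simp only; linarith, by simp only; linarith⟩

/-- The image of a product neighborhood under the flattening coordinates. -/
def box (g : ℝ → ℂ → ℂ) (lam : ℂ) (r ρ τ : ℝ) : Set (ℂ × ℂ) :=
  {x | x.1 ∈ ball (0 : ℂ) ρ ∧
    x.2 / lam ∈ shear (fun t => normFam g lam (r / 2) t x.1) '' square τ}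

lemma mem_box (H : LeafGraph S r ε g lam) {ρ τ : ℝ} {x : ℂ × ℂ} : x ∈ box g lam r ρ τ ↔
    ∃ z ∈ ball (0 : ℂ) ρ, ∃ ζ ∈ square τ, flat g lam (r / 2) (z, ζ) = x := by
  have hl := H.ne_zero
  constructor
  · rintro ⟨h1, ζ, hζ, h2⟩
    refine ⟨x.1, h1, ζ, hζ, Prod.ext rfl ?_⟩
    simp only [flat]
    rw [h2]
    field_simp
  · rintro ⟨z, hz, ζ, hζ, rfl⟩
    refine ⟨hz, ζ, hζ, ?_⟩
    simp only [flat]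
    field_simp

lemma isOpen_box (H : LeafGraph S r ε g lam) {ρ τ : ℝ} (hρ : ρ ≤ ε) :
    IsOpen (box g lam r ρ τ) := by
  rw [isOpen_iff_mem_nhds]
  rintro ⟨z, w⟩ ⟨hz, ζ, hζ, hw⟩
  have hB := ball_subset_ball (x := (0 : ℂ)) hρ
  have he := eventually_mem_shear_image (fun z hz => H.nearId (hB hz))
    (fun t => (H.continuousOn_normFam_right t).mono hB) hz (isOpen_square τ) hζ
  simp only at hw
  rw [hw] at he
  have hc : ContinuousAt (fun x : ℂ × ℂ => (x.1, x.2 / lam)) (z, w) := by fun_prop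
  filter_upwards [hc.eventually he] with x hx
  exact hx

end LeafGraph
end LeviFlat

/-! ### The two sides of the hypersurface. -/

namespace LeviFlat
open Set Metric Filter Topology Complex

namespace LeafGraph
variable {S U : Set (ℂ × ℂ)} {r ε : ℝ} {g : ℝ → ℂ → ℂ} {lam : ℂ}

lemma zero_mem (H : LeafGraph S r ε g lam) : (0 : ℂ × ℂ) ∈ S := by
  have := H.mem 0 (by simpa using H.pos_r) 0 (mem_ball_self H.pos_ε)
  rwa [H.map_zero] at this

/-- The normal derivative of a defining function does not vanish in the direction `I * lam`. -/
lemma fderiv_ne_zero (H : LeafGraph S r ε g lam) {N : Set (ℂ × ℂ)} {ρ : ℂ × ℂ → ℝ}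
    (hN : N ∈ 𝓝 (0 : ℂ × ℂ)) (hρ : DifferentiableAt ℝ ρ 0) (h0 : fderiv ℝ ρ 0 ≠ 0)
    (hS : ∀ x ∈ S ∩ N, ρ x = 0) : fderiv ℝ ρ 0 (0, lam * I) ≠ 0 := by
  intro hI
  set D := fderiv ℝ ρ 0 with hD
  have hcurve : ∀ (c : ℝ → ℂ × ℂ) (v : ℂ × ℂ), HasDerivAt c v 0 → c 0 = 0 →
      (∀ᶠ s in 𝓝 0, c s ∈ S) → D v = 0 := by
    intro c v hc hc0 hcS
    have hρ' : HasFDerivAt ρ D (c 0) := by rw [hc0]; exact hρ.hasFDerivAt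
    have h1 : HasDerivAt (fun s => ρ (c s)) (D v) 0 := hρ'.comp_hasDerivAt 0 hc
    have h2 : HasDerivAt (fun s => ρ (c s)) 0 0 := by
      refine (hasDerivAt_const (0 : ℝ) (0 : ℝ)).congr_of_eventuallyEq ?_
      have hN' : N ∈ 𝓝 (c 0) := by rwa [hc0]
      filter_upwards [hcS, hc.continuousAt.eventually hN'] with s h3 h4 using hS _ ⟨h3, h4⟩
    exact h1.unique h2
  have h0ε := mem_ball_self (x := (0 : ℂ)) H.pos_ε
  have h0r : (0 : ℝ) ∈ Ioo (-r) r := by simpa using H.pos_r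
  have h1 : D (0, lam) = 0 := by
    refine hcurve (fun t => (0, g t 0)) _ ((hasDerivAt_const _ _).prodMk H.hasDerivAt)
      (by simp [H.map_zero]) ?_
    filter_upwards [isOpen_Ioo.mem_nhds h0r] with t ht using H.mem t ht 0 h0ε
  set a := deriv (g 0) 0 with ha
  have h2 : ∀ c : ℂ, D (c, c * a) = 0 := by
    intro c
    have hg : HasDerivAt (g 0) a 0 :=
      ((H.holo 0 h0r).differentiableAt (isOpen_ball.mem_nhds h0ε)).hasDerivAt
    have hl : HasDerivAt (fun s : ℝ => (s : ℂ) * c) c 0 := by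
      simpa using (HasDerivAt.ofReal_comp (hasDerivAt_id (0 : ℝ))).mul_const c
    have hg' : HasDerivAt (fun s : ℝ => g 0 ((s : ℂ) * c)) (a * c) 0 :=
      hg.comp_of_eq (h := fun s : ℝ => (s : ℂ) * c) 0 hl (by simp)
    rw [mul_comm] at hg'
    refine hcurve (fun s => ((s : ℂ) * c, g 0 ((s : ℂ) * c))) _ (hl.prodMk hg')
      (by simp [H.map_zero]) ?_
    have hb : ball (0 : ℂ) ε ∈ 𝓝 ((fun s : ℝ => (s : ℂ) * c) 0) := by
      simpa using ball_mem_nhds (0 : ℂ) H.pos_ε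
    filter_upwards [hl.continuousAt.eventually hb] with s hs using H.mem 0 h0r _ hs
  apply h0
  refine ContinuousLinearMap.ext fun p => ?_
  obtain ⟨x, y⟩ := p
  set q := (y - x * a) / lam with hq
  have hl := H.ne_zero
  -- `ℂ²` is spanned over `ℝ` by the leaf directions `(x, x a)`, the transverse tangent vector `(0,
  -- lam)` and `(0, lam I)`. The differential kills the first two kinds, so vanishing on the third
  -- would make it zero.
  have e : ((x, y) : ℂ × ℂ) = (x, x * a) + (q.re • ((0, lam) : ℂ × ℂ) + q.im • ((0, lam * I) : ℂ × ℂ)) := by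
    refine Prod.ext (by simp) ?_
    simp only [Prod.snd_add, Prod.smul_snd, real_smul]
    have h3 : (q.re : ℂ) * lam + (q.im : ℂ) * (lam * I) = q * lam := by
      nth_rewrite 3 [← re_add_im q]; ring
    rw [h3, hq]
    field_simp
    ring
  rw [e, map_add, map_add, map_smul, map_smul, h1, h2, hI]
  simp

/-- Rolle's theorem: a further point of `S` on the vertical segment over a leaf would make a
defining function vanish at both ends, hence its derivative in the direction `lam I` vanish in
between, which is excluded on `A`. -/
lemma exists_mem_iff (H : LeafGraph S r ε g lam) (hS : IsSmoothHypersurface S) :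
    ∃ A ∈ 𝓝 (0 : ℂ × ℂ), ∀ ρ ≤ r / 4, ρ ≤ ε / 2 → (∀ z ∈ ball (0 : ℂ) ρ, ∀ ζ : ℂ, |ζ.re| ≤ ρ →
      |ζ.im| ≤ ρ → flat g lam (r / 2) (z, ζ) ∈ A) → ∀ z ∈ ball (0 : ℂ) ρ, ∀ ζ ∈ square ρ,
        (flat g lam (r / 2) (z, ζ) ∈ S ↔ ζ.im = 0) := by
  obtain ⟨N, f, hNo, h0N, hf, hf0, hSN⟩ := hS 0 H.zero_mem
  have hSf : ∀ x ∈ S ∩ N, f x = 0 := fun x hx => (hSN ▸ hx : x ∈ {q ∈ N | f q = 0}).2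
  have hfd : ∀ x ∈ N, HasFDerivAt f (fderiv ℝ f x) x := fun x hx =>
    ((hf.differentiableOn (by simp)).differentiableAt (hNo.mem_nhds hx)).hasFDerivAt
  have hne := H.fderiv_ne_zero (hNo.mem_nhds h0N) (hfd 0 h0N).differentiableAt (hf0 0 h0N) hSf
  set A : Set (ℂ × ℂ) := {x ∈ N | fderiv ℝ f x (0, lam * I) ≠ 0} with hA
  have hAo : IsOpen A :=
    ((hf.continuousOn_fderiv_of_isOpen hNo (by simp)).clm_apply
      continuousOn_const).isOpen_inter_preimage hNo isOpen_ne
  refine ⟨A, hAo.mem_nhds ⟨h0N, hne⟩, fun ρ hρr hρε hρA z hz ζ hζ => ?_⟩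
  rw [mem_square] at hζ
  have hr := H.pos_r
  have hz' : z ∈ ball (0 : ℂ) ε := ball_subset_ball (by linarith [H.pos_ε]) hz
  have hmem : ∀ t : ℝ, |t| < ρ → (z, g t z) ∈ S := fun t ht =>
    H.mem t (abs_lt.1 (by linarith)) z hz'
  constructor
  · intro hζS
    set c : ℝ → ℂ × ℂ := fun s => flat g lam (r / 2) (z, ζ.re + s * I) with hc
    have hcd : ∀ s, HasDerivAt c (0, lam * I) s := by
      intro s
      have h1 : HasDerivAt (fun s : ℝ => lam * (normFam g lam (r / 2) ζ.re z + (s : ℂ) * I))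
          (lam * (1 * I)) s :=
        (((HasDerivAt.ofReal_comp (hasDerivAt_id s)).mul_const I).const_add _).const_mul lam
      rw [one_mul] at h1
      have h2 := (hasDerivAt_const s z).prodMk h1
      refine h2.congr_of_eventuallyEq (Eventually.of_forall fun s => ?_)
      simp [hc, flat, shear]
    have hcA : ∀ s, |s| ≤ ρ → c s ∈ A := fun s hs =>
      hρA z hz _ (by simpa using hζ.1.le) (by simpa using hs)
    have hfc : ∀ s, |s| ≤ ρ → HasDerivAt (fun s => f (c s)) (fderiv ℝ f (c s) (0, lam * I)) s :=
      fun s hs => (hfd _ (hcA s hs).1).comp_hasDerivAt s (hcd s)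
    have hc0 : f (c 0) = 0 := by
      have e : c 0 = (z, g ζ.re z) := by
        simp only [hc]
        rw [H.flat_of_im_eq_zero (by simp; linarith) (by simp)]
        simp
      exact hSf _ ⟨by rw [e]; exact hmem _ hζ.1, (hcA 0 (by
        rw [abs_zero]; exact (abs_nonneg _).trans hζ.1.le)).1⟩
    have hc1 : f (c ζ.im) = 0 := by
      have e : c ζ.im = flat g lam (r / 2) (z, ζ) := by simp only [hc, re_add_im]
      exact hSf _ ⟨by rw [e]; exact hζS, (hcA ζ.im hζ.2.le).1⟩
    by_contra him
    have hlt := abs_lt.1 hζ.2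
    rcases lt_or_gt_of_ne him with h | h
    · have hin : ∀ s ∈ Icc ζ.im 0, |s| ≤ ρ := fun s hs =>
        abs_le.2 ⟨by linarith [hs.1], by linarith [hs.2]⟩
      obtain ⟨s, hs, hs0⟩ := exists_hasDerivAt_eq_zero h
        (fun s hs => (hfc s (hin s hs)).continuousAt.continuousWithinAt)
        (hc1.trans hc0.symm) (fun s hs => hfc s (hin s (Ioo_subset_Icc_self hs)))
      exact (hcA s (hin s (Ioo_subset_Icc_self hs))).2 hs0
    · have hin : ∀ s ∈ Icc 0 ζ.im, |s| ≤ ρ := fun s hs =>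
        abs_le.2 ⟨by linarith [hs.1], by linarith [hs.2]⟩
      obtain ⟨s, hs, hs0⟩ := exists_hasDerivAt_eq_zero h
        (fun s hs => (hfc s (hin s hs)).continuousAt.continuousWithinAt)
        (hc0.trans hc1.symm) (fun s hs => hfc s (hin s (Ioo_subset_Icc_self hs)))
      exact (hcA s (hin s (Ioo_subset_Icc_self hs))).2 hs0
  · intro h
    rw [H.flat_of_im_eq_zero (by linarith) h]
    exact hmem _ hζ.1

/-- Near the origin `U` is one of the two sides of the leaves. -/
lemma exists_sides (H : LeafGraph S r ε g lam) (hS : IsLeviFlatGerm S U) :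
    ∃ ρ > 0, ρ ≤ r / 4 ∧ ρ ≤ ε / 2 ∧
      (∀ z ∈ ball (0 : ℂ) ρ, ∀ ζ ∈ square ρ, (flat g lam (r / 2) (z, ζ) ∈ S ↔ ζ.im = 0)) ∧
      ((∀ z ∈ ball (0 : ℂ) ρ, ∀ ζ ∈ square ρ, (flat g lam (r / 2) (z, ζ) ∈ U ↔ 0 < ζ.im)) ∨
        ∀ z ∈ ball (0 : ℂ) ρ, ∀ ζ ∈ square ρ, (flat g lam (r / 2) (z, ζ) ∈ U ↔ ζ.im < 0)) := by
  obtain ⟨h0S, hSs, -, 𝒰, U', h𝒰, -, hS𝒰, hU, -, hU', -, hdisj, hcompl, hclU, hclU'⟩ := hS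
  obtain ⟨A, hA, hiff⟩ := H.exists_mem_iff hSs
  obtain ⟨ρ, hρ, hρr, hρε, hsmall⟩ := H.exists_small
    (inter_mem hA (h𝒰.mem_nhds (hS𝒰 h0S)))
  have hSiff := hiff ρ hρr hρε fun z hz ζ h1 h2 => (hsmall z hz ζ h1 h2).1
  have hr := H.pos_r
  have hε := H.pos_ε
  have hB : ball (0 : ℂ) ρ ⊆ ball 0 ε := ball_subset_ball (by linarith)
  have hUS : ∀ x ∈ U, x ∉ S := fun x hx => ((hcompl ▸ Or.inl hx : x ∈ 𝒰 \ S)).2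
  have hUS' : ∀ x ∈ U', x ∉ S := fun x hx => ((hcompl ▸ Or.inr hx : x ∈ 𝒰 \ S)).2
  have hside : ∀ z ∈ ball (0 : ℂ) ρ, ∀ ζ ∈ square ρ, ζ.im ≠ 0 →
      flat g lam (r / 2) (z, ζ) ∈ U ∪ U' := by
    intro z hz ζ hζ h0
    rw [← hcompl]
    have h1 := mem_square.1 hζ
    exact ⟨(hsmall z hz ζ h1.1.le h1.2.le).2, fun h => h0 ((hSiff z hz ζ hζ).1 h)⟩
  have hsq : ∀ ζ ∈ rect ρ, ζ ∈ square ρ ∧ -ζ ∈ square ρ := fun ζ hζ => by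
    rw [mem_rect] at hζ
    rw [mem_square, mem_square, neg_re, neg_im, abs_neg, abs_neg, abs_of_pos hζ.2.1]
    exact ⟨⟨hζ.1, hζ.2.2⟩, hζ.1, hζ.2.2⟩
  have hpre : IsPreconnected (ball (0 : ℂ) ρ ×ˢ rect ρ) :=
    ((convex_ball _ _).prod (convex_rect ρ)).isPreconnected
  have hc1 : ContinuousOn (flat g lam (r / 2)) (ball (0 : ℂ) ρ ×ˢ rect ρ) :=
    H.continuousOn_flat.mono (prod_mono hB (subset_univ _))
  have hc2 : ContinuousOn (fun x : ℂ × ℂ => flat g lam (r / 2) (x.1, -x.2))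
      (ball (0 : ℂ) ρ ×ˢ rect ρ) :=
    H.continuousOn_flat.comp (f := fun x : ℂ × ℂ => (x.1, -x.2)) (by fun_prop)
      fun x hx => ⟨hB hx.1, mem_univ _⟩
  -- Each open half of the box is connected and misses `S`, so it lies entirely in one of the two
  -- components.
  have hpos := (hpre.image _ hc1).subset_or_subset hU hU' hdisj (by
    rintro _ ⟨⟨z, ζ⟩, ⟨hz, hζ⟩, rfl⟩
    exact hside z hz ζ (hsq ζ hζ).1 (mem_rect.1 hζ).2.1.ne')
  have hneg := (hpre.image _ hc2).subset_or_subset hU hU' hdisj (by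
    rintro _ ⟨⟨z, ζ⟩, ⟨hz, hζ⟩, rfl⟩
    exact hside z hz (-ζ) (hsq ζ hζ).2 (by simpa using (mem_rect.1 hζ).2.1.ne'))
  have hposm : ∀ z ∈ ball (0 : ℂ) ρ, ∀ ζ ∈ square ρ, 0 < ζ.im → flat g lam (r / 2) (z, ζ) ∈
      flat g lam (r / 2) '' (ball (0 : ℂ) ρ ×ˢ rect ρ) := fun z hz ζ hζ h => by
    have h1 := mem_square.1 hζ
    exact ⟨(z, ζ), ⟨hz, mem_rect.2 ⟨h1.1, h, (le_abs_self _).trans_lt h1.2⟩⟩, rfl⟩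
  have hnegm : ∀ z ∈ ball (0 : ℂ) ρ, ∀ ζ ∈ square ρ, ζ.im < 0 → flat g lam (r / 2) (z, ζ) ∈
      (fun x : ℂ × ℂ => flat g lam (r / 2) (x.1, -x.2)) '' (ball (0 : ℂ) ρ ×ˢ rect ρ) :=
    fun z hz ζ hζ h => by
    have h1 := mem_square.1 hζ
    refine ⟨(z, -ζ), ⟨hz, mem_rect.2 ⟨?_, ?_, ?_⟩⟩, ?_⟩
    · rw [neg_re, abs_neg]; exact h1.1
    · rw [neg_im]; linarith
    · rw [neg_im]; exact (neg_le_abs _).trans_lt h1.2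
    · simp
  -- Both components adhere to `0`, so each meets the box off `S`; this excludes that the two halves
  -- lie in the same component.
  have hboth : ∀ V : Set (ℂ × ℂ), IsOpen V → S ⊆ closure V → (∀ x ∈ V, x ∉ S) →
      ∃ z ∈ ball (0 : ℂ) ρ, ∃ ζ ∈ square ρ, ζ.im ≠ 0 ∧ flat g lam (r / 2) (z, ζ) ∈ V := by
    intro V hV hcl hVS
    have h0 : (0 : ℂ × ℂ) ∈ box g lam r ρ ρ := (H.mem_box).2
      ⟨0, mem_ball_self hρ, 0, mem_square.2 ⟨by simpa using hρ, by simpa using hρ⟩, H.flat_zero⟩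
    obtain ⟨x, hx, hxV⟩ := mem_closure_iff.1 (hcl h0S) _
      (H.isOpen_box (ρ := ρ) (τ := ρ) (by linarith)) h0
    obtain ⟨z, hz, ζ, hζ, rfl⟩ := (H.mem_box).1 hx
    exact ⟨z, hz, ζ, hζ, fun h => hVS _ hxV ((hSiff z hz ζ hζ).2 h), hxV⟩
  have hnot : ∀ x, x ∈ U → x ∈ U' → False := fun x h1 h2 => disjoint_left.1 hdisj h1 h2
  refine ⟨ρ, hρ, hρr, hρε, hSiff, ?_⟩
  rcases hpos with hp | hp <;> rcases hneg with hn | hn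
  · obtain ⟨z, hz, ζ, hζ, h0, hV⟩ := hboth U' hU' hclU' hUS'
    rcases lt_or_gt_of_ne h0 with h | h
    · exact (hnot _ (hn (hnegm z hz ζ hζ h)) hV).elim
    · exact (hnot _ (hp (hposm z hz ζ hζ h)) hV).elim
  · left
    intro z hz ζ hζ
    refine ⟨fun h => ?_, fun h => hp (hposm z hz ζ hζ h)⟩
    rcases lt_trichotomy ζ.im 0 with h1 | h1 | h1
    · exact (hnot _ h (hn (hnegm z hz ζ hζ h1))).elim
    · exact (hUS _ h ((hSiff z hz ζ hζ).2 h1)).elim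
    · exact h1
  · right
    intro z hz ζ hζ
    refine ⟨fun h => ?_, fun h => hn (hnegm z hz ζ hζ h)⟩
    rcases lt_trichotomy ζ.im 0 with h1 | h1 | h1
    · exact h1
    · exact (hUS _ h ((hSiff z hz ζ hζ).2 h1)).elim
    · exact (hnot _ h (hp (hposm z hz ζ hζ h1))).elim
  · obtain ⟨z, hz, ζ, hζ, h0, hV⟩ := hboth U hU hclU hUS
    rcases lt_or_gt_of_ne h0 with h | h
    · exact (hnot _ hV (hn (hnegm z hz ζ hζ h))).elim
    · exact (hnot _ hV (hp (hposm z hz ζ hζ h))).elim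

end LeafGraph

lemma exists_oriented_leafGraph {S U : Set (ℂ × ℂ)} (hS : IsLeviFlatGerm S U)
    (hH : complexTangent S 0 = {v : ℂ × ℂ | v.2 = 0}) :
    ∃ (r ε : ℝ) (g : ℝ → ℂ → ℂ) (lam : ℂ) (ρ : ℝ), LeafGraph S r ε g lam ∧ 0 < ρ ∧ ρ ≤ r / 4 ∧
      ρ ≤ ε / 2 ∧
      (∀ z ∈ ball (0 : ℂ) ρ, ∀ ζ ∈ square ρ, (flat g lam (r / 2) (z, ζ) ∈ S ↔ ζ.im = 0)) ∧
      ∀ z ∈ ball (0 : ℂ) ρ, ∀ ζ ∈ square ρ, (flat g lam (r / 2) (z, ζ) ∈ U ↔ 0 < ζ.im) := by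
  obtain ⟨r, ε, g, lam, H⟩ := exists_leafGraph hS.1 hS.2.2.1 hH
  obtain ⟨ρ, hρ, hρr, hρε, hSiff, hU | hU⟩ := H.exists_sides hS
  · exact ⟨r, ε, g, lam, ρ, H, hρ, hρr, hρε, hSiff, hU⟩
  · have hr := H.pos_r
    have hflat : ∀ z : ℂ, ∀ ζ ∈ square ρ, flat (fun t => g (-t)) (-lam) (r / 2) (z, ζ) =
        flat g lam (r / 2) (z, -ζ) := fun z ζ hζ =>
      flat_neg g lam z ζ (by linarith [(mem_square.1 hζ).1])
    have hneg : ∀ ζ ∈ square ρ, -ζ ∈ square ρ := fun ζ hζ => by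
      rw [mem_square] at *
      rwa [neg_re, neg_im, abs_neg, abs_neg]
    refine ⟨r, ε, _, _, ρ, H.neg, hρ, hρr, hρε, fun z hz ζ hζ => ?_, fun z hz ζ hζ => ?_⟩
    · rw [hflat z ζ hζ, hSiff z hz _ (hneg ζ hζ), neg_im, neg_eq_zero]
    · rw [hflat z ζ hζ, hU z hz _ (hneg ζ hζ), neg_im, neg_lt_zero]

end LeviFlat

/-! ### From the trivializing map to the leaf family; uniqueness of leaves. -/

namespace LeviFlat
open Set Metric Filter Topology Complex

/-- On a leaf the complex derivative is the real partial derivative in the direction `(0, 1)`, which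
is jointly smooth in `(t, z)`. -/
lemma contDiffOn_deriv_leaf {g : ℝ → ℂ → ℂ} {I : Set ℝ} {B : Set ℂ} (hI : IsOpen I) (hB : IsOpen B)
    (hg : ContDiffOn ℝ ∞ (fun x : ℝ × ℂ => g x.1 x.2) (I ×ˢ B))
    (hh : ∀ t ∈ I, DifferentiableOn ℂ (g t) B) :
    ContDiffOn ℝ ∞ (fun x : ℝ × ℂ => deriv (g x.1) x.2) (I ×ˢ B) := by
  have hO : IsOpen (I ×ˢ B) := hI.prod hB
  have h1 : ContDiffOn ℝ ∞ (fun x => fderiv ℝ (fun x : ℝ × ℂ => g x.1 x.2) x (0, 1)) (I ×ˢ B) :=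
    (hg.fderiv_of_isOpen hO (by simp)).clm_apply contDiffOn_const
  refine h1.congr ?_
  rintro ⟨t, z⟩ ⟨ht, hz⟩
  have h2 := ((hh t ht).differentiableAt (hB.mem_nhds hz)).hasDerivAt.hasFDerivAt.restrictScalars ℝ
  have h3 : HasFDerivAt (g t) ((fderiv ℝ (fun x : ℝ × ℂ => g x.1 x.2) (t, z)).comp
      (ContinuousLinearMap.inr ℝ ℝ ℂ)) z :=
    HasFDerivAt.comp z (g := fun x : ℝ × ℂ => g x.1 x.2) (f := fun ζ => (t, ζ))
      ((hg.differentiableOn (by simp)).differentiableAt (hO.mem_nhds ⟨ht, hz⟩)).hasFDerivAt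
      (hasFDerivAt_prodMk_right t z)
  have h4 := congrArg (fun T : ℂ →L[ℝ] ℂ => T 1) (h2.unique h3)
  simpa using h4

lemma contDiffOn_iteratedDeriv_leaf {g : ℝ → ℂ → ℂ} {I : Set ℝ} {B : Set ℂ} (hI : IsOpen I)
    (hB : IsOpen B) (hg : ContDiffOn ℝ ∞ (fun x : ℝ × ℂ => g x.1 x.2) (I ×ˢ B))
    (hh : ∀ t ∈ I, DifferentiableOn ℂ (g t) B) (k : ℕ) :
    ContDiffOn ℝ ∞ (fun x : ℝ × ℂ => iteratedDeriv k (g x.1) x.2) (I ×ˢ B) ∧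
      ∀ t ∈ I, DifferentiableOn ℂ (iteratedDeriv k (g t)) B := by
  induction k with
  | zero => simpa only [iteratedDeriv_zero] using And.intro hg hh
  | succ k ih =>
    simp only [iteratedDeriv_succ]
    exact ⟨contDiffOn_deriv_leaf (g := fun t => iteratedDeriv k (g t)) hI hB ih.1 ih.2,
      fun t ht => (ih.2 t ht).deriv hB⟩

namespace LeafGraph
variable {S U : Set (ℂ × ℂ)} {r ε : ℝ} {g : ℝ → ℂ → ℂ} {lam : ℂ}

lemma hasDerivAt_normFam (H : LeafGraph S r ε g lam) {t : ℝ} (ht : |t| < r / 2) {z : ℂ}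
    (hz : z ∈ ball (0 : ℂ) ε) : HasDerivAt (fun t => normFam g lam (r / 2) t z)
      (fderiv ℝ (fun x : ℝ × ℂ => g x.1 x.2) (t, z) (1, 0) / lam) t := by
  have hr := H.pos_r
  have h1 := (hasDerivAt_time (isOpen_Ioo.prod isOpen_ball) H.smooth
    (t := t) (z := z) ⟨abs_lt.1 (by linarith), hz⟩).div_const lam
  refine h1.congr_of_eventuallyEq ?_
  filter_upwards [continuous_abs.continuousAt.eventually_lt_const ht] with s hs
    using H.normFam_eq hs.le z

lemma iteratedDeriv_normFam (H : LeafGraph S r ε g lam) {t : ℝ} (ht : |t| ≤ r / 2) (k : ℕ) (z : ℂ) :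
    iteratedDeriv k (normFam g lam (r / 2) t) z = iteratedDeriv k (g t) z / lam := by
  have : normFam g lam (r / 2) t = fun z => lam⁻¹ * g t z :=
    funext fun z => by rw [H.normFam_eq ht, div_eq_inv_mul]
  rw [this, iteratedDeriv_const_mul_field, div_eq_inv_mul]

lemma isLeafParam (H : LeafGraph S r ε g lam) {ρ σ τ : ℝ} (hρr : ρ ≤ r / 4) (hρε : ρ ≤ ε / 2)
    (hS : ∀ z ∈ ball (0 : ℂ) ρ, ∀ ζ ∈ square ρ, (flat g lam (r / 2) (z, ζ) ∈ S ↔ ζ.im = 0))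
    (hσ : 0 < σ) (hσρ : σ ≤ ρ) (hτ : 0 < τ) (hτρ : τ ≤ ρ) :
    IsLeafParam S τ σ (box g lam r σ τ) g := by
  have hr := H.pos_r
  have hε := H.pos_ε
  have hl := H.ne_zero
  have hB : ball (0 : ℂ) σ ⊆ ball 0 ε := ball_subset_ball (by linarith)
  have hI : Ioo (-τ) τ ⊆ Ioo (-r) r := Ioo_subset_Ioo (by linarith) (by linarith)
  have habs : ∀ t ∈ Ioo (-τ) τ, |t| < r / 2 := fun t ht => by
    have := abs_lt.2 ht
    linarith
  have hgf : ∀ t ∈ Ioo (-τ) τ, ∀ z, flat g lam (r / 2) (z, (t : ℂ)) = (z, g t z) := by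
    intro t ht z
    rw [H.flat_of_im_eq_zero (by rw [ofReal_re]; exact (habs t ht).le) (ofReal_im t), ofReal_re]
  refine
  { pos_δ := hτ
    pos_ε := hσ
    isOpen := H.isOpen_box (by linarith)
    zero_mem := H.mem_box.2 ⟨0, mem_ball_self hσ, 0, mem_square.2 (by simpa using hτ), H.flat_zero⟩
    map_zero := H.map_zero
    smooth := H.smooth.mono (prod_mono hI hB)
    holo := fun t ht => (H.holo t (hI ht)).mono hB
    regular := ?_
    inj := ?_
    image := ?_ }
  · intro t ht z hz
    rw [(hasDerivAt_time (isOpen_Ioo.prod isOpen_ball) H.smooth ⟨hI ht, hB hz⟩).deriv]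
    intro h0
    have h1 := (H.nearId (hB hz)).norm_deriv_ge (H.hasDerivAt_normFam (habs t ht) (hB hz))
    rw [h0, zero_div, norm_zero] at h1
    linarith
  · rintro ⟨t, z⟩ ⟨ht, hz⟩ ⟨t', z'⟩ ⟨ht', hz'⟩ he
    simp only [Prod.mk.injEq] at he
    obtain ⟨rfl, he⟩ := he
    have h1 := (H.nearId (hB hz)).norm_sub_ge t t'
    rw [H.normFam_eq (habs t ht).le, H.normFam_eq (habs t' ht').le, he, sub_self, norm_zero] at h1
    have h2 : |t - t'| = 0 := le_antisymm (by linarith) (abs_nonneg _)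
    rw [sub_eq_zero.1 (abs_eq_zero.1 h2)]
  · ext x
    constructor
    · rintro ⟨⟨t, z⟩, ⟨ht, hz⟩, rfl⟩
      exact ⟨H.mem t (hI ht) z (hB hz), H.mem_box.2 ⟨z, hz, t, mem_square.2
        ⟨by rw [ofReal_re]; exact abs_lt.2 ht, by rwa [ofReal_im, abs_zero]⟩, hgf t ht z⟩⟩
    · rintro ⟨hxS, hx⟩
      obtain ⟨z, hz, ζ, hζ, rfl⟩ := H.mem_box.1 hx
      rw [mem_square] at hζ
      have h0 := (hS z (ball_subset_ball hσρ hz) ζ (mem_square.2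
        ⟨hζ.1.trans_le hτρ, hζ.2.trans_le hτρ⟩)).1 hxS
      have ht := abs_lt.1 hζ.1
      exact ⟨(ζ.re, z), ⟨ht, hz⟩, (H.flat_of_im_eq_zero (habs _ ht).le h0).symm⟩

/-- The abstract theory applies to `h (z, w) = (Φ (z, lam w)).2` in the rescaled variable. The
constants are uniform in `z`: the Lipschitz bound for `∂g/∂t` holds on a compact box, `χ` does not
involve `z`, and `M₀` bounds `Φ` on the whole box. -/
lemma exists_leafFamily (H : LeafGraph S r ε g lam) {ρ : ℝ} (hρ : 0 < ρ) (hρr : ρ ≤ r / 4)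
    (hρε : ρ ≤ ε / 2)
    (hS : ∀ z ∈ ball (0 : ℂ) ρ, ∀ ζ ∈ square ρ, (flat g lam (r / 2) (z, ζ) ∈ S ↔ ζ.im = 0))
    (hU : ∀ z ∈ ball (0 : ℂ) ρ, ∀ ζ ∈ square ρ, (flat g lam (r / 2) (z, ζ) ∈ U ↔ 0 < ζ.im))
    {V : Set (ℂ × ℂ)} {Φ : ℂ × ℂ → ℂ × ℂ} (hVU : IsOpen (V ∩ U))
    (hd : DifferentiableOn ℂ Φ (V ∩ U)) (hpos : ∀ p ∈ V ∩ U, 0 < (Φ p).2.im)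
    (hre : ∀ p ∈ V ∩ S, (Φ p).2.im = 0) (hc : ContinuousOn Φ (V ∩ (U ∪ S)))
    (hCR : IsSmoothCROn Φ S V)
    (hV : ∀ z ∈ ball (0 : ℂ) ρ, ∀ ζ ∈ square ρ, flat g lam (r / 2) (z, ζ) ∈ V) {M₀ : ℝ}
    (hM₀ : ∀ z ∈ ball (0 : ℂ) ρ, ∀ ζ ∈ square ρ, flat g lam (r / 2) (z, ζ) ∈ U ∪ S →
      ‖Φ (flat g lam (r / 2) (z, ζ))‖ ≤ M₀) :
    ∃ L M : ℝ, LeafFamily (normFam g lam (r / 2))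
      (fun t z => fderiv ℝ (fun x : ℝ × ℂ => g x.1 x.2) (t, z) (1, 0) / lam)
      (fun p => (Φ (p.1, lam * p.2)).2) (fun t => (Φ (0, g t 0)).2)
      (deriv fun t => (Φ (0, g t 0)).2) (ρ / 2) (ρ / 2) L M := by
  have hr := H.pos_r
  have hε := H.pos_ε
  have hl := H.ne_zero
  have hlpos := norm_pos_iff.2 hl
  set O : Set (ℝ × ℂ) := Ioo (-r) r ×ˢ ball 0 ε with hO
  have hOo : IsOpen O := isOpen_Ioo.prod isOpen_ball
  set G : ℝ × ℂ → ℂ := fun x => fderiv ℝ (fun x : ℝ × ℂ => g x.1 x.2) x (1, 0) / lam with hG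
  have hGs : ContDiffOn ℝ ∞ G O :=
    ((H.smooth.fderiv_of_isOpen hOo (by simp)).clm_apply contDiffOn_const).div_const lam
  have hKO : Icc (-(ρ / 2)) (ρ / 2) ×ˢ closedBall (0 : ℂ) (ρ / 2) ⊆ O :=
    prod_mono (Icc_subset_Ioo (by linarith) (by linarith)) (closedBall_subset_ball (by linarith))
  obtain ⟨L₁, hL₁⟩ := ((hGs.mono hKO).of_le (by simp : (1 : WithTop ℕ∞) ≤ ∞)).exists_lipschitzOnWith
    (by simp) ((convex_Icc _ _).prod (convex_closedBall _ _))
    (isCompact_Icc.prod (isCompact_closedBall _ _))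
  have hB : ball (0 : ℂ) ρ ⊆ ball 0 ε := ball_subset_ball (by linarith)
  have hB2 : ball (0 : ℂ) (ρ / 2) ⊆ ball 0 ρ := ball_subset_ball (by linarith)
  have hgf : ∀ t : ℝ, |t| < ρ → ∀ z, flat g lam (r / 2) (z, (t : ℂ)) = (z, g t z) := by
    intro t ht z
    rw [H.flat_of_im_eq_zero (by rw [ofReal_re]; linarith) (ofReal_im t), ofReal_re]
  have hsq : ∀ t : ℝ, |t| < ρ → (t : ℂ) ∈ square ρ := fun t ht =>
    mem_square.2 ⟨by rwa [ofReal_re], by rwa [ofReal_im, abs_zero]⟩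
  have hmemS : ∀ t : ℝ, |t| < ρ → ∀ z ∈ ball (0 : ℂ) ρ, (z, g t z) ∈ V ∩ S := fun t ht z hz => by
    rw [← hgf t ht]
    exact ⟨hV z hz _ (hsq t ht), (hS z hz _ (hsq t ht)).2 (ofReal_im t)⟩
  have h0ρ := mem_ball_self (x := (0 : ℂ)) hρ
  set χ : ℝ → ℂ := fun t => (Φ (0, g t 0)).2 with hχ
  have hIoo : ∀ t : ℝ, t ∈ Ioo (-ρ) ρ ↔ |t| < ρ := fun t => by rw [mem_Ioo, abs_lt]
  have hχs : ContDiffOn ℝ ∞ χ (Ioo (-ρ) ρ) := by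
    have h1 : ContDiffOn ℝ ∞ (fun t : ℝ => g t 0) (Ioo (-ρ) ρ) :=
      H.smooth.comp (f := fun t : ℝ => (t, (0 : ℂ))) (by fun_prop) fun t ht =>
        ⟨Ioo_subset_Ioo (by linarith) (by linarith) ht, hB h0ρ⟩
    have h2 : ContDiffOn ℝ ∞ (fun t : ℝ => ((0 : ℂ), g t 0)) (Ioo (-ρ) ρ) :=
      contDiffOn_const.prodMk h1
    exact (hCR.1.comp h2 fun t ht => hmemS t ((hIoo t).1 ht) 0 h0ρ).snd
  have hsub : Icc (-(ρ / 2)) (ρ / 2) ⊆ Ioo (-ρ) ρ := Icc_subset_Ioo (by linarith) (by linarith)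
  obtain ⟨L₂, hL₂0, hL₂⟩ := exists_deriv_lipschitz isOpen_Ioo hχs hsub
  have hχ'c : ContinuousOn (deriv χ) (Icc (-(ρ / 2)) (ρ / 2)) :=
    (hχs.continuousOn_deriv_of_isOpen isOpen_Ioo (by simp)).mono hsub
  obtain ⟨M₁, hM₁⟩ := isCompact_Icc.exists_bound_of_continuousOn hχ'c
  have hup : ∀ z ∈ ball (0 : ℂ) ρ, ∀ ζ ∈ square ρ, 0 ≤ ζ.im →
      flat g lam (r / 2) (z, ζ) ∈ V ∩ (U ∪ S) := fun z hz ζ hζ h => by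
    refine ⟨hV z hz ζ hζ, ?_⟩
    rcases h.lt_or_eq with h | h
    · exact Or.inl ((hU z hz ζ hζ).2 h)
    · exact Or.inr ((hS z hz ζ hζ).2 h.symm)
  have hcl : ∀ ζ ∈ closedRect (ρ / 2), ζ ∈ square ρ ∧ 0 ≤ ζ.im := fun ζ hζ => by
    rw [mem_closedRect] at hζ
    rw [mem_square, abs_of_nonneg hζ.2.1]
    exact ⟨⟨by linarith, by linarith⟩, hζ.2.1⟩
  have hop : ∀ z ∈ ball (0 : ℂ) (ρ / 2), ∀ ζ ∈ rect (ρ / 2),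
      flat g lam (r / 2) (z, ζ) ∈ V ∩ U := fun z hz ζ hζ => by
    have h1 := (hcl ζ (halfRect_subset_closedRect _ (rect_subset_halfRect _ hζ))).1
    exact ⟨hV z (hB2 hz) ζ h1, (hU z (hB2 hz) ζ h1).2 (mem_rect.1 hζ).2.1⟩
  have hholo : ∀ z ∈ ball (0 : ℂ) (ρ / 2),
      ∀ w ∈ shear (fun t => normFam g lam (r / 2) t z) '' rect (ρ / 2),
        DifferentiableAt ℂ (fun p : ℂ × ℂ => (Φ (p.1, lam * p.2)).2) (z, w) := by
    rintro z hz _ ⟨ζ, hζ, rfl⟩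
    have h1 := hd.differentiableAt (hVU.mem_nhds (hop z hz ζ hζ))
    have h2 : DifferentiableAt ℂ (fun p : ℂ × ℂ => (p.1, lam * p.2))
        (z, shear (fun t => normFam g lam (r / 2) t z) ζ) := by fun_prop
    exact (DifferentiableAt.comp (g := Φ) (z, shear (fun t => normFam g lam (r / 2) t z) ζ)
      h1 h2).snd
  refine ⟨max L₁ L₂, max M₀ M₁, ?_⟩
  have hmemIcc : ∀ t : ℝ, |t| ≤ ρ / 2 → t ∈ Icc (-(ρ / 2)) (ρ / 2) := fun t ht => abs_le.1 ht
  have hlt : ∀ t : ℝ, |t| ≤ ρ / 2 → |t| < ρ := fun t ht => by linarith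
  refine
  { pos_ε := by linarith
    data := fun z hz =>
    { nearId := H.nearId (hB (hB2 hz))
      pos := by linarith
      nonneg := hL₂0.trans (le_max_right _ _)
      hasDerivAt_b := fun t ht => H.hasDerivAt_normFam (by linarith) (hB (hB2 hz))
      hasDerivAt_u := fun t ht => ((hχs.differentiableOn (by simp)).differentiableAt
        (isOpen_Ioo.mem_nhds ((hIoo t).2 (hlt t ht)))).hasDerivAt
      lip_b := fun t t' ht ht' => ?_
      lip_u := fun t t' ht ht' => (hL₂ t (hmemIcc t ht) t' (hmemIcc t' ht')).trans
        (mul_le_mul_of_nonneg_right (le_max_right _ _) (abs_nonneg _))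
      bound_u := fun t ht => (hM₁ t (hmemIcc t ht)).trans (le_max_right _ _)
      holo := fun w hw => ?_
      cont := ?_
      bound := ?_
      boundary := fun t ht => ?_ }
    real := fun t ht => hre _ (hmemS t (hlt t ht) 0 h0ρ)
    im_pos := ?_
    cont_gt := (hGs.continuousOn.continuousAt (hOo.mem_nhds
      ⟨by simpa using hr, mem_ball_self hε⟩) : ContinuousAt G (0, 0))
    cont_g := fun t => (H.continuousOn_normFam_right t).mono (hB2.trans hB)
    holo_g := fun t ht => ?_
    holo_h := hholo
    smooth_coeff := fun k => ?_ }
  · have hz' := ball_subset_closedBall hz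
    have h1 := hL₁.dist_le_mul (t, z) ⟨hmemIcc t ht, hz'⟩ (t', z) ⟨hmemIcc t' ht', hz'⟩
    rw [Prod.dist_eq, dist_self, max_eq_left dist_nonneg, Real.dist_eq, dist_eq_norm] at h1
    exact h1.trans (mul_le_mul_of_nonneg_right (le_max_left _ _) (abs_nonneg _))
  · have h2 : DifferentiableAt ℂ (fun w : ℂ => (z, w)) w := by fun_prop
    exact (DifferentiableAt.comp (g := fun p : ℂ × ℂ => (Φ (p.1, lam * p.2)).2) w
      (hholo z hz w hw) h2).differentiableWithinAt
  · have h1 : ContinuousOn (fun w : ℂ => (z, lam * w))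
        (shear (fun t => normFam g lam (r / 2) t z) '' closedRect (ρ / 2)) := by fun_prop
    refine (hc.comp h1 ?_).snd
    rintro _ ⟨ζ, hζ, rfl⟩
    exact hup z (hB2 hz) ζ (hcl ζ hζ).1 (hcl ζ hζ).2
  · rintro _ ⟨ζ, hζ, rfl⟩
    exact (norm_snd_le _).trans ((hM₀ z (hB2 hz) ζ (hcl ζ hζ).1
      (hup z (hB2 hz) ζ (hcl ζ hζ).1 (hcl ζ hζ).2).2).trans (le_max_left _ _))
  -- The boundary value on the leaf `t` is the same for all `z` because the second component of `Φ`
  -- is real and CR on `S`.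
  · simp only [H.lam_mul_normFam (show |t| ≤ r / 2 by linarith)]
    exact snd_eq_of_mem hCR hre
      ((H.holo t (abs_lt.1 (by linarith [hlt t ht]))).mono hB) (hmemS t (hlt t ht)) (hB2 hz)
  · rintro z hz _ ⟨ζ, hζ, rfl⟩
    exact hpos _ (hop z hz ζ hζ)
  · have h1 := ((H.holo t (abs_lt.1 (by linarith))).mono (hB2.trans hB)).div_const lam
    exact h1.congr fun z _ => H.normFam_eq (by linarith) z
  · have h1 := (contDiffOn_iteratedDeriv_leaf isOpen_Ioo isOpen_ball H.smooth H.holo k).1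
    have h2 : ContDiffOn ℝ ∞ (fun t : ℝ => iteratedDeriv k (g t) 0 / lam)
        (Ioo (-(ρ / 2)) (ρ / 2)) :=
      (h1.comp (f := fun t : ℝ => (t, (0 : ℂ))) (by fun_prop) fun t ht =>
        ⟨Ioo_subset_Ioo (by linarith) (by linarith) ht, mem_ball_self hε⟩).div_const lam
    exact h2.congr fun t ht => H.iteratedDeriv_normFam (by linarith [abs_lt.2 ht]) k 0

end LeafGraph

lemma IsLeafParam.mem {S : Set (ℂ × ℂ)} {δ ε : ℝ} {N : Set (ℂ × ℂ)} {g : ℝ → ℂ → ℂ}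
    (H : IsLeafParam S δ ε N g) {t : ℝ} (ht : t ∈ Ioo (-δ) δ) {z : ℂ} (hz : z ∈ ball (0 : ℂ) ε) :
    (z, g t z) ∈ S ∩ N := by
  rw [← H.image]
  exact ⟨(t, z), ⟨ht, hz⟩, rfl⟩

lemma IsLeafParam.exists_eq {S : Set (ℂ × ℂ)} {δ ε : ℝ} {N : Set (ℂ × ℂ)} {g : ℝ → ℂ → ℂ}
    (H : IsLeafParam S δ ε N g) {z w : ℂ} (h : (z, w) ∈ S ∩ N) :
    z ∈ ball (0 : ℂ) ε ∧ ∃ t ∈ Ioo (-δ) δ, g t z = w := by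
  rw [← H.image] at h
  obtain ⟨⟨t, z'⟩, ⟨ht, hz'⟩, he⟩ := h
  simp only [Prod.mk.injEq] at he
  obtain ⟨rfl, he⟩ := he
  exact ⟨hz', t, ht, he⟩

/-- The point is on the transversal, so `Function.invFunOn` does return a parameter in the interval
of a leaf through it rather than a default value. -/
lemma IsLeafParam.exists_leafCoeff {S : Set (ℂ × ℂ)} {δ ε : ℝ} {N : Set (ℂ × ℂ)} {g : ℝ → ℂ → ℂ}
    (H : IsLeafParam S δ ε N g) {w : ℂ} (h : ((0 : ℂ), w) ∈ S ∩ N) (k : ℕ) :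
    ∃ t ∈ Ioo (-δ) δ, g t 0 = w ∧
      leafCoeff g δ k w = iteratedDeriv k (g t) 0 / (k.factorial : ℂ) := by
  have h0 : ∀ t, paramCoeff g 0 t = g t 0 := fun t => by simp [paramCoeff]
  obtain ⟨-, t, ht, he⟩ := H.exists_eq h
  have hex : ∃ t ∈ Ioo (-δ) δ, paramCoeff g 0 t = w := ⟨t, ht, (h0 t).trans he⟩
  exact ⟨_, Function.invFunOn_mem hex, (h0 _).symm.trans (Function.invFunOn_eq hex), rfl⟩

/-- The leaf through a point of the transversal is unique if the leaves are separated by a CR map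
with real second component. -/
lemma IsLeafParam.eventuallyEq {S V : Set (ℂ × ℂ)} {δ ε δ' ε' : ℝ} {N N' : Set (ℂ × ℂ)}
    {g g' : ℝ → ℂ → ℂ} {Φ : ℂ × ℂ → ℂ × ℂ} (H : IsLeafParam S δ ε N g)
    (H' : IsLeafParam S δ' ε' N' g') (hCR : IsSmoothCROn Φ S V)
    (hre : ∀ p ∈ V ∩ S, (Φ p).2.im = 0) (hNV : N ∩ S ⊆ V)
    (hinj : ∀ t t', |t| < δ → |t'| < δ → (Φ (0, g t 0)).2 = (Φ (0, g t' 0)).2 → t = t')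
    {t t' : ℝ} (ht : t ∈ Ioo (-δ) δ) (ht' : t' ∈ Ioo (-δ') δ') (he : g' t' 0 = g t 0) :
    g' t' =ᶠ[𝓝 0] g t := by
  have h0 := mem_ball_self (x := (0 : ℂ)) H.pos_ε
  have h0' := mem_ball_self (x := (0 : ℂ)) H'.pos_ε
  have hmem : ∀ s ∈ Ioo (-δ) δ, ∀ z ∈ ball (0 : ℂ) ε, (z, g s z) ∈ V ∩ S := fun s hs z hz => by
    have := H.mem hs hz
    exact ⟨hNV ⟨this.2, this.1⟩, this.1⟩
  have hc : ContinuousAt (fun z => (z, g' t' z)) (0 : ℂ) :=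
    continuousAt_id.prodMk ((H'.holo t' ht').continuousOn.continuousAt (isOpen_ball.mem_nhds h0'))
  have hN : ∀ᶠ z in 𝓝 (0 : ℂ), z ∈ ball (0 : ℂ) ε' ∧ (z, g' t' z) ∈ N :=
    (isOpen_ball.eventually_mem h0').and
      (hc.eventually (H.isOpen.mem_nhds (by simpa only [he] using (H.mem ht h0).2)))
  obtain ⟨η, hη, hηN⟩ := Metric.eventually_nhds_iff_ball.1 hN
  filter_upwards [ball_mem_nhds (0 : ℂ) hη] with z hz
  have hS : ∀ z ∈ ball (0 : ℂ) η, (z, g' t' z) ∈ S := fun z hz => (H'.mem ht' (hηN z hz).1).1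
  -- A point of the second leaf near `0` lies on some leaf `g s` of the first family. The second
  -- component of `Φ` is constant on both curves, so `g s` and `g t` have the same level and `s =
  -- t`.
  obtain ⟨hzε, s, hs, hsz⟩ := H.exists_eq ⟨hS z hz, (hηN z hz).2⟩
  have h1 := snd_eq_of_mem hCR hre ((H'.holo t' ht').mono fun z hz => (hηN z hz).1)
    (fun z hz => ⟨hNV ⟨(hηN z hz).2, hS z hz⟩, hS z hz⟩) hz
  have h2 := snd_eq_of_mem hCR hre (H.holo s hs) (hmem s hs) hzε
  rw [hsz, h1, he] at h2
  rw [← hsz, hinj t s (abs_lt.2 ht) (abs_lt.2 hs) h2]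

end LeviFlat

/-! ### Conclusion. -/

theorem mainTheorem3 (S U : Set (ℂ × ℂ))
    (hS : LeviFlat.IsLeviFlatGerm S U)
    (hH : LeviFlat.complexTangent S 0 = {v : ℂ × ℂ | v.2 = 0})
    (htriv : LeviFlat.IsTrivial S U) :
    ∃ W : Set (ℂ × ℂ), IsOpen W ∧ (0 : ℂ × ℂ) ∈ W ∧
      (∃ (δ ε : ℝ) (N : Set (ℂ × ℂ)) (g : ℝ → ℂ → ℂ),
        LeviFlat.IsLeafParam S δ ε N g ∧ W ⊆ N) ∧
      ∀ k : ℕ, 1 ≤ k → ∃ f : ℂ → ℂ,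
        DifferentiableOn ℂ f {w : ℂ | ((0 : ℂ), w) ∈ W ∩ U} ∧
        ContDiffOn ℝ ∞ f {w : ℂ | ((0 : ℂ), w) ∈ W ∩ (U ∪ S)} ∧
        ∀ (δ ε : ℝ) (N : Set (ℂ × ℂ)) (g : ℝ → ℂ → ℂ), LeviFlat.IsLeafParam S δ ε N g →
          ∀ w : ℂ, ((0 : ℂ), w) ∈ S ∩ W ∩ N → f w = LeviFlat.leafCoeff g δ k w := by
  obtain ⟨r, ε, g, lam, ρ₀, H, hρ₀, hρ₀r, hρ₀ε, hSiff₀, hUiff₀⟩ :=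
    LeviFlat.exists_oriented_leafGraph hS hH
  obtain ⟨V, V₂, Φ, Ψ, hV, h0V, -, -, hmap, -, -, hd, -, hc, hmapS, hCR⟩ := htriv
  have hUo : IsOpen U := by
    obtain ⟨-, -, -, -, -, -, -, -, h, -⟩ := hS
    exact h
  have hre : ∀ p ∈ V ∩ S, (Φ p).2.im = 0 := fun p hp => (hmapS hp).2
  -- Continuity of `Φ` at `0` on `U ∪ S` provides the bound `M₀ = ‖Φ 0‖ + 1` on a small box
  -- contained in `V`.
  have hA : {x : ℂ × ℂ | x ∈ V ∧ (x ∈ U ∪ S → ‖Φ x‖ ≤ ‖Φ 0‖ + 1)} ∈ nhds (0 : ℂ × ℂ) := by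
    have h1 : ContinuousWithinAt (fun x => ‖Φ x‖) (V ∩ (U ∪ S)) 0 :=
      (hc 0 ⟨h0V, Or.inr hS.1⟩).norm
    have h2 := eventually_nhdsWithin_iff.1 (h1.eventually_lt_const (lt_add_one ‖Φ 0‖))
    filter_upwards [h2, hV.mem_nhds h0V] with x hx hxV
    exact ⟨hxV, fun h => (hx ⟨hxV, h⟩).le⟩
  obtain ⟨ρ₁, hρ₁, -, -, hsmall⟩ := H.exists_small hA
  obtain ⟨ρ, hρ, hρ₀', hρ₁'⟩ : ∃ ρ > 0, ρ ≤ ρ₀ ∧ ρ ≤ ρ₁ :=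
    ⟨min ρ₀ ρ₁, lt_min hρ₀ hρ₁, min_le_left _ _, min_le_right _ _⟩
  have hsq : ∀ {τ τ' : ℝ}, τ ≤ τ' → LeviFlat.square τ ⊆ LeviFlat.square τ' := fun h ζ hζ => by
    rw [LeviFlat.mem_square] at *
    exact ⟨hζ.1.trans_le h, hζ.2.trans_le h⟩
  have hSiff := fun z (hz : z ∈ Metric.ball (0 : ℂ) ρ) ζ (hζ : ζ ∈ LeviFlat.square ρ) =>
    hSiff₀ z (Metric.ball_subset_ball hρ₀' hz) ζ (hsq hρ₀' hζ)
  have hUiff := fun z (hz : z ∈ Metric.ball (0 : ℂ) ρ) ζ (hζ : ζ ∈ LeviFlat.square ρ) =>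
    hUiff₀ z (Metric.ball_subset_ball hρ₀' hz) ζ (hsq hρ₀' hζ)
  have hAρ := fun z (hz : z ∈ Metric.ball (0 : ℂ) ρ) ζ (hζ : ζ ∈ LeviFlat.square ρ) =>
    hsmall z (Metric.ball_subset_ball hρ₁' hz) ζ
      ((LeviFlat.mem_square.1 hζ).1.le.trans hρ₁') ((LeviFlat.mem_square.1 hζ).2.le.trans hρ₁')
  obtain ⟨L, M, F⟩ := H.exists_leafFamily hρ (hρ₀'.trans hρ₀r) (hρ₀'.trans hρ₀ε) hSiff hUiff
    (hV.inter hUo) hd (fun p hp => (hmap hp).2) hre hc hCR (fun z hz ζ hζ => (hAρ z hz ζ hζ).1)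
    (fun z hz ζ hζ => (hAρ z hz ζ hζ).2)
  obtain ⟨τ, hτ, hτρ, hinj, hcoeff⟩ := F.exists_coeff
  have hr := H.pos_r
  have P := H.isLeafParam (hρ₀'.trans hρ₀r) (hρ₀'.trans hρ₀ε) hSiff (half_pos hρ)
    (half_le_self hρ.le) hτ (by linarith : τ ≤ ρ)
  have h0 := Metric.mem_ball_self (x := (0 : ℂ)) hρ
  -- `W` is the flattened box of base radius `ρ / 2` and size `τ`, fixed before `k` is introduced.
  refine ⟨_, P.isOpen, P.zero_mem, ⟨τ, ρ / 2, _, g, P, subset_rfl⟩, fun k _ => ?_⟩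
  obtain ⟨f, hf, hf', hfb⟩ := hcoeff k
  have hbox : ∀ w : ℂ, ((0 : ℂ), w) ∈ LeviFlat.LeafGraph.box g lam r (ρ / 2) τ →
      ∃ ζ ∈ LeviFlat.square τ,
        LeviFlat.shear (fun t => LeviFlat.normFam g lam (r / 2) t 0) ζ = w / lam ∧
        (((0 : ℂ), w) ∈ S ↔ ζ.im = 0) ∧ (((0 : ℂ), w) ∈ U ↔ 0 < ζ.im) := by
    intro w hw
    obtain ⟨-, ζ, hζ, he⟩ := hw
    have hfl : LeviFlat.flat g lam (r / 2) (0, ζ) = (0, w) := by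
      refine Prod.ext rfl ?_
      have hl := H.ne_zero
      simp only [LeviFlat.flat] at he ⊢
      rw [he]
      field_simp
    have hζ' := hsq (by linarith : τ ≤ ρ) hζ
    exact ⟨ζ, hζ, he, hfl ▸ hSiff 0 h0 ζ hζ', hfl ▸ hUiff 0 h0 ζ hζ'⟩
  -- The family was rescaled by `1 / lam` in `w`, so its derivatives are those of `g` divided by
  -- `lam`; the factor `lam` undoes this, and `k!` turns the derivative into a Taylor coefficient.
  refine ⟨fun w => lam * f (w / lam) / (k.factorial : ℂ), ?_, ?_, ?_⟩
  · refine ((hf.comp (differentiable_id.div_const lam).differentiableOn ?_).const_mul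
      lam).div_const _
    rintro w ⟨hw, hwU⟩
    obtain ⟨ζ, hζ, he, -, hU⟩ := hbox w hw
    rw [LeviFlat.mem_square] at hζ
    exact ⟨ζ, LeviFlat.mem_rect.2 ⟨hζ.1, hU.1 hwU, (le_abs_self _).trans_lt hζ.2⟩, he⟩
  · have h1 : ContDiffOn ℝ ∞ (fun w : ℂ => w / lam)
        {w : ℂ | ((0 : ℂ), w) ∈ LeviFlat.LeafGraph.box g lam r (ρ / 2) τ ∩ (U ∪ S)} :=
      (contDiff_id.div_const lam).contDiffOn
    refine (contDiffOn_const.mul (hf'.comp h1 ?_)).div_const _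
    rintro w ⟨hw, hwU⟩
    obtain ⟨ζ, hζ, he, hS', hU⟩ := hbox w hw
    rw [LeviFlat.mem_square] at hζ
    have him : 0 ≤ ζ.im := hwU.elim (fun h => (hU.1 h).le) fun h => (hS'.1 h).ge
    exact ⟨ζ, LeviFlat.mem_halfRect.2 ⟨hζ.1, him, (le_abs_self _).trans_lt hζ.2⟩, he⟩
  · rintro δ' ε' N' g' P' w ⟨⟨hwS, hwW⟩, hwN⟩
    obtain ⟨t', ht', he', hc'⟩ := P'.exists_leafCoeff ⟨hwS, hwN⟩ k
    obtain ⟨-, t, ht, he⟩ := P.exists_eq ⟨hwS, hwW⟩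
    have htτ := abs_lt.2 ht
    have htr : |t| ≤ r / 2 := by linarith
    have hNV : LeviFlat.LeafGraph.box g lam r (ρ / 2) τ ∩ S ⊆ V := by
      rintro x ⟨hx, -⟩
      obtain ⟨z, hz, ζ, hζ, rfl⟩ := H.mem_box.1 hx
      exact (hAρ z (Metric.ball_subset_ball (by linarith) hz) ζ
        (hsq (by linarith : τ ≤ ρ) hζ)).1
    -- The leaf of an arbitrary parametrization through `(0, w)` has the same germ at `z = 0` as the
    -- leaf of the constructed one, hence the same coefficients.
    have heq := P.eventuallyEq P' hCR hre hNV hinj ht ht' (he'.trans he.symm)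
    have hl := H.ne_zero
    simp only
    rw [hc', heq.iteratedDeriv_eq k, ← he, ← H.normFam_eq htr, hfb t htτ,
      H.iteratedDeriv_normFam htr]
    field_simp
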